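/- Let $\mathcal P$ be a countable set (the prime elements) with a map $N:\mathcal P\to\{2,3,4,\dots\}$. Let $\mathcal M$ be the free abelian monoid on $\mathcal P$, whose elements are the formal sums $\mathfrak m=\sum_{\mathfrak p} n_{\mathfrak p}(\mathfrak m)\,\mathfrak p$ with multiplicities $n_{\mathfrak p}(\mathfrak m)\in\{0,1,2,\dots\}$, almost all zero. Put $N(\mathfrak m)=\prod_{\mathfrak p}N(\mathfrak p)^{n_{\mathfrak p}(\mathfrak m)}$ and $\Omega(\mathfrak m)=\sum_{\mathfrak p}n_{\mathfrak p}(\mathfrak m)$. Let $X\subseteq\mathbb Q$ contain $N(\mathfrak m)$ for all $\mathfrak m\in\mathcal M$ and be closed under quotients. Suppose that there are $\kappa>0$ and $0\le\theta<1$ with $$\#\{\mathfrak m\in\mathcal M: N(\mathfrak m)\le x\}=\kappa x+O(x^\theta)\qquad(x\to\infty,\ x\in X).$$ Let $h\ge2$ be an integer, call $\mathfrak m$ $h$-free if $n_{\mathfrak p}(\mathfrak m)\le h-1$ for all $\mathfrak p$, and let $\mathcal S_h(x)$ be the set of $h$-free $\mathfrak m$ with $N(\mathfrak m)\le x$. Put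 $\zeta_{\mathcal M}(s)=\sum_{\mathfrak m\in\mathcal M}N(\mathfrak m)^{-s}$, $$\mathfrak A=\lim_{x\to\infty,\,x\in X}\Big(\sum_{N(\mathfrak p)\le x}\frac1{N(\mathfrak p)}-\log\log x\Big),\qquad \mathfrak B=-\frac{\pi^2}6,$$ and, writing $n=N(\mathfrak p)$ in the sums over $\mathfrak p\in\mathcal P$, $$\mathfrak C_3=\mathfrak A+\sum_{\mathfrak p}\frac{n^h-hn^2+hn-1}{n(n-1)(n^h-1)},$$ $$\mathfrak C_3'=\mathfrak A+\sum_{\mathfrak p}\frac{n^h(3n-1)+(n-1)^2-n\big(h^2n^2+(-2h^2+2h+1)n+(h-1)^2\big)}{n(n-1)^2(n^h-1)},$$ $$\mathfrak C_4=\mathfrak C_3^2+\mathfrak C_3'+\mathfrak B-\sum_{\mathfrak p}\Big(\frac{n^h-hn+h-1}{(n-1)(n^h-1)}\Big)^2 .$$ Then $\{\mathfrak m\in\mathcal M:N(\mathfrak m)\le x\}$ is finite for every $x\in\mathbb Q$, the limit $\mathfrak A$ exists, the series for $\zeta_{\mathcal M}(h)$ and the three series over $\mathfrak p$ converge absolutely,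 and, as $x\to\infty$ in $X$, $$\sum_{\mathfrak m\in\mathcal S_h(x)}\Omega(\mathfrak m)=\frac{\kappa}{\zeta_{\mathcal M}(h)}x\log\log x+\frac{\kappa\,\mathfrak C_3}{\zeta_{\mathcal M}(h)}x+O_h\Big(\frac x{\log x}\Big),$$ $$\sum_{\mathfrak m\in\mathcal S_h(x)}\Omega(\mathfrak m)^2=\frac{\kappa}{\zeta_{\mathcal M}(h)}x(\log\log x)^2+\frac{\kappa(2\mathfrak C_3+1)}{\zeta_{\mathcal M}(h)}x\log\log x+\frac{\kappa\,\mathfrak C_4}{\zeta_{\mathcal M}(h)}x+O_h\Big(\frac{x\log\log x}{\log x}\Big).$$ -/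

import Mathlib

open Filter Asymptotics Topology

noncomputable section

/-! The free abelian monoid on a type `P` of prime elements is `P →₀ ℕ`, written additively;
the multiplicity of `p` in `m` is `m p`. -/

namespace PrimeMonoid

variable {P : Type*}

/-- The norm of `m = ∑ m p • p`, that is `∏ N(p) ^ (m p)`. -/
def norm (N : P → ℕ) (m : P →₀ ℕ) : ℕ := m.prod fun p k => N p ^ k

/-- The number of prime elements in `m`, counted with multiplicity. -/
def bigOmega (m : P →₀ ℕ) : ℕ := m.sum fun _ k => k

/-- The set of elements of norm at most `x`. -/
def normLE (N : P → ℕ) (x : ℚ) : Set (P →₀ ℕ) := {m | (norm N m : ℚ) ≤ x}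

/-- `m` is `h`-free: all multiplicities are at most `h - 1`. -/
def IsHFree (h : ℕ) (m : P →₀ ℕ) : Prop := ∀ p, m p < h

/-- The set of `h`-free elements of norm at most `x`. -/
def hFreeLE (N : P → ℕ) (h : ℕ) (x : ℚ) : Set (P →₀ ℕ) := {m | IsHFree h m ∧ m ∈ normLE N x}

/-- `x → ∞` through the set `X`. -/
def toInf (X : Set ℚ) : Filter ℚ := atTop ⊓ 𝓟 X

/-- `X` contains all norms and is closed under quotients, and the number of elements of norm at
most `x` is `κ x + O(x ^ θ)` for `x ∈ X` large. (`Set.ncard` is `0` on infinite sets, so the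
asymptotic formula cannot hold when these sets are infinite.) -/
structure ConditionStar (N : P → ℕ) (X : Set ℚ) (κ θ : ℝ) : Prop where
  norm_mem : ∀ m : P →₀ ℕ, (norm N m : ℚ) ∈ X
  div_mem : ∀ x₁ ∈ X, ∀ x₂ ∈ X, x₁ / x₂ ∈ X
  kappa_pos : 0 < κ
  theta_nonneg : 0 ≤ θ
  theta_lt_one : θ < 1
  count : (fun x : ℚ => ((normLE N x).ncard : ℝ) - κ * (x : ℝ)) =O[toInf X]
    fun x : ℚ => (x : ℝ) ^ θ

/-- The zeta function `∑ N(m) ^ (-s)` of the monoid (at a real argument); the sum is over all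
elements, including the zero element, which has norm `1`. -/
def zeta (N : P → ℕ) (s : ℝ) : ℝ := ∑' m : P →₀ ℕ, (norm N m : ℝ) ^ (-s)

/-- `∑_{N(p) ≤ x} 1 / N(p) - log log x`. -/
def mertensDiff (N : P → ℕ) (x : ℚ) : ℝ :=
  (∑ᶠ (p : P) (_ : (N p : ℚ) ≤ x), 1 / (N p : ℝ)) - Real.log (Real.log (x : ℝ))

/-- The constant `𝔄`. -/
def constA (N : P → ℕ) (X : Set ℚ) : ℝ := limUnder (toInf X) (mertensDiff N)

/-- The constant `𝔅`. -/
def constB : ℝ := -(Real.pi ^ 2 / 6)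

/-- The summand of `𝔆₃` at a prime element of norm `n`. -/
def termC3 (h : ℕ) (n : ℝ) : ℝ :=
  (n ^ h - h * n ^ 2 + h * n - 1) / (n * (n - 1) * (n ^ h - 1))

/-- The summand of `𝔆₃'` at a prime element of norm `n`. -/
def termC3' (h : ℕ) (n : ℝ) : ℝ :=
  (n ^ h * (3 * n - 1) + (n - 1) ^ 2
      - n * ((h : ℝ) ^ 2 * n ^ 2 + (-2 * (h : ℝ) ^ 2 + 2 * h + 1) * n + ((h : ℝ) - 1) ^ 2))
    / (n * (n - 1) ^ 2 * (n ^ h - 1))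

/-- The summand of the last series in `𝔆₄` at a prime element of norm `n`. -/
def termC4 (h : ℕ) (n : ℝ) : ℝ :=
  ((n ^ h - h * n + h - 1) / ((n - 1) * (n ^ h - 1))) ^ 2

/-- The constant `𝔆₃`. -/
def constC3 (N : P → ℕ) (X : Set ℚ) (h : ℕ) : ℝ := constA N X + ∑' p : P, termC3 h (N p)

/-- The constant `𝔆₃'`. -/
def constC3' (N : P → ℕ) (X : Set ℚ) (h : ℕ) : ℝ := constA N X + ∑' p : P, termC3' h (N p)

/-- The constant `𝔆₄`. -/
def constC4 (N : P → ℕ) (X : Set ℚ) (h : ℕ) : ℝ :=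
  constC3 N X h ^ 2 + constC3' N X h + constB - ∑' p : P, termC4 h (N p)

end PrimeMonoid

end

/-!
The number of elements of norm at most `x` is `κ x + O(x ^ θ)`, but only for `x` in the set `X`.
For arguments off `X` the argument is rounded down to `X` (`floorIn`). As `X` is closed under
quotients, this rounding is homogeneous under multiplication by positive elements of `X`
(`Regular.floorIn_mul`), and `x / N(d)` stays in `X` for `x` in `X`.

*Mertens.* With this, integrals of the counting function give `∑ log N(m)` and `∑ 1 / N(m)` with
power-saving errors (`Regular.exists_sum_log`, `Regular.exists_sum_inv`). Some combination `log
N(m) - β (y / N(m)) - γ` has sums `O(y ^ η)` with `η < 1`. Its Möbius transform is `ψ(x) - β x -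
γ`, so that the trivial bound `|μ| ≤ 1` already gives Chebyshev's estimate `ψ(x) = O(x)`
(`Regular.exists_psi_le`). Expanding `log N(m)` over the prime powers dividing `m` and summing by
parts leads to `∑ 1 / N(p) = log log t + A + O(1 / log t)` (`Regular.exists_mertens`), and the
convergent sum over higher prime powers shifts the constant (`Regular.exists_ppSum_sub_le`).

*Moments over all elements.* `Ω(m)` is the number of prime powers `q` dividing `m`, so its first
moment is asymptotically `κ x ∑ 1 / N(q)`. For the second moment, `Ω(m) ^ 2` leads to the sum of
`1 / (N(q) N(q'))` over pairs of prime powers with `N(q) N(q') ≤ x`. Grouping prime powers into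
dyadic blocks compares this sum with `∑ 1 / (i j)` over `i + j ≤ n`, which is the square of the
harmonic sum minus `π ^ 2 / 6` up to a small error (`exists_convolution`). This is the source of
the constant `𝔅`.

*Passage to `h`-free elements.* The `h`-free elements are detected by `∑ μ(d)` over `d` with `h d
≤ m`; writing `m = h d + m'` and `Ω(m) = h Ω(d) + Ω(m')` reduces the moments to those above at `x
/ N(d) ^ h`, and to the series `∑ μ(d) Ω(d) ^ j / N(d) ^ h` with `j ≤ 2`
(`Regular.exists_hFree_omega`, `Regular.exists_hFree_omega_sq`). The series `∑ μ(d) z ^ Ω(d) /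
N(d) ^ h` is the inverse of `∑ z ^ Ω(m) / N(m) ^ h`, so its derivatives in `z` are computed from
those of the latter (`Regular.mobSum_eq`). Summing geometric series over the powers of each prime
gives the constants as sums over primes (`Regular.hasSum_termC3`, `Regular.hasSum_termC3'`).

When there are no prime elements, the counting hypothesis forces `X` to be bounded above, and the
asymptotic statements hold because the filter `x → ∞` in `X` is trivial.
-/

open Filter Asymptotics Topology

noncomputable section

namespace PrimeMonoid

open scoped Classical

section

/-! ### Elements of bounded norm, prime powers and Möbius inversion -/

variable {P : Type*}

/-- All prime elements have norm at least `2`, and there are finitely many elements of bounded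
norm. -/
class NormFinite (N : P → ℕ) : Prop where
  two_le : ∀ p, 2 ≤ N p
  finite : ∀ t : ℝ, {m : P →₀ ℕ | (norm N m : ℝ) ≤ t}.Finite

variable (N : P → ℕ)

/-- The norm of an element as a real number. -/
def size (m : P →₀ ℕ) : ℝ := (norm N m : ℝ)

lemma size_zero : size N 0 = 1 := by simp [size, norm]

lemma size_add (m n : P →₀ ℕ) : size N (m + n) = size N m * size N n := by
  unfold size norm
  rw [Finsupp.prod_add_index' (fun _ => pow_zero _) (fun _ _ _ => pow_add _ _ _)]
  push_cast; rfl

lemma size_nsmul (h : ℕ) (m : P →₀ ℕ) : size N (h • m) = size N m ^ h := by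
  induction h with
  | zero => simp [size_zero]
  | succ k ih => rw [succ_nsmul, size_add, ih, pow_succ]

/-- The prime power with exponent `k + 1` of the prime `p`, indexed by the pair `(p, k)`. The
shift makes the indexing injective. -/
def primePow (q : P × ℕ) : P →₀ ℕ := Finsupp.single q.1 (q.2 + 1)

/-- The norm of the prime power indexed by `q`. -/
def ppSize (q : P × ℕ) : ℝ := (N q.1 : ℝ) ^ (q.2 + 1)

lemma size_primePow (q : P × ℕ) : size N (primePow q) = ppSize N q := by
  unfold size norm primePow ppSize
  rw [Finsupp.prod_single_index (h := fun p k => N p ^ k) (pow_zero _)]; push_cast; rfl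

lemma primePow_le_iff {q : P × ℕ} {m : P →₀ ℕ} : primePow q ≤ m ↔ q.2 < m q.1 := by
  rw [primePow, Finsupp.single_le_iff]; exact Nat.succ_le_iff

lemma primePow_injective : Function.Injective (primePow : P × ℕ → P →₀ ℕ) := by
  rintro ⟨p, k⟩ ⟨p', k'⟩ h
  have := (Finsupp.single_eq_single_iff _ _ _ _).1 h
  simp at this
  ext <;> simp [this]

/-- The completely additive function on the monoid with value `w p` at the prime `p`. -/
def additive (w : P → ℝ) (m : P →₀ ℕ) : ℝ := m.sum fun p k => k * w p

lemma additive_add (w : P → ℝ) (m n : P →₀ ℕ) :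
    additive w (m + n) = additive w m + additive w n := by
  unfold additive
  exact Finsupp.sum_add_index' (fun _ => by simp) (fun _ _ _ => by push_cast; ring)

lemma additive_nsmul (w : P → ℝ) (h : ℕ) (m : P →₀ ℕ) :
    additive w (h • m) = h * additive w m := by
  induction h with
  | zero => simp [additive]
  | succ k ih => rw [succ_nsmul, additive_add, ih]; push_cast; ring

lemma additive_zero (w : P → ℝ) : additive w 0 = 0 := by simp [additive]

lemma additive_primePow (w : P → ℝ) (q : P × ℕ) :
    additive w (primePow q) = (q.2 + 1) * w q.1 := by
  unfold additive primePow
  rw [Finsupp.sum_single_index (by simp)]; push_cast; rfl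

/-- The Möbius function of the monoid. -/
def mob (d : P →₀ ℕ) : ℝ := if ∀ p, d p ≤ 1 then (-1) ^ d.support.card else 0

lemma abs_mob_le (d : P →₀ ℕ) : |mob d| ≤ 1 := by
  unfold mob; split_ifs <;> simp

/-- The squarefree element with the given set of prime divisors. -/
def ofFinset (S : Finset P) : P →₀ ℕ := Finsupp.indicator S fun _ _ => 1

lemma ofFinset_apply (S : Finset P) (p : P) : ofFinset S p = if p ∈ S then 1 else 0 := by
  simp [ofFinset, Finsupp.indicator_apply]

lemma support_ofFinset (S : Finset P) : (ofFinset S).support = S := by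
  ext p; simp [ofFinset_apply]

lemma ofFinset_support {d : P →₀ ℕ} (hd : ∀ p, d p ≤ 1) : ofFinset d.support = d := by
  ext p
  rw [ofFinset_apply]
  have := hd p
  split_ifs with h
  · have := Finsupp.mem_support_iff.1 h; omega
  · exact (Finsupp.notMem_support_iff.1 h).symm

/-- The defining property of the Möbius function, in the form that detects `h`-free elements; for
`h = 1` only the zero element is `h`-free. -/
lemma sum_mob {h : ℕ} (hh : 1 ≤ h) (m : P →₀ ℕ) (s : Finset (P →₀ ℕ))
    (hs : ∀ d, h • d ≤ m → d ∈ s) :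
    ∑ d ∈ s.filter (h • · ≤ m), mob d = if IsHFree h m then 1 else 0 := by
  set S := m.support.filter (h ≤ m ·) with hS
  have memS : ∀ p, p ∈ S ↔ h ≤ m p := by
    intro p; simp only [hS, Finset.mem_filter, Finsupp.mem_support_iff]; omega
  have h1 : ∑ d ∈ s.filter (h • · ≤ m), mob d = ∑ T ∈ S.powerset, ((-1 : ℝ)) ^ T.card := by
    have h2 : ∑ d ∈ s.filter (h • · ≤ m), mob d
        = ∑ d ∈ (s.filter (h • · ≤ m)).filter (fun d => ∀ p, d p ≤ 1),
            (-1 : ℝ) ^ d.support.card := by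
      rw [Finset.sum_filter (p := fun d : P →₀ ℕ => ∀ p, d p ≤ 1)]; rfl
    rw [h2]
    refine Finset.sum_bij' (fun d _ => d.support) (fun T _ => ofFinset T) ?_ ?_ ?_ ?_ ?_
    · intro d hd
      simp only [Finset.mem_filter] at hd
      refine Finset.mem_powerset.2 fun p hp => (memS p).2 ?_
      have h3 := hd.1.2 p
      simp only [Finsupp.smul_apply, smul_eq_mul] at h3
      have h4 := Finsupp.mem_support_iff.1 hp
      nlinarith [Nat.one_le_iff_ne_zero.2 h4]
    · intro T hT
      have h3 : h • ofFinset T ≤ m := by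
        intro p
        simp only [Finsupp.smul_apply, smul_eq_mul, ofFinset_apply]
        split_ifs with hp
        · simpa using (memS p).1 (Finset.mem_powerset.1 hT hp)
        · simp
      simp only [Finset.mem_filter]
      refine ⟨⟨hs _ h3, h3⟩, fun p => ?_⟩
      rw [ofFinset_apply]; split_ifs <;> simp
    · intro d hd
      exact ofFinset_support (Finset.mem_filter.1 hd).2
    · intro T _; exact support_ofFinset T
    · intro d _; rfl
  have h5 := Finset.sum_powerset_neg_one_pow_card (x := S)
  have h6 : ∑ T ∈ S.powerset, ((-1 : ℝ)) ^ T.card = if S = ∅ then 1 else 0 := by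
    have := congrArg (Int.cast : ℤ → ℝ) h5
    push_cast at this
    exact this
  rw [h1, h6]
  congr 1
  simp only [Finset.eq_empty_iff_forall_notMem, memS, IsHFree, not_le]

variable [NormFinite N]

lemma two_le_cast (p : P) : (2 : ℝ) ≤ N p := by exact_mod_cast NormFinite.two_le (N := N) p

lemma one_le_size (m : P →₀ ℕ) : 1 ≤ size N m := by
  unfold size norm
  exact_mod_cast Nat.one_le_iff_ne_zero.2 (Finset.prod_ne_zero_iff.2 fun p _ =>
    pow_ne_zero _ (by have := NormFinite.two_le (N := N) p; omega))

lemma size_pos (m : P →₀ ℕ) : 0 < size N m := lt_of_lt_of_le one_pos (one_le_size N m)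

lemma two_le_ppSize (q : P × ℕ) : 2 ≤ ppSize N q :=
  (two_le_cast N q.1).trans (le_self_pow₀ (by linarith [two_le_cast N q.1]) (by omega))

lemma ppSize_pos (q : P × ℕ) : 0 < ppSize N q := by linarith [two_le_ppSize N q]

/-- The finite set of elements of norm at most `t`. -/
def ball (t : ℝ) : Finset (P →₀ ℕ) := (NormFinite.finite (N := N) t).toFinset

variable {N} in
lemma mem_ball {t : ℝ} {m : P →₀ ℕ} : m ∈ ball N t ↔ size N m ≤ t := by
  simp [ball, size]

/-- The number of elements of norm at most `t`. -/
def count (t : ℝ) : ℝ := (ball N t).card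

lemma ppFinite (t : ℝ) : {q : P × ℕ | ppSize N q ≤ t}.Finite := by
  refine ((ball N t).finite_toSet.preimage primePow_injective.injOn).subset fun q hq => ?_
  simpa [mem_ball, size_primePow] using hq

/-- The finite set of prime powers of norm at most `t`. -/
def ppBall (t : ℝ) : Finset (P × ℕ) := (ppFinite N t).toFinset

variable {N} in
lemma mem_ppBall {t : ℝ} {q : P × ℕ} : q ∈ ppBall N t ↔ ppSize N q ≤ t := by
  simp [ppBall]

lemma ball_mono {s t : ℝ} (h : s ≤ t) : ball N s ⊆ ball N t := fun _ hm =>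
  mem_ball.2 ((mem_ball.1 hm).trans h)

lemma ppBall_mono {s t : ℝ} (h : s ≤ t) : ppBall N s ⊆ ppBall N t := fun _ hm =>
  mem_ppBall.2 ((mem_ppBall.1 hm).trans h)

lemma count_mono : Monotone (count N) := fun _ _ h => by
  unfold count; exact_mod_cast Finset.card_le_card (ball_mono N h)

lemma count_nonneg (t : ℝ) : 0 ≤ count N t := by unfold count; positivity

lemma ball_eq_empty {t : ℝ} (ht : t < 1) : ball N t = ∅ := by
  ext m; simp only [mem_ball, Finset.notMem_empty, iff_false, not_le]
  linarith [one_le_size N m]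

lemma ppBall_eq_empty {t : ℝ} (ht : t < 2) : ppBall N t = ∅ := by
  ext m; simp only [mem_ppBall, Finset.notMem_empty, iff_false, not_le]
  linarith [two_le_ppSize N m]

lemma sum_ball_filter_le (q : P →₀ ℕ) (y : ℝ) (F : (P →₀ ℕ) → ℝ) :
    ∑ m ∈ (ball N y).filter (q ≤ ·), F m = ∑ m ∈ ball N (y / size N q), F (m + q) := by
  symm
  refine Finset.sum_bij (fun m _ => m + q) ?_ ?_ ?_ (fun _ _ => rfl)
  · intro m hm
    rw [mem_ball, le_div_iff₀ (size_pos N q)] at hm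
    simp [mem_ball, size_add, hm]
  · intro a _ b _ h; exact add_right_cancel h
  · intro m hm
    simp only [Finset.mem_filter, mem_ball] at hm
    refine ⟨m - q, ?_, tsub_add_cancel_of_le hm.2⟩
    rw [mem_ball, le_div_iff₀ (size_pos N q), ← size_add, tsub_add_cancel_of_le hm.2]
    exact hm.1


lemma additive_eq_sum (w : P → ℝ) {m : P →₀ ℕ} {y : ℝ} (hm : m ∈ ball N y) :
    additive w m = ∑ q ∈ ppBall N y, if primePow q ≤ m then w q.1 else 0 := by
  have key : ∑ q ∈ (ppBall N y).filter (primePow · ≤ m), w q.1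
      = ∑ p ∈ m.support, ∑ _k ∈ Finset.range (m p), w p := by
    refine Finset.sum_finset_product _ _ _ fun q => ?_
    simp only [Finset.mem_filter, mem_ppBall, primePow_le_iff, Finset.mem_range,
      Finsupp.mem_support_iff]
    constructor
    · rintro ⟨-, h⟩; exact ⟨by omega, h⟩
    · rintro ⟨-, h⟩
      refine ⟨?_, h⟩
      have h1 : primePow q ≤ m := primePow_le_iff.2 h
      rw [← size_primePow]
      refine le_trans ?_ (mem_ball.1 hm)
      conv_rhs => rw [← tsub_add_cancel_of_le h1, size_add]
      exact le_mul_of_one_le_left (size_pos N _).le (one_le_size N _)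
  rw [← Finset.sum_filter, key]
  simp [additive, Finsupp.sum]

/-- Writing an additive function as a sum over the prime powers dividing its argument. -/
lemma sum_additive_mul (w : P → ℝ) (F : (P →₀ ℕ) → ℝ) (y : ℝ) :
    ∑ m ∈ ball N y, additive w m * F m
      = ∑ q ∈ ppBall N y, w q.1 * ∑ m ∈ ball N (y / ppSize N q), F (m + primePow q) := by
  have h1 : ∀ m ∈ ball N y, additive w m * F m
      = ∑ q ∈ ppBall N y, if primePow q ≤ m then w q.1 * F m else 0 := by
    intro m hm
    rw [additive_eq_sum N w hm, Finset.sum_mul]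
    exact Finset.sum_congr rfl fun q _ => by split_ifs <;> simp
  rw [Finset.sum_congr rfl h1, Finset.sum_comm]
  refine Finset.sum_congr rfl fun q _ => ?_
  rw [← size_primePow, ← sum_ball_filter_le, Finset.mul_sum, Finset.sum_filter]

lemma sum_hFree {h : ℕ} (hh : 1 ≤ h) (F : (P →₀ ℕ) → ℝ) (y : ℝ) :
    ∑ m ∈ (ball N y).filter (IsHFree h), F m
      = ∑ d ∈ ball N y, mob d * ∑ m ∈ ball N (y / size N d ^ h), F (m + h • d) := by
  have h1 : ∀ m ∈ ball N y, (if IsHFree h m then F m else 0)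
      = ∑ d ∈ ball N y, if h • d ≤ m then mob d * F m else 0 := by
    intro m hm
    have := sum_mob hh m (ball N y) fun d hd => ?_
    · rw [← Finset.sum_filter, ← Finset.sum_mul, this]; split_ifs <;> simp
    · rw [mem_ball] at hm ⊢
      refine le_trans ?_ hm
      have h2 : size N m = size N (m - h • d) * size N d ^ h := by
        rw [← size_nsmul, ← size_add, tsub_add_cancel_of_le hd]
      rw [h2]
      calc size N d ≤ size N d ^ h := le_self_pow₀ (one_le_size N d) (by omega)
        _ ≤ _ := le_mul_of_one_le_left (by have := size_pos N d; positivity) (one_le_size N _)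
  rw [Finset.sum_filter, Finset.sum_congr rfl h1, Finset.sum_comm]
  refine Finset.sum_congr rfl fun d _ => ?_
  rw [← size_nsmul, ← sum_ball_filter_le, Finset.mul_sum, Finset.sum_filter]

lemma sum_mob_mul (F : (P →₀ ℕ) → ℝ) {y : ℝ} (hy : 1 ≤ y) :
    ∑ d ∈ ball N y, mob d * ∑ m ∈ ball N (y / size N d), F (m + d) = F 0 := by
  have h1 := sum_hFree N le_rfl F y
  simp only [pow_one, one_smul] at h1
  rw [← h1]
  have : (ball N y).filter (IsHFree 1) = {0} := by
    ext m
    simp only [Finset.mem_filter, mem_ball, Finset.mem_singleton, IsHFree, Nat.lt_one_iff]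
    constructor
    · rintro ⟨-, h⟩; ext p; simp [h p]
    · rintro rfl; simpa [size_zero] using hy
  rw [this, Finset.sum_singleton]

end

section

/-! ### The counting function off the set of admissible arguments -/

/-- A dyadic decomposition: if the weights `u` have partial sums `O(t)` with respect to the sizes
`n`, then smoothing the cut-off at `y` by the factor `(y / n) ^ θ` with `θ < 1` costs only a
constant. -/
lemma sum_mul_div_rpow_le {ι : Type*} (s : Finset ι) (n u : ι → ℝ) {y K θ : ℝ} (hθ0 : 0 ≤ θ)
    (hθ1 : θ < 1) (hy : 0 < y) (hu : ∀ i ∈ s, 0 ≤ u i) (hn : ∀ i ∈ s, 0 < n i ∧ n i ≤ y)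
    (hK : ∀ t, 0 < t → t ≤ y → ∑ i ∈ s.filter (n · ≤ t), u i ≤ K * t) :
    ∑ i ∈ s, u i * (y / n i) ^ θ ≤ 2 ^ θ * (1 - 2 ^ (θ - 1))⁻¹ * K * y := by
  have hex : ∀ i, ∃ j : ℕ, i ∈ s → (2 : ℝ) ^ j ≤ y / n i ∧ y / n i < 2 ^ (j + 1) := by
    intro i
    by_cases hi : i ∈ s
    · obtain ⟨j, hj⟩ := exists_nat_pow_near (x := y / n i) (y := 2)
        ((one_le_div (hn i hi).1).2 (hn i hi).2) one_lt_two
      exact ⟨j, fun _ => hj⟩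
    · exact ⟨0, fun h => absurd h hi⟩
  choose j hj using hex
  have h2θ : (0 : ℝ) < 2 ^ θ := by positivity
  have hKy : 0 ≤ K * y := (Finset.sum_nonneg fun i hi => hu i (Finset.mem_filter.1 hi).1).trans
    (hK y hy le_rfl)
  set J := s.sup j + 1
  have h1 : ∀ i ∈ s, u i * (y / n i) ^ θ
      ≤ 2 ^ θ * ∑ l ∈ Finset.range J, ((2 : ℝ) ^ θ) ^ l * if n i ≤ y / 2 ^ l then u i else 0 := by
    intro i hi
    have hni := (hn i hi).1
    have hle : n i ≤ y / 2 ^ j i := by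
      rw [le_div_iff₀ (by positivity), mul_comm]; exact (le_div_iff₀ hni).1 (hj i hi).1
    have h3 : ((2 : ℝ) ^ θ) ^ (j i) * u i
        ≤ ∑ l ∈ Finset.range J, ((2 : ℝ) ^ θ) ^ l * if n i ≤ y / 2 ^ l then u i else 0 := by
      have := Finset.single_le_sum (f := fun l => ((2 : ℝ) ^ θ) ^ l *
        if n i ≤ y / 2 ^ l then u i else 0) (fun l _ => ?_)
        (Finset.mem_range.2 (Nat.lt_succ_of_le (Finset.le_sup hi)) : j i ∈ Finset.range J)
      · simpa [hle] using this
      · refine mul_nonneg (by positivity) ?_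
        split_ifs
        exacts [hu i hi, le_rfl]
    have h4 : (y / n i) ^ θ ≤ 2 ^ θ * ((2 : ℝ) ^ θ) ^ (j i) := by
      calc (y / n i) ^ θ ≤ ((2 : ℝ) ^ (j i + 1)) ^ θ :=
            Real.rpow_le_rpow (by positivity) (hj i hi).2.le hθ0
        _ = ((2 : ℝ) ^ θ) ^ (j i + 1) := by
            rw [← Real.rpow_natCast, ← Real.rpow_mul zero_le_two, mul_comm,
              Real.rpow_mul zero_le_two, Real.rpow_natCast]
        _ = _ := by ring
    calc u i * (y / n i) ^ θ ≤ u i * (2 ^ θ * ((2 : ℝ) ^ θ) ^ (j i)) :=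
          mul_le_mul_of_nonneg_left h4 (hu i hi)
      _ = 2 ^ θ * (((2 : ℝ) ^ θ) ^ (j i) * u i) := by ring
      _ ≤ _ := mul_le_mul_of_nonneg_left h3 h2θ.le
  have hr : (2 : ℝ) ^ (θ - 1) < 1 := Real.rpow_lt_one_of_one_lt_of_neg one_lt_two (by linarith)
  have hr0 : (0 : ℝ) ≤ 2 ^ (θ - 1) := by positivity
  calc ∑ i ∈ s, u i * (y / n i) ^ θ
      ≤ ∑ i ∈ s, 2 ^ θ * ∑ l ∈ Finset.range J, ((2 : ℝ) ^ θ) ^ l *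
          if n i ≤ y / 2 ^ l then u i else 0 := Finset.sum_le_sum h1
    _ = 2 ^ θ * ∑ l ∈ Finset.range J, ((2 : ℝ) ^ θ) ^ l *
          ∑ i ∈ s.filter (n · ≤ y / 2 ^ l), u i := by
        rw [← Finset.mul_sum, Finset.sum_comm]
        simp only [Finset.mul_sum, Finset.sum_filter]
    _ ≤ 2 ^ θ * ∑ l ∈ Finset.range J, ((2 : ℝ) ^ θ) ^ l * (K * (y / 2 ^ l)) := by
        gcongr with l _
        exact hK _ (by positivity) (div_le_self hy.le (one_le_pow₀ one_le_two))
    _ = 2 ^ θ * (∑ l ∈ Finset.range J, ((2 : ℝ) ^ (θ - 1)) ^ l) * (K * y) := by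
        rw [mul_assoc, Finset.sum_mul]
        congr 1
        refine Finset.sum_congr rfl fun l _ => ?_
        rw [Real.rpow_sub_one two_ne_zero, div_pow]
        ring
    _ ≤ 2 ^ θ * (1 - 2 ^ (θ - 1))⁻¹ * (K * y) := by
        gcongr
        exact (summable_geometric_of_lt_one hr0 hr).sum_le_tsum _ (fun _ _ => by positivity)
          |>.trans_eq (tsum_geometric_of_lt_one hr0 hr)
    _ = _ := by ring

variable {P : Type*}

/-- The counting hypothesis in the form in which it is used: `Y` is a set of positive reals closed
under quotients that contains all norms, and the counting formula holds at every point of `Y`,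
with an explicit constant. -/
structure Regular (N : P → ℕ) [NormFinite N] (Y : Set ℝ) (κ θ K : ℝ) : Prop where
  pos : ∀ y ∈ Y, 0 < y
  size_mem : ∀ m, size N m ∈ Y
  div_mem : ∀ x ∈ Y, ∀ y ∈ Y, x / y ∈ Y
  kappa_pos : 0 < κ
  theta_pos : 0 < θ
  theta_lt : θ < 1
  count_le : ∀ y ∈ Y, |count N y - κ * y| ≤ K * y ^ θ

variable {N : P → ℕ} [NormFinite N] {Y : Set ℝ} {κ θ K : ℝ}

/-- The supremum of the elements of `Y` up to `t`; it need not lie in `Y`. If there are none, it is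
the junk value `sSup ∅ = 0`. -/
def floorIn (Y : Set ℝ) (t : ℝ) : ℝ := sSup {x | x ∈ Y ∧ x ≤ t}

lemma bddAbove_floorIn (t : ℝ) : BddAbove {x | x ∈ Y ∧ x ≤ t} :=
  ⟨t, fun _ hx => hx.2⟩

lemma le_floorIn {x t : ℝ} (hx : x ∈ Y) (hxt : x ≤ t) : x ≤ floorIn Y t :=
  le_csSup (bddAbove_floorIn t) ⟨hx, hxt⟩

namespace Regular

variable (R : Regular N Y κ θ K)
include R

lemma one_mem : 1 ∈ Y := size_zero N ▸ R.size_mem 0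

lemma mul_mem {x y : ℝ} (hx : x ∈ Y) (hy : y ∈ Y) : x * y ∈ Y := by
  have := R.div_mem x hx _ (R.div_mem 1 R.one_mem y hy)
  simpa using this

lemma const_nonneg : 0 ≤ K := by
  have := R.count_le 1 R.one_mem
  simp only [Real.one_rpow, mul_one] at this
  exact (abs_nonneg _).trans this

lemma ppSize_mem (q : P × ℕ) : ppSize N q ∈ Y := size_primePow N q ▸ R.size_mem _

lemma pow_mem {x : ℝ} (hx : x ∈ Y) (k : ℕ) : x ^ k ∈ Y := by
  induction k with
  | zero => simpa using R.one_mem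
  | succ k ih => rw [pow_succ]; exact R.mul_mem ih hx

/-- Up to a bounded factor every real number at least `1` lies in `Y`. -/
lemma exists_mem_ge [Nonempty P] :
    ∃ b : ℝ, 2 ≤ b ∧ ∀ t : ℝ, 1 ≤ t → ∃ x ∈ Y, t ≤ x ∧ x ≤ b * t := by
  obtain ⟨p⟩ := ‹Nonempty P›
  have hb := two_le_cast N p
  refine ⟨N p, hb, fun t ht => ?_⟩
  obtain ⟨j, hj1, hj2⟩ := exists_nat_pow_near (x := t) (y := N p) ht (by linarith)
  refine ⟨_, R.ppSize_mem (p, j), hj2.le, ?_⟩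
  rw [ppSize, pow_succ']
  gcongr

lemma floorIn_mono : Monotone (floorIn Y) := by
  intro s t hst
  by_cases h : {x | x ∈ Y ∧ x ≤ s}.Nonempty
  · exact csSup_le_csSup (bddAbove_floorIn t) h fun x hx => ⟨hx.1, hx.2.trans hst⟩
  · rw [Set.not_nonempty_iff_eq_empty] at h
    rw [floorIn, h, Real.sSup_empty]
    exact Real.sSup_nonneg fun x hx => (R.pos x hx.1).le

lemma floorIn_le {t : ℝ} (ht : 1 ≤ t) : floorIn Y t ≤ t :=
  csSup_le ⟨1, R.one_mem, ht⟩ fun _ hx => hx.2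

/-- Homogeneity of the floor; this is the form in which closure of `Y` under quotients is used for
arguments off `Y`. -/
lemma floorIn_mul {x : ℝ} (hx : x ∈ Y) (t : ℝ) : floorIn Y (x * t) = x * floorIn Y t := by
  have hx0 := R.pos x hx
  have h : {z | z ∈ Y ∧ z ≤ x * t} = (fun z => x • z) '' {z | z ∈ Y ∧ z ≤ t} := by
    ext z
    constructor
    · rintro ⟨hz, hzt⟩
      refine ⟨z / x, ⟨R.div_mem z hz x hx, ?_⟩, ?_⟩
      · rwa [div_le_iff₀' hx0]
      · simp only [smul_eq_mul]; field_simp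
    · rintro ⟨z, ⟨hz, hzt⟩, rfl⟩
      exact ⟨R.mul_mem hx hz, mul_le_mul_of_nonneg_left hzt hx0.le⟩
  have := Real.sSup_smul_of_nonneg hx0.le {z | z ∈ Y ∧ z ≤ t}
  rw [floorIn, h, Set.image_smul, this]
  rfl

/-- The counting formula extends to all real `t ≥ 1` if `t` is replaced by its floor in `Y`: the
largest norm up to `t` lies in `Y`. -/
lemma abs_count_sub_le {t : ℝ} (ht : 1 ≤ t) : |count N t - κ * floorIn Y t| ≤ K * t ^ θ := by
  have hK := R.const_nonneg
  have hκ := R.kappa_pos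
  rw [abs_le]
  constructor
  · have h1 : floorIn Y t ≤ (count N t + K * t ^ θ) / κ := by
      refine csSup_le ⟨1, R.one_mem, ht⟩ fun x hx => ?_
      rw [le_div_iff₀ hκ]
      have h2 := (abs_le.1 (R.count_le x hx.1)).1
      have h3 := count_mono N hx.2
      have h4 : K * x ^ θ ≤ K * t ^ θ := by
        have := R.pos x hx.1
        have := R.theta_pos
        gcongr
        exact hx.2
      linarith
    rw [le_div_iff₀ hκ] at h1
    linarith
  · obtain ⟨m, hm, hmax⟩ := Finset.exists_max_image (ball N t) (size N)
      ⟨0, mem_ball.2 (by rwa [size_zero])⟩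
    have h1 : ball N t = ball N (size N m) := by
      ext a; rw [mem_ball, mem_ball]
      exact ⟨fun h => hmax a (mem_ball.2 h), fun h => h.trans (mem_ball.1 hm)⟩
    have h2 := (abs_le.1 (R.count_le _ (R.size_mem m))).2
    have h3 : count N t = count N (size N m) := by rw [count, h1]; rfl
    have h4 := le_floorIn (R.size_mem m) (mem_ball.1 hm)
    have h5 : K * size N m ^ θ ≤ K * t ^ θ := by
      have := size_pos N m
      have := R.theta_pos
      gcongr
      exact mem_ball.1 hm
    nlinarith

/-- The number of elements of norm at most `t` is `O(t)`. -/
lemma exists_count_le : ∃ C, 0 ≤ C ∧ ∀ t, 0 ≤ t → count N t ≤ C * t := by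
  have hK := R.const_nonneg
  have hκ := R.kappa_pos
  refine ⟨κ + K, by positivity, fun t ht0 => ?_⟩
  rcases lt_or_ge t 1 with ht | ht
  · rw [count, ball_eq_empty N ht]; simp; positivity
  · have h1 := (abs_le.1 (R.abs_count_sub_le ht)).2
    have h2 := R.floorIn_le ht
    have h3 : t ^ θ ≤ t := Real.rpow_le_self_of_one_le ht R.theta_lt.le
    nlinarith

end Regular

end

section

/-! ### Logarithmic and harmonic sums over the monoid -/

variable {P : Type*} {N : P → ℕ} [NormFinite N] {Y : Set ℝ} {κ θ K : ℝ}

open MeasureTheory in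
/-- Interchange of summation and integration. -/
lemma sum_integral_eq {y : ℝ} {g : ℝ → ℝ} (hg : ContinuousOn g (Set.Icc 1 y)) (hy : 1 ≤ y) :
    ∑ m ∈ ball N y, ∫ t in (size N m)..y, g t = ∫ t in (1 : ℝ)..y, count N t * g t := by
  have hint : IntegrableOn g (Set.Ioc 1 y) :=
    (hg.integrableOn_compact isCompact_Icc).mono_set Set.Ioc_subset_Icc_self
  have h1 : ∀ m ∈ ball N y, ∫ t in (size N m)..y, g t
      = ∫ t in Set.Ioc 1 y, (Set.Ici (size N m)).indicator g t := by
    intro m hm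
    rw [setIntegral_indicator measurableSet_Ici, intervalIntegral.integral_of_le (mem_ball.1 hm)]
    refine setIntegral_congr_set ?_
    have h2 : Set.Ioc (size N m) y = Set.Ioc 1 y ∩ Set.Ioi (size N m) := by
      rw [Set.Ioc_inter_Ioi, sup_eq_right.2 (one_le_size N m)]
    rw [h2]
    exact ae_eq_set_inter (ae_eq_refl _) Ioi_ae_eq_Ici
  rw [Finset.sum_congr rfl h1, ← integral_finsetSum _ fun m _ =>
    hint.indicator measurableSet_Ici, intervalIntegral.integral_of_le hy]
  refine setIntegral_congr_fun measurableSet_Ioc fun t ht => ?_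
  have h3 : ball N t = (ball N y).filter (size N · ≤ t) := by
    ext m; simp only [Finset.mem_filter, mem_ball]
    exact ⟨fun h => ⟨h.trans ht.2, h⟩, fun h => h.2⟩
  simp only [count, h3, Finset.card_filter, Nat.cast_sum, Finset.sum_mul]
  refine Finset.sum_congr rfl fun m _ => ?_
  by_cases h : size N m ≤ t <;> simp [Set.indicator, h]

lemma continuousOn_inv_Icc {a b : ℝ} (ha : 0 < a) : ContinuousOn (fun t : ℝ => t⁻¹) (Set.Icc a b) :=
  continuousOn_inv₀.mono fun _ ht => (ha.trans_le ht.1).ne'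

lemma continuousOn_inv_sq_Icc {a b : ℝ} (ha : 0 < a) :
    ContinuousOn (fun t : ℝ => (t ^ 2)⁻¹) (Set.Icc a b) :=
  (continuous_pow 2).continuousOn.inv₀ fun _ ht => pow_ne_zero _ (ha.trans_le ht.1).ne'

lemma mono_mul_integrable {f g : ℝ → ℝ} {a b : ℝ} (hab : a ≤ b)
    (hf : Monotone f) (hg : ContinuousOn g (Set.Icc a b)) :
    IntervalIntegrable (fun t => f t * g t) MeasureTheory.volume a b :=
  hf.intervalIntegrable.mul_continuousOn (by rwa [Set.uIcc_of_le hab])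

namespace Regular

variable (R : Regular N Y κ θ K)
include R

/-- Homogeneity of the floor in `Y` determines its integral against `1 / t` exactly. -/
lemma exists_integral_floorIn_inv [Nonempty P] :
    ∃ c, ∀ y ∈ Y, 1 ≤ y → ∫ t in (1 : ℝ)..y, floorIn Y t * t⁻¹ = c * (y - 1) := by
  set H : ℝ → ℝ := fun y => ∫ t in (1 : ℝ)..y, floorIn Y t * t⁻¹ with hH
  have hint : ∀ a b : ℝ, 0 < a → a ≤ b →
      IntervalIntegrable (fun t => floorIn Y t * t⁻¹) MeasureTheory.volume a b := fun a b ha hab =>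
    mono_mul_integrable hab R.floorIn_mono (continuousOn_inv_Icc ha)
  have hadd : ∀ x ∈ Y, ∀ y, 1 ≤ x → 1 ≤ y → H (x * y) = H x + x * H y := by
    intro x hx y hx1 hy1
    have hx0 : 0 < x := by linarith
    have hxy : x ≤ x * y := le_mul_of_one_le_right hx0.le hy1
    have h1 := intervalIntegral.integral_add_adjacent_intervals (hint 1 x one_pos hx1)
      (hint x (x * y) hx0 hxy)
    have h2 := intervalIntegral.mul_integral_comp_mul_left (a := 1) (b := y)
      (f := fun t => floorIn Y t * t⁻¹) x
    simp only [mul_one] at h2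
    rw [hH]; simp only
    rw [← h1, ← h2]
    congr 2
    refine intervalIntegral.integral_congr fun t _ => ?_
    simp only [R.floorIn_mul hx]
    field_simp
  -- The relation `hadd` is not symmetric in `x` and `y`, while `x * y` is; with `x` fixed to the
  -- norm `b` of a prime, comparing both orders shows that `H y` is a multiple of `y - 1`.
  obtain ⟨p⟩ := ‹Nonempty P›
  have hb := two_le_ppSize N (p, 0)
  set b := ppSize N (p, 0)
  refine ⟨H b / (b - 1), fun y hy hy1 => ?_⟩
  have h3 := hadd b (R.ppSize_mem _) y (by linarith) hy1
  have h4 := hadd y hy b hy1 (by linarith)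
  rw [mul_comm y b, h3] at h4
  change H y = _
  rw [div_mul_eq_mul_div, eq_div_iff (by linarith)]
  linarith

/-- The integral of the floor in `Y` against `1 / t ^ 2` is additive on the multiplicative group
generated by `Y`, and monotone, hence a multiple of the logarithm. -/
lemma exists_integral_floorIn_inv_sq [Nonempty P] :
    ∃ α, 0 < α ∧ ∀ y ∈ Y, 1 ≤ y →
      ∫ t in (1 : ℝ)..y, floorIn Y t * (t ^ 2)⁻¹ = α * Real.log y := by
  set J : ℝ → ℝ := fun y => ∫ t in (1 : ℝ)..y, floorIn Y t * (t ^ 2)⁻¹ with hJ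
  have hint : ∀ a b : ℝ, 0 < a → a ≤ b →
      IntervalIntegrable (fun t => floorIn Y t * (t ^ 2)⁻¹) MeasureTheory.volume a b :=
    fun a b ha hab => mono_mul_integrable hab R.floorIn_mono (continuousOn_inv_sq_Icc ha)
  have hadd : ∀ x ∈ Y, ∀ y, 1 ≤ x → 1 ≤ y → J (x * y) = J x + J y := by
    intro x hx y hx1 hy1
    have hx0 : 0 < x := by linarith
    have hxy : x ≤ x * y := le_mul_of_one_le_right hx0.le hy1
    have h1 := intervalIntegral.integral_add_adjacent_intervals (hint 1 x one_pos hx1)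
      (hint x (x * y) hx0 hxy)
    have h2 := intervalIntegral.mul_integral_comp_mul_left (a := 1) (b := y)
      (f := fun t => floorIn Y t * (t ^ 2)⁻¹) x
    simp only [mul_one] at h2
    rw [hJ]; simp only
    rw [← h1, ← h2, ← intervalIntegral.integral_const_mul]
    congr 1
    refine intervalIntegral.integral_congr fun t _ => ?_
    simp only [R.floorIn_mul hx]
    field_simp
  have hone : ∀ t, 1 ≤ t → 1 ≤ floorIn Y t := fun t ht => le_floorIn R.one_mem ht
  have hmono : ∀ x y, 1 ≤ x → x ≤ y → J x ≤ J y := by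
    intro x y hx hxy
    have hx0 : 0 < x := by linarith
    have h1 := intervalIntegral.integral_add_adjacent_intervals (hint 1 x one_pos hx)
      (hint x y hx0 hxy)
    have h2 : 0 ≤ ∫ t in x..y, floorIn Y t * (t ^ 2)⁻¹ :=
      intervalIntegral.integral_nonneg hxy fun t ht => by
        have := hone t (hx.trans ht.1); positivity
    simp only [hJ]; linarith
  have hpow : ∀ x ∈ Y, 1 ≤ x → ∀ k : ℕ, J (x ^ k) = k * J x := by
    intro x hx hx1 k
    induction k with
    | zero => simp [hJ]
    | succ k ih =>
      rw [pow_succ, hadd _ (R.pow_mem hx k) _ (one_le_pow₀ hx1) hx1, ih]; push_cast; ring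
  obtain ⟨p⟩ := ‹Nonempty P›
  have hb := two_le_ppSize N (p, 0)
  have hbY := R.ppSize_mem (p, 0)
  set b := ppSize N (p, 0)
  have hlb : 0 < Real.log b := Real.log_pos (by linarith)
  have hJb : 0 < J b := by
    have h1 : ∫ t in (1 : ℝ)..b, (b ^ 2)⁻¹ ≤ J b := by
      refine intervalIntegral.integral_mono_on (by linarith) (by simp) (hint 1 b one_pos
        (by linarith)) fun t ht => ?_
      have ht0 : 0 < t := by linarith [ht.1]
      calc (b ^ 2)⁻¹ ≤ 1 * (t ^ 2)⁻¹ := by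
            rw [one_mul]; gcongr; exact ht.2
        _ ≤ _ := by gcongr; exact hone t ht.1
    refine lt_of_lt_of_le ?_ h1
    simp only [intervalIntegral.integral_const, smul_eq_mul]
    have : 0 < b - 1 := by linarith
    positivity
  refine ⟨J b / Real.log b, by positivity, fun y hy hy1 => ?_⟩
  change J y = _
  have hly : 0 ≤ Real.log y := Real.log_nonneg hy1
  -- Powers of `y` are compared with powers of the fixed `b`; the bound is uniform in the exponent,
  -- which forces equality.
  have hcmp : ∀ n : ℕ, |n * (J y - J b / Real.log b * Real.log y)| ≤ J b := by
    intro n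
    obtain ⟨k, hk1, hk2⟩ := exists_nat_pow_near (x := y ^ n) (y := b) (one_le_pow₀ hy1)
      (by linarith)
    have hb1 : 1 ≤ b := by linarith
    have e1 := hmono _ _ (one_le_pow₀ hb1) hk1
    have e2 := hmono _ _ (one_le_pow₀ hy1) hk2.le
    rw [hpow b hbY hb1, hpow y hy hy1] at e1 e2
    have e3 := Real.log_le_log (by positivity) hk1
    have e4 := Real.log_le_log (by positivity) hk2.le
    rw [Real.log_pow, Real.log_pow] at e3 e4
    have e5 : (n : ℝ) * (J b / Real.log b * Real.log y) = J b / Real.log b * (n * Real.log y) := by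
      ring
    have hq : 0 < J b / Real.log b := by positivity
    have e6 := mul_le_mul_of_nonneg_left e3 hq.le
    have e7 := mul_le_mul_of_nonneg_left e4 hq.le
    have e8 : ∀ z : ℝ, J b / Real.log b * (z * Real.log b) = z * J b := fun z => by field_simp
    rw [e8] at e6 e7
    push_cast at e2 e7
    rw [mul_sub, e5, abs_le]
    constructor <;> linarith
  by_contra hne
  have hpos : 0 < |J y - J b / Real.log b * Real.log y| := abs_pos.2 (sub_ne_zero.2 hne)
  obtain ⟨n, hn⟩ := exists_nat_gt (J b / |J y - J b / Real.log b * Real.log y|)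
  rw [div_lt_iff₀ hpos] at hn
  have := hcmp n
  rw [abs_mul, Nat.abs_cast] at this
  linarith

/-- `∑ log (y / N(m))` over the elements of norm at most `y`. -/
lemma exists_sum_log_div [Nonempty P] :
    ∃ c C, ∀ y ∈ Y, 1 ≤ y →
      |∑ m ∈ ball N y, Real.log (y / size N m) - c * y| ≤ C * y ^ θ := by
  obtain ⟨c, hc⟩ := R.exists_integral_floorIn_inv
  have hθ := R.theta_pos
  have hK := R.const_nonneg
  refine ⟨κ * c, K / θ + |κ * c|, fun y hy hy1 => ?_⟩
  have hy0 : 0 < y := by linarith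
  have hcont := continuousOn_inv_Icc (a := 1) (b := y) one_pos
  have h1 : ∑ m ∈ ball N y, Real.log (y / size N m) = ∫ t in (1 : ℝ)..y, count N t * t⁻¹ := by
    rw [← sum_integral_eq hcont hy1]
    exact Finset.sum_congr rfl fun m _ => (integral_inv_of_pos (size_pos N m) hy0).symm
  have i1 := mono_mul_integrable hy1 (count_mono N) hcont
  have i2 := mono_mul_integrable hy1 R.floorIn_mono hcont
  have h2 : (∫ t in (1 : ℝ)..y, count N t * t⁻¹) - κ * (c * (y - 1))
      = ∫ t in (1 : ℝ)..y, (count N t * t⁻¹ - κ * (floorIn Y t * t⁻¹)) := by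
    rw [intervalIntegral.integral_sub i1 (i2.const_mul κ), intervalIntegral.integral_const_mul,
      hc y hy hy1]
  have h3 : |∫ t in (1 : ℝ)..y, (count N t * t⁻¹ - κ * (floorIn Y t * t⁻¹))|
      ≤ ∫ t in (1 : ℝ)..y, K * t ^ (θ - 1) := by
    rw [← Real.norm_eq_abs]
    refine intervalIntegral.norm_integral_le_of_norm_le hy1 (Eventually.of_forall fun t ht => ?_)
      ((intervalIntegral.intervalIntegrable_rpow' (by linarith)).const_mul K)
    have ht0 : 0 < t := by linarith [ht.1]
    have h4 := R.abs_count_sub_le ht.1.le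
    rw [Real.norm_eq_abs, ← mul_assoc, ← sub_mul, abs_mul, abs_of_pos (inv_pos.2 ht0),
      Real.rpow_sub_one ht0.ne', ← div_eq_mul_inv, ← mul_div_assoc]
    gcongr
  have h5 : ∫ t in (1 : ℝ)..y, K * t ^ (θ - 1) ≤ K / θ * y ^ θ := by
    rw [intervalIntegral.integral_const_mul, integral_rpow (Or.inl (by linarith)),
      sub_add_cancel, Real.one_rpow, div_mul_eq_mul_div, mul_div_assoc]
    gcongr
    linarith
  have h6 : 1 ≤ y ^ θ := Real.one_le_rpow hy1 hθ.le
  rw [h1]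
  calc |(∫ t in (1 : ℝ)..y, count N t * t⁻¹) - κ * c * y|
      = |((∫ t in (1 : ℝ)..y, count N t * t⁻¹) - κ * (c * (y - 1))) + -(κ * c)| := by
        congr 1; ring
    _ ≤ K / θ * y ^ θ + |κ * c| := by
        refine (abs_add_le _ _).trans ?_
        rw [abs_neg, h2]; linarith
    _ ≤ _ := by rw [add_mul]; nlinarith [abs_nonneg (κ * c)]

open MeasureTheory in
/-- `∑ 1 / N(m)` over the elements of norm at most `y`. -/
lemma exists_sum_inv [Nonempty P] :
    ∃ α c C, 0 < α ∧ ∀ y ∈ Y, 1 ≤ y →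
      |y * ∑ m ∈ ball N y, (size N m)⁻¹ - α * y * Real.log y - c * y| ≤ C * y ^ θ := by
  obtain ⟨α, hα, hJ⟩ := R.exists_integral_floorIn_inv_sq
  have hθ := R.theta_pos
  have hθ1 := R.theta_lt
  have hK := R.const_nonneg
  have hκ := R.kappa_pos
  set e : ℝ → ℝ := fun t => count N t * (t ^ 2)⁻¹ - κ * (floorIn Y t * (t ^ 2)⁻¹) with he
  have hbd : ∀ t, 1 ≤ t → ‖e t‖ ≤ K * t ^ (θ - 2) := by
    intro t ht
    have ht0 : 0 < t := by linarith
    have h4 := R.abs_count_sub_le ht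
    have h5 : (0 : ℝ) < (t ^ 2)⁻¹ := by positivity
    rw [he, Real.norm_eq_abs]
    simp only
    rw [← mul_assoc, ← sub_mul, abs_mul, abs_of_pos h5,
      Real.rpow_sub ht0, Real.rpow_two, ← div_eq_mul_inv, ← mul_div_assoc]
    gcongr
  have hmeas : Measurable e := by
    have := (count_mono N).measurable
    have := R.floorIn_mono.measurable
    fun_prop
  have hrp : IntegrableOn (fun t : ℝ => K * t ^ (θ - 2)) (Set.Ioi 1) :=
    (integrableOn_Ioi_rpow_of_lt (by linarith) one_pos).const_mul K
  have hei : IntegrableOn e (Set.Ioi 1) := by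
    refine hrp.mono' hmeas.aestronglyMeasurable ?_
    filter_upwards [ae_restrict_mem measurableSet_Ioi] with t ht using hbd t (le_of_lt ht)
  -- The contribution of the error `e` to the linear term is its integral up to infinity.
  set E := ∫ t in Set.Ioi (1 : ℝ), e t
  refine ⟨κ * α, κ + E, K + K / (1 - θ), by positivity, fun y hy hy1 => ?_⟩
  have hy0 : 0 < y := by linarith
  have hcont := continuousOn_inv_sq_Icc (a := 1) (b := y) one_pos
  have i1 := mono_mul_integrable hy1 (count_mono N) hcont
  have i2 := mono_mul_integrable hy1 R.floorIn_mono hcont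
  have h1 : ∑ m ∈ ball N y, (size N m)⁻¹
      = count N y / y + ∫ t in (1 : ℝ)..y, count N t * (t ^ 2)⁻¹ := by
    rw [← sum_integral_eq hcont hy1, count, div_eq_mul_inv, ← nsmul_eq_mul, ← Finset.sum_const,
      ← Finset.sum_add_distrib]
    refine Finset.sum_congr rfl fun m hm => ?_
    have hm0 := size_pos N m
    have hmy := mem_ball.1 hm
    have : ∫ t in (size N m)..y, (t ^ 2)⁻¹ = (size N m)⁻¹ - y⁻¹ := by
      have h0 : (0 : ℝ) ∉ Set.uIcc (size N m) y := by
        rw [Set.uIcc_of_le hmy]; intro h; linarith [h.1]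
      have := integral_zpow (a := size N m) (b := y) (n := -2) (Or.inr ⟨by norm_num, h0⟩)
      simp only [zpow_neg] at this
      norm_num at this
      rw [this]; ring
    rw [this]; ring
  have h2 : (∫ t in (1 : ℝ)..y, count N t * (t ^ 2)⁻¹)
      = κ * (α * Real.log y) + ∫ t in (1 : ℝ)..y, e t := by
    rw [intervalIntegral.integral_sub i1 (i2.const_mul κ), intervalIntegral.integral_const_mul,
      hJ y hy hy1]
    ring
  have h3 : (∫ t in (1 : ℝ)..y, e t) = E - ∫ t in Set.Ioi y, e t := by
    have hy' : IntegrableOn e (Set.Ioi y) := hei.mono_set (Set.Ioi_subset_Ioi hy1)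
    have := intervalIntegral.integral_interval_add_Ioi hei hy'
    linarith
  have h4 : |∫ t in Set.Ioi y, e t| ≤ K / (1 - θ) * y ^ (θ - 1) := by
    rw [← Real.norm_eq_abs]
    refine (norm_integral_le_of_norm_le (hrp.mono_set (Set.Ioi_subset_Ioi hy1)) ?_).trans ?_
    · filter_upwards [ae_restrict_mem measurableSet_Ioi] with t ht
        using hbd t (hy1.trans (le_of_lt ht))
    · rw [integral_const_mul, integral_Ioi_rpow_of_lt (by linarith) hy0]
      have : θ - 2 + 1 = -(1 - θ) := by ring
      rw [this, div_neg, neg_div, neg_neg, div_mul_eq_mul_div, mul_div_assoc, neg_sub]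
  have h5 := R.count_le y hy
  have h6 : y * y ^ (θ - 1) = y ^ θ := by
    rw [Real.rpow_sub_one hy0.ne']; field_simp
  calc |y * ∑ m ∈ ball N y, (size N m)⁻¹ - κ * α * y * Real.log y - (κ + E) * y|
      = |(count N y - κ * y) - y * ∫ t in Set.Ioi y, e t| := by
        rw [h1, h2, h3]; congr 1; field_simp; ring
    _ ≤ K * y ^ θ + y * (K / (1 - θ) * y ^ (θ - 1)) := by
        refine (abs_sub _ _).trans ?_
        rw [abs_mul y, abs_of_pos hy0]
        gcongr
    _ = _ := by rw [← h6]; ring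

end Regular

end

section

/-! ### Chebyshev's bound -/

variable {P : Type*} (N : P → ℕ)

lemma log_size (hN : ∀ p, N p ≠ 0) (m : P →₀ ℕ) :
    Real.log (size N m) = additive (fun p => Real.log (N p)) m := by
  unfold size norm additive Finsupp.prod Finsupp.sum
  push_cast
  rw [Real.log_prod fun p _ => by have := hN p; positivity]
  simp [Real.log_pow]

variable [NormFinite N]

lemma log_size_eq (m : P →₀ ℕ) :
    Real.log (size N m) = additive (fun p => Real.log (N p)) m :=
  log_size N (fun p => by have := NormFinite.two_le (N := N) p; omega) m

/-- The Chebyshev function. -/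
def psi (t : ℝ) : ℝ := ∑ q ∈ ppBall N t, Real.log (N q.1)

lemma log_cast_pos (p : P) : 0 < Real.log (N p) := Real.log_pos (by linarith [two_le_cast N p])

lemma psi_mono {s t : ℝ} (h : s ≤ t) : psi N s ≤ psi N t :=
  Finset.sum_le_sum_of_subset_of_nonneg (ppBall_mono N h) fun q _ _ => (log_cast_pos N q.1).le

/-- Möbius inversion of the summatory function of an additive function. -/
lemma sum_mob_additive (w : P → ℝ) (x : ℝ) :
    ∑ d ∈ ball N x, mob d * ∑ m ∈ ball N (x / size N d), additive w m
      = ∑ q ∈ ppBall N x, w q.1 := by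
  have h1 : ∀ d ∈ ball N x, mob d * ∑ m ∈ ball N (x / size N d), additive w m
      = ∑ q ∈ ppBall N x, w q.1 * (mob d * count N (x / ppSize N q / size N d)) := by
    intro d hd
    have h2 := sum_additive_mul N w (fun _ => 1) (x / size N d)
    simp only [mul_one, Finset.sum_const, nsmul_eq_mul] at h2
    have hx0 : 0 < x := (size_pos N d).trans_le (mem_ball.1 hd)
    have hsub : ppBall N (x / size N d) ⊆ ppBall N x :=
      ppBall_mono N (div_le_self hx0.le (one_le_size N d))
    rw [h2, Finset.mul_sum, Finset.sum_subset hsub]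
    · refine Finset.sum_congr rfl fun q _ => ?_
      rw [div_right_comm, count]; ring
    · intro q _ hq
      rw [mem_ppBall, not_le] at hq
      rw [ball_eq_empty N ((div_lt_one (ppSize_pos N q)).2 hq)]
      simp
  rw [Finset.sum_congr rfl h1, Finset.sum_comm]
  refine Finset.sum_congr rfl fun q hq => ?_
  have hq1 : 1 ≤ x / ppSize N q := (one_le_div (ppSize_pos N q)).2 (mem_ppBall.1 hq)
  have hx0 : 0 < x := (ppSize_pos N q).trans_le (mem_ppBall.1 hq)
  have h3 := sum_mob_mul N (fun _ => (1 : ℝ)) hq1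
  simp only [Finset.sum_const, nsmul_eq_mul, mul_one] at h3
  rw [← Finset.mul_sum]
  have hsub : ball N (x / ppSize N q) ⊆ ball N x :=
    ball_mono N (div_le_self hx0.le (by linarith [two_le_ppSize N q]))
  rw [← Finset.sum_subset hsub]
  · simp only [count] at *
    rw [h3, mul_one]
  · intro d _ hd
    rw [mem_ball, not_le] at hd
    rw [count, ball_eq_empty N ((div_lt_one (size_pos N d)).2 hd)]
    simp

variable {N} {Y : Set ℝ} {κ θ K : ℝ}

namespace Regular

variable (R : Regular N Y κ θ K)
include R

lemma sum_div_rpow_le {η : ℝ} (h0 : 0 ≤ η) (h1 : η < 1) :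
    ∃ C, ∀ x, 1 ≤ x → ∑ d ∈ ball N x, (x / size N d) ^ η ≤ C * x := by
  obtain ⟨C, hC0, hC⟩ := R.exists_count_le
  refine ⟨2 ^ η * (1 - 2 ^ (η - 1))⁻¹ * C, fun x hx => ?_⟩
  have := sum_mul_div_rpow_le (ball N x) (size N) (fun _ => 1) (K := C) h0 h1
    (by linarith : (0 : ℝ) < x) (fun _ _ => zero_le_one)
    (fun m hm => ⟨size_pos N m, mem_ball.1 hm⟩) fun t ht _ => ?_
  · simpa using this
  · refine le_trans ?_ (hC t ht.le)
    simp only [Finset.sum_const, nsmul_eq_mul, mul_one, count]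
    exact_mod_cast Finset.card_le_card fun m hm => mem_ball.2 (Finset.mem_filter.1 hm).2

/-- `∑ log N(m)`, up to the exponent of the error term. -/
lemma exists_sum_log [Nonempty P] :
    ∃ c C, ∀ y ∈ Y, 1 ≤ y →
      |∑ m ∈ ball N y, Real.log (size N m) - κ * y * Real.log y - c * y|
        ≤ C * y ^ ((1 + θ) / 2) := by
  obtain ⟨c, C, h⟩ := R.exists_sum_log_div
  have hθ := R.theta_pos
  have hθ1 := R.theta_lt
  have hK := R.const_nonneg
  have hC : 0 ≤ C := by
    have := (abs_nonneg _).trans (h 1 R.one_mem le_rfl)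
    simpa using this
  refine ⟨-c, C + K * ((1 - θ) / 2)⁻¹, fun y hy hy1 => ?_⟩
  have hy0 : 0 < y := by linarith
  have h1 : ∑ m ∈ ball N y, Real.log (size N m)
      = count N y * Real.log y - ∑ m ∈ ball N y, Real.log (y / size N m) := by
    rw [count, ← nsmul_eq_mul, ← Finset.sum_const, ← Finset.sum_sub_distrib]
    refine Finset.sum_congr rfl fun m _ => ?_
    rw [Real.log_div hy0.ne' (size_pos N m).ne']; ring
  have hlog : 0 ≤ Real.log y := Real.log_nonneg hy1
  have h2 : y ^ θ * Real.log y ≤ ((1 - θ) / 2)⁻¹ * y ^ ((1 + θ) / 2) := by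
    have := Real.log_le_rpow_div hy0.le (show 0 < (1 - θ) / 2 by linarith)
    calc y ^ θ * Real.log y ≤ y ^ θ * (y ^ ((1 - θ) / 2) / ((1 - θ) / 2)) := by gcongr
      _ = ((1 - θ) / 2)⁻¹ * (y ^ θ * y ^ ((1 - θ) / 2)) := by ring
      _ = _ := by rw [← Real.rpow_add hy0]; congr 2; ring
  have h3 : y ^ θ ≤ y ^ ((1 + θ) / 2) := Real.rpow_le_rpow_of_exponent_le hy1 (by linarith)
  have h4 := R.count_le y hy
  calc |∑ m ∈ ball N y, Real.log (size N m) - κ * y * Real.log y - -c * y|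
      = |(count N y - κ * y) * Real.log y
          - (∑ m ∈ ball N y, Real.log (y / size N m) - c * y)| := by
        rw [h1]; congr 1; ring
    _ ≤ K * y ^ θ * Real.log y + C * y ^ θ := by
        refine (abs_sub _ _).trans (add_le_add ?_ (h y hy hy1))
        rw [abs_mul, abs_of_nonneg hlog]
        gcongr
    _ ≤ K * (((1 - θ) / 2)⁻¹ * y ^ ((1 + θ) / 2)) + C * y ^ ((1 + θ) / 2) := by
        rw [mul_assoc]; gcongr
    _ = _ := by ring

/-- Chebyshev's bound. The logarithm is, up to a function with small partial sums over `Y`, a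
combination of functions whose convolution with the Möbius function has explicit sums; applying
Möbius inversion costs only the trivial bound `|μ| ≤ 1`. -/
lemma exists_psi_le [Nonempty P] : ∃ C, 0 ≤ C ∧ ∀ t, 0 ≤ t → psi N t ≤ C * t := by
  obtain ⟨c₁, C₁, h₁⟩ := R.exists_sum_log
  obtain ⟨a, c₂, C₂, ha, h₂⟩ := R.exists_sum_inv
  have hθ := R.theta_pos
  have hθ1 := R.theta_lt
  have hK := R.const_nonneg
  have hκ := R.kappa_pos
  obtain ⟨C₃, h₃⟩ := R.sum_div_rpow_le (η := (1 + θ) / 2) (by linarith) (by linarith)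
  have hC₂ : 0 ≤ C₂ := by
    have := (abs_nonneg _).trans (h₂ 1 R.one_mem le_rfl)
    simpa using this
  -- `β` is chosen to cancel the terms of order `y log y` and `γ` those of order `y`.
  set β := κ / a with hβ
  have hβ0 : 0 < β := by positivity
  set γ := (c₁ - β * c₂) / κ with hγ
  set C₄ := C₁ + β * C₂ + |γ| * K with hC₄
  have hR : ∀ y ∈ Y, 1 ≤ y →
      |∑ m ∈ ball N y, (Real.log (size N m) - β * (y * (size N m)⁻¹) - γ)|
        ≤ C₄ * y ^ ((1 + θ) / 2) := by
    intro y hy hy1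
    have h3 : y ^ θ ≤ y ^ ((1 + θ) / 2) := Real.rpow_le_rpow_of_exponent_le hy1 (by linarith)
    have e1 := h₁ y hy hy1
    have e2 := h₂ y hy hy1
    have e3 := R.count_le y hy
    have e4 : ∑ m ∈ ball N y, (Real.log (size N m) - β * (y * (size N m)⁻¹) - γ)
        = (∑ m ∈ ball N y, Real.log (size N m) - κ * y * Real.log y - c₁ * y)
          - β * (y * ∑ m ∈ ball N y, (size N m)⁻¹ - a * y * Real.log y - c₂ * y)
          - γ * (count N y - κ * y) := by
      simp only [Finset.sum_sub_distrib, ← Finset.mul_sum, Finset.sum_const, nsmul_eq_mul]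
      rw [count, hγ, hβ]
      field_simp
      ring
    rw [e4]
    refine (abs_sub _ _).trans ((add_le_add (abs_sub _ _) le_rfl).trans ?_)
    rw [abs_mul, abs_mul, abs_of_pos hβ0]
    calc _ ≤ C₁ * y ^ ((1 + θ) / 2) + β * (C₂ * y ^ ((1 + θ) / 2))
          + |γ| * (K * y ^ ((1 + θ) / 2)) := by
            gcongr
            · exact e2.trans (by gcongr)
            · exact e3.trans (by gcongr)
      _ = _ := by rw [hC₄]; ring
  have hC₄0 : 0 ≤ C₄ := by
    have := (abs_nonneg _).trans (hR 1 R.one_mem le_rfl)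
    simpa using this
  have hY : ∀ x ∈ Y, 1 ≤ x → psi N x ≤ (C₄ * C₃ + β + |γ|) * x := by
    intro x hx hx1
    have hx0 : 0 < x := by linarith
    -- The Möbius transform of the logarithm is `ψ`, and that of `β (x / N(m)) + γ` is `β x + γ`.
    have e1 := sum_mob_additive N (fun p => Real.log (N p)) x
    have e2 := sum_mob_mul N (fun m => β * (x * (size N m)⁻¹) + γ) hx1
    simp only [size_zero, inv_one, mul_one] at e2
    have e3 : psi N x - (β * x + γ) = ∑ d ∈ ball N x, mob d *
        ∑ m ∈ ball N (x / size N d),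
          (Real.log (size N m) - β * (x / size N d * (size N m)⁻¹) - γ) := by
      rw [psi, ← e1, ← e2, ← Finset.sum_sub_distrib]
      refine Finset.sum_congr rfl fun d _ => ?_
      rw [← mul_sub, ← Finset.sum_sub_distrib]
      congr 1
      refine Finset.sum_congr rfl fun m _ => ?_
      rw [size_add, log_size_eq, mul_inv]
      ring
    have e4 : |psi N x - (β * x + γ)| ≤ C₄ * (C₃ * x) := by
      rw [e3]
      refine (Finset.abs_sum_le_sum_abs _ _).trans ?_
      refine le_trans ?_ (mul_le_mul_of_nonneg_left (h₃ x hx1) hC₄0)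
      rw [Finset.mul_sum]
      refine Finset.sum_le_sum fun d hd => ?_
      rw [abs_mul]
      refine (mul_le_of_le_one_left (abs_nonneg _) (abs_mob_le d)).trans ?_
      exact hR _ (R.div_mem _ hx _ (R.size_mem d)) ((one_le_div (size_pos N d)).2 (mem_ball.1 hd))
    have e5 := (abs_le.1 e4).2
    have e6 : γ ≤ |γ| * x := (le_abs_self γ).trans (le_mul_of_one_le_right (abs_nonneg _) hx1)
    linarith
  obtain ⟨b, hb, hbY⟩ := R.exists_mem_ge
  set C₅ := C₄ * C₃ + β + |γ|
  have hC₅ : 0 ≤ C₅ := by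
    have := hY 1 R.one_mem le_rfl
    rw [psi, ppBall_eq_empty N one_lt_two] at this
    simpa using this
  refine ⟨C₅ * b, by positivity, fun t ht0 => ?_⟩
  rcases lt_or_ge t 1 with ht | ht
  · rw [psi, ppBall_eq_empty N (by linarith)]; simp only [Finset.sum_empty]; positivity
  · obtain ⟨x, hx, htx, hxt⟩ := hbY t ht
    calc psi N t ≤ psi N x := psi_mono N htx
      _ ≤ C₅ * x := hY x hx (ht.trans htx)
      _ ≤ C₅ * (b * t) := by gcongr
      _ = _ := by ring

end Regular

end

section

/-! ### Convergent sums and prime power counts -/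

lemma abs_sum_sub_tsum_le {ι : Type*} (s : Finset ι) {f g : ι → ℝ} {c : ℝ} (hf : Summable f)
    (hg : Summable g) (hg0 : ∀ i, 0 ≤ g i) (hc : 0 ≤ c) (hfg : ∀ i ∉ s, |f i| ≤ c * g i) :
    |∑ i ∈ s, f i - ∑' i, f i| ≤ c * ∑' i, g i := by
  rw [← hf.sum_add_tsum_compl (s := s), sub_add_cancel_left, abs_neg, ← Real.norm_eq_abs]
  have hfa : Summable fun x : ↑((s : Set ι)ᶜ) => ‖f x‖ := (hf.norm).subtype _
  have hga : Summable fun x : ↑((s : Set ι)ᶜ) => c * g x := (hg.subtype _).mul_left c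
  calc ‖∑' x : ↑((s : Set ι)ᶜ), f x‖ ≤ ∑' x : ↑((s : Set ι)ᶜ), ‖f x‖ := norm_tsum_le_tsum_norm hfa
    _ ≤ ∑' x : ↑((s : Set ι)ᶜ), c * g x :=
        hfa.tsum_le_tsum (fun x => hfg x x.2) hga
    _ = c * ∑' x : ↑((s : Set ι)ᶜ), g x := tsum_mul_left
    _ ≤ _ := by
        gcongr
        exact hg.tsum_subtype_le _ _ hg0

lemma one_add_log_le {t : ℝ} (ht : 1 ≤ t) : 1 + Real.log t ≤ 5 * t ^ (1 / 4 : ℝ) := by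
  have h1 := Real.log_le_rpow_div (by linarith : 0 ≤ t) (by norm_num : (0 : ℝ) < 1 / 4)
  have h2 : 1 ≤ t ^ (1 / 4 : ℝ) := Real.one_le_rpow ht (by norm_num)
  linarith

variable {P : Type*} (N : P → ℕ) [NormFinite N]

/-- The finite set of primes of norm at most `t`. -/
def primeBall (t : ℝ) : Finset P :=
  (ppBall N t).preimage (fun p => (p, 0)) (Prod.mk_left_injective 0).injOn

variable {N} in
lemma mem_primeBall {t : ℝ} {p : P} : p ∈ primeBall N t ↔ (N p : ℝ) ≤ t := by
  rw [primeBall, Finset.mem_preimage, mem_ppBall]; simp [ppSize]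

lemma raise_injective {P : Type*} :
    Function.Injective fun q : P × ℕ => (q.1, q.2 + 1) := fun a b h => by
  simp only [Prod.mk.injEq, add_left_inj] at h
  exact Prod.ext h.1 h.2

/-- The finite set of prime powers of norm at most `t` with exponent at least `2`, the exponent
being indexed by `k + 2`. -/
def higherBall (t : ℝ) : Finset (P × ℕ) :=
  (ppBall N t).preimage (fun q => (q.1, q.2 + 1)) raise_injective.injOn

variable {N} in
lemma mem_higherBall {t : ℝ} {q : P × ℕ} :
    q ∈ higherBall N t ↔ ppSize N (q.1, q.2 + 1) ≤ t := by
  rw [higherBall, Finset.mem_preimage, mem_ppBall]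

lemma sum_ppBall (f : P × ℕ → ℝ) (t : ℝ) :
    ∑ q ∈ ppBall N t, f q
      = ∑ p ∈ primeBall N t, f (p, 0) + ∑ q ∈ higherBall N t, f (q.1, q.2 + 1) := by
  rw [← Finset.sum_filter_add_sum_filter_not (ppBall N t) (fun q => q.2 = 0)]
  congr 1
  · refine (Finset.sum_bij (fun p _ => (p, 0)) ?_ ?_ ?_ fun _ _ => rfl).symm
    · intro p hp
      simpa [mem_ppBall, mem_primeBall, ppSize] using hp
    · intro a _ b _ h; exact (Prod.ext_iff.1 h).1
    · rintro ⟨p, k⟩ h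
      simp only [Finset.mem_filter, mem_ppBall] at h
      obtain ⟨h, rfl⟩ := h
      exact ⟨p, by simpa [mem_primeBall, ppSize] using h, rfl⟩
  · refine (Finset.sum_bij (fun q _ => (q.1, q.2 + 1)) ?_ ?_ ?_ fun _ _ => rfl).symm
    · intro q hq
      simpa [mem_ppBall, mem_higherBall] using hq
    · intro a _ b _ h; exact raise_injective h
    · rintro ⟨p, k⟩ h
      simp only [Finset.mem_filter, mem_ppBall] at h
      obtain ⟨h, hk⟩ := h
      obtain ⟨k, rfl⟩ := Nat.exists_eq_succ_of_ne_zero hk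
      exact ⟨(p, k), mem_higherBall.2 h, rfl⟩

variable {N} {Y : Set ℝ} {κ θ K : ℝ}

namespace Regular

variable (R : Regular N Y κ θ K)
include R

/-- The zeta function of the monoid converges to the right of `1`. -/
lemma summable_size_rpow {s : ℝ} (hs : 1 < s) : Summable fun m => size N m ^ (-s) := by
  obtain ⟨C, hC0, hC⟩ := R.exists_count_le
  -- Each `m` is counted in the dyadic range `[2 ^ j, 2 ^ (j + 1))` that contains its norm.
  have hex : ∀ m, ∃ j : ℕ, (2 : ℝ) ^ j ≤ size N m ∧ size N m < 2 ^ (j + 1) := fun m =>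
    exists_nat_pow_near (one_le_size N m) one_lt_two
  choose j hj using hex
  have hr : (2 : ℝ) ^ (1 - s) < 1 := Real.rpow_lt_one_of_one_lt_of_neg one_lt_two (by linarith)
  have hr0 : (0 : ℝ) ≤ 2 ^ (1 - s) := by positivity
  refine summable_of_sum_le (c := 2 * C * (1 - 2 ^ (1 - s))⁻¹)
    (fun m => by have := size_pos N m; positivity) fun u => ?_
  set J := u.sup j + 1
  have h1 : ∀ m ∈ u, size N m ^ (-s)
      ≤ ∑ l ∈ Finset.range J, ((2 : ℝ) ^ (-s)) ^ l * if size N m ≤ 2 ^ (l + 1) then 1 else 0 := by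
    intro m hm
    have := Finset.single_le_sum (f := fun l => ((2 : ℝ) ^ (-s)) ^ l *
        if size N m ≤ 2 ^ (l + 1) then 1 else 0) (fun l _ => by split_ifs <;> positivity)
        (Finset.mem_range.2 (Nat.lt_succ_of_le (Finset.le_sup hm)) : j m ∈ Finset.range J)
    refine le_trans ?_ this
    simp only [(hj m).2.le, if_true, mul_one]
    rw [← Real.rpow_natCast, ← Real.rpow_mul zero_le_two, mul_comm, Real.rpow_mul zero_le_two,
      Real.rpow_natCast]
    exact Real.rpow_le_rpow_of_nonpos (by positivity) (hj m).1 (by linarith)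
  calc ∑ m ∈ u, size N m ^ (-s)
      ≤ ∑ m ∈ u, ∑ l ∈ Finset.range J, ((2 : ℝ) ^ (-s)) ^ l *
          if size N m ≤ 2 ^ (l + 1) then 1 else 0 := Finset.sum_le_sum h1
    _ = ∑ l ∈ Finset.range J, ((2 : ℝ) ^ (-s)) ^ l *
          ((u.filter (size N · ≤ 2 ^ (l + 1))).card : ℝ) := by
        rw [Finset.sum_comm]
        refine Finset.sum_congr rfl fun l _ => ?_
        rw [← Finset.mul_sum, Finset.card_filter]; push_cast; rfl
    _ ≤ ∑ l ∈ Finset.range J, ((2 : ℝ) ^ (-s)) ^ l * (C * 2 ^ (l + 1)) := by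
        gcongr with l _
        refine le_trans ?_ (hC _ (by positivity))
        unfold count
        exact_mod_cast Finset.card_le_card fun m hm => mem_ball.2 (Finset.mem_filter.1 hm).2
    _ = 2 * C * ∑ l ∈ Finset.range J, ((2 : ℝ) ^ (1 - s)) ^ l := by
        rw [Finset.mul_sum]
        refine Finset.sum_congr rfl fun l _ => ?_
        rw [sub_eq_add_neg, Real.rpow_add two_pos, Real.rpow_one, mul_pow]
        ring
    _ ≤ _ := by
        gcongr
        exact (summable_geometric_of_lt_one hr0 hr).sum_le_tsum _ (fun _ _ => by positivity)
          |>.trans_eq (tsum_geometric_of_lt_one hr0 hr)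

lemma summable_prime_rpow {s : ℝ} (hs : 1 < s) : Summable fun p => (N p : ℝ) ^ (-s) := by
  have h := (R.summable_size_rpow hs).comp_injective
    (i := fun p : P => primePow (p, 0)) fun a b h => (Prod.ext_iff.1 (primePow_injective h)).1
  refine h.congr fun p => ?_
  simp [size_primePow, ppSize]

/-- The sum over the proper prime powers converges even with the exponent `3 / 4`; this gives
tails of size `O(t ^ (-1 / 4))`. -/
lemma summable_higher :
    Summable fun q : P × ℕ => ((q.2 : ℝ) + 2) * ppSize N (q.1, q.2 + 1) ^ (-(3 / 4) : ℝ) := by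
  have hr : ‖(2 : ℝ) ^ (-(3 / 4) : ℝ)‖ < 1 := by
    rw [Real.norm_eq_abs, abs_of_pos (by positivity)]
    exact Real.rpow_lt_one_of_one_lt_of_neg one_lt_two (by norm_num)
  have h1 : Summable fun k : ℕ => ((k : ℝ) + 2) * ((2 : ℝ) ^ (-(3 / 4) : ℝ)) ^ k := by
    have a1 := summable_pow_mul_geometric_of_norm_lt_one 1 hr
    have a2 := (summable_geometric_of_norm_lt_one hr).mul_left 2
    refine (a1.add a2).congr fun k => ?_
    rw [pow_one]; ring
  have h2 := (R.summable_prime_rpow (s := 3 / 2) (by norm_num)).mul_of_nonneg h1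
    (fun p => by positivity) (fun k => by positivity)
  refine Summable.of_nonneg_of_le (fun q => ?_) (fun q => ?_) h2
  · have := ppSize_pos N (q.1, q.2 + 1); positivity
  · have hp := two_le_cast N q.1
    have hp0 : (0 : ℝ) ≤ N q.1 := by linarith
    have : ppSize N (q.1, q.2 + 1) ^ (-(3 / 4) : ℝ)
        = (N q.1 : ℝ) ^ (-(3 / 2) : ℝ) * ((N q.1 : ℝ) ^ (-(3 / 4) : ℝ)) ^ q.2 := by
      rw [ppSize, ← Real.rpow_natCast, ← Real.rpow_natCast, ← Real.rpow_mul hp0,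
        ← Real.rpow_mul hp0, ← Real.rpow_add (by linarith)]
      congr 1; push_cast; ring
    rw [this]
    calc ((q.2 : ℝ) + 2) * ((N q.1 : ℝ) ^ (-(3 / 2) : ℝ) * ((N q.1 : ℝ) ^ (-(3 / 4) : ℝ)) ^ q.2)
        ≤ ((q.2 : ℝ) + 2) * ((N q.1 : ℝ) ^ (-(3 / 2) : ℝ) * ((2 : ℝ) ^ (-(3 / 4) : ℝ)) ^ q.2) := by
          gcongr _ * (_ * ?_ ^ _)
          exact Real.rpow_le_rpow_of_nonpos two_pos hp (by norm_num)
      _ = _ := by ring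

/-- Finite sums over proper prime powers, and their tails. -/
lemma exists_sum_higher_sub_le {f : P × ℕ → ℝ} {c : ℝ} (hc : 0 ≤ c)
    (hf : ∀ q : P × ℕ, |f q| ≤ c * (((q.2 : ℝ) + 2) * (ppSize N (q.1, q.2 + 1))⁻¹)) :
    Summable f ∧ ∃ C, ∀ t, 1 ≤ t →
      |∑ q ∈ higherBall N t, f q - ∑' q, f q| ≤ C * t ^ (-(1 / 4) : ℝ) := by
  have hS := R.summable_higher
  set g : P × ℕ → ℝ := fun q => ((q.2 : ℝ) + 2) * ppSize N (q.1, q.2 + 1) ^ (-(3 / 4) : ℝ)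
  have hfac : ∀ q : P × ℕ, (ppSize N (q.1, q.2 + 1))⁻¹
      = ppSize N (q.1, q.2 + 1) ^ (-(3 / 4) : ℝ) * ppSize N (q.1, q.2 + 1) ^ (-(1 / 4) : ℝ) := by
    intro q
    rw [← Real.rpow_add (ppSize_pos N _), ← Real.rpow_neg_one]; norm_num
  have hg0 : ∀ q, 0 ≤ g q := fun q => by
    have := ppSize_pos N (q.1, q.2 + 1); positivity
  have hle : ∀ q, |f q| ≤ c * (g q * ppSize N (q.1, q.2 + 1) ^ (-(1 / 4) : ℝ)) := by
    intro q
    refine (hf q).trans (le_of_eq ?_)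
    rw [hfac]; ring
  have hfs : Summable f := by
    refine Summable.of_norm_bounded (hS.mul_left c) fun q => (hle q).trans ?_
    gcongr
    refine mul_le_of_le_one_right (hg0 q) ?_
    exact Real.rpow_le_one_of_one_le_of_nonpos (by linarith [two_le_ppSize N (q.1, q.2 + 1)])
      (by norm_num)
  refine ⟨hfs, c * ∑' q, g q, fun t ht => ?_⟩
  have := abs_sum_sub_tsum_le (higherBall N t) (c := c * t ^ (-(1 / 4) : ℝ)) hfs hS hg0
    (by positivity) fun q hq => ?_
  · refine this.trans (le_of_eq (by ring))
  · rw [mem_higherBall, not_le] at hq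
    refine (hle q).trans ?_
    have h5 : ppSize N (q.1, q.2 + 1) ^ (-(1 / 4) : ℝ) ≤ t ^ (-(1 / 4) : ℝ) :=
      Real.rpow_le_rpow_of_nonpos (by linarith) hq.le (by norm_num)
    calc c * (g q * ppSize N (q.1, q.2 + 1) ^ (-(1 / 4) : ℝ))
        ≤ c * (g q * t ^ (-(1 / 4) : ℝ)) := by have := hg0 q; gcongr
      _ = _ := by ring

/-- The number of prime powers up to `t`, even when weighted with the exponents, is
`O(t / log t)`. -/
lemma exists_ppCount_le [Nonempty P] :
    ∃ C, 0 ≤ C ∧ ∀ t, 1 ≤ t → (∑ q ∈ ppBall N t, ((q.2 : ℝ) + 1)) * (1 + Real.log t) ≤ C * t := by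
  obtain ⟨C₁, hC₁, h₁⟩ := R.exists_count_le
  obtain ⟨C₂, hC₂, h₂⟩ := R.exists_psi_le
  set S := ∑' q : P × ℕ, ((q.2 : ℝ) + 2) * ppSize N (q.1, q.2 + 1) ^ (-(3 / 4) : ℝ)
  have hS0 : 0 ≤ S := tsum_nonneg fun q => by
    have := ppSize_pos N (q.1, q.2 + 1); positivity
  refine ⟨5 * C₁ + 4 * C₂ + 5 * S, by positivity, fun t ht => ?_⟩
  have ht0 : 0 < t := by linarith
  have hlog : 0 ≤ Real.log t := Real.log_nonneg ht
  have hlt := one_add_log_le ht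
  have hq : t ^ (3 / 4 : ℝ) * (1 + Real.log t) ≤ 5 * t := by
    calc t ^ (3 / 4 : ℝ) * (1 + Real.log t) ≤ t ^ (3 / 4 : ℝ) * (5 * t ^ (1 / 4 : ℝ)) := by gcongr
      _ = 5 * (t ^ (3 / 4 : ℝ) * t ^ (1 / 4 : ℝ)) := by ring
      _ = 5 * t := by rw [← Real.rpow_add ht0]; norm_num
  -- Primes above `√t` are counted by `ψ`, as `log N(p) ≥ (log t) / 2`; those below are negligible.
  have hprime : ((primeBall N t).card : ℝ) * (1 + Real.log t) ≤ (5 * C₁ + 4 * C₂) * t := by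
    have e1 : ∀ p ∈ primeBall N t, 1 + Real.log t
        ≤ 4 * Real.log (N p) + if (N p : ℝ) ≤ √t then 1 + Real.log t else 0 := by
      intro p _
      have hl := log_cast_pos N p
      split_ifs with h
      · linarith
      · rw [not_le] at h
        have a1 := Real.log_le_log (Real.sqrt_pos.2 ht0) h.le
        rw [Real.log_sqrt ht0.le] at a1
        have a2 := Real.log_le_log two_pos (two_le_cast N p)
        have a3 := Real.log_two_gt_d9
        linarith
    have e2 : ∑ p ∈ primeBall N t, Real.log (N p) ≤ psi N t := by
      have := sum_ppBall N (fun q => Real.log (N q.1)) t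
      rw [psi, this]
      simp only
      have : 0 ≤ ∑ q ∈ higherBall N t, Real.log (N q.1) :=
        Finset.sum_nonneg fun q _ => (log_cast_pos N q.1).le
      linarith
    have e3 : (((primeBall N t).filter (fun p => (N p : ℝ) ≤ √t)).card : ℝ) ≤ count N √t := by
      unfold count
      norm_cast
      refine Finset.card_le_card_of_injOn (fun p => primePow (p, 0)) (fun p hp => ?_)
        fun a _ b _ h => (Prod.ext_iff.1 (primePow_injective h)).1
      have := (Finset.mem_filter.1 hp).2
      simpa [mem_ball, size_primePow, ppSize] using this
    have e4 : √t ≤ t ^ (3 / 4 : ℝ) := by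
      rw [Real.sqrt_eq_rpow]; exact Real.rpow_le_rpow_of_exponent_le ht (by norm_num)
    calc ((primeBall N t).card : ℝ) * (1 + Real.log t)
        = ∑ p ∈ primeBall N t, (1 + Real.log t) := by rw [Finset.sum_const, nsmul_eq_mul]
      _ ≤ ∑ p ∈ primeBall N t, (4 * Real.log (N p) +
            if (N p : ℝ) ≤ √t then 1 + Real.log t else 0) := Finset.sum_le_sum e1
      _ = 4 * ∑ p ∈ primeBall N t, Real.log (N p) +
            ((primeBall N t).filter (fun p => (N p : ℝ) ≤ √t)).card * (1 + Real.log t) := by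
          rw [Finset.sum_add_distrib, ← Finset.mul_sum, ← Finset.sum_filter, Finset.sum_const,
            nsmul_eq_mul]
      _ ≤ 4 * (C₂ * t) + C₁ * t ^ (3 / 4 : ℝ) * (1 + Real.log t) := by
          gcongr
          · exact e2.trans (h₂ t ht0.le)
          · exact e3.trans ((h₁ _ (Real.sqrt_nonneg t)).trans (by gcongr))
      _ ≤ _ := by nlinarith
  have hhigher : (∑ q ∈ higherBall N t, ((q.2 : ℝ) + 2)) ≤ S * t ^ (3 / 4 : ℝ) := by
    have hsum := R.summable_higher.sum_le_tsum (higherBall N t) (fun q _ => by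
      have := ppSize_pos N (q.1, q.2 + 1); positivity)
    refine le_trans ?_ (mul_le_mul_of_nonneg_right hsum (by positivity))
    rw [Finset.sum_mul]
    refine Finset.sum_le_sum fun q hq => ?_
    have hq0 := ppSize_pos N (q.1, q.2 + 1)
    have := mem_higherBall.1 hq
    rw [mul_assoc]
    refine le_mul_of_one_le_right (by positivity) ?_
    rw [Real.rpow_neg hq0.le, ← div_eq_inv_mul, ← Real.div_rpow ht0.le hq0.le]
    exact Real.one_le_rpow ((one_le_div hq0).2 this) (by norm_num)
  have hsplit := sum_ppBall N (fun q => (q.2 : ℝ) + 1) t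
  simp only [CharP.cast_eq_zero, zero_add, Finset.sum_const, nsmul_eq_mul, mul_one] at hsplit
  have h6 : ∑ q ∈ higherBall N t, (((q.2 + 1 : ℕ) : ℝ) + 1)
      = ∑ q ∈ higherBall N t, ((q.2 : ℝ) + 2) :=
    Finset.sum_congr rfl fun q _ => by push_cast; ring
  rw [hsplit, h6, add_mul]
  have h7 : (∑ q ∈ higherBall N t, ((q.2 : ℝ) + 2)) * (1 + Real.log t)
      ≤ S * t ^ (3 / 4 : ℝ) * (1 + Real.log t) := by gcongr
  nlinarith

end Regular

end

section

/-! ### Mertens' theorems -/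

variable {P : Type*} (N : P → ℕ) [NormFinite N]

/-- `∑ log N(p) / N(p) ^ k` over the prime powers of norm at most `t`. -/
def logSum (t : ℝ) : ℝ := ∑ q ∈ ppBall N t, Real.log (N q.1) * (ppSize N q)⁻¹

/-- `∑ log N(p) / N(p)` over the primes of norm at most `t`. -/
def primeLogSum (t : ℝ) : ℝ := ∑ p ∈ primeBall N t, Real.log (N p) * (N p : ℝ)⁻¹

/-- `∑ 1 / N(p)` over the primes of norm at most `t`. -/
def primeSum (t : ℝ) : ℝ := ∑ p ∈ primeBall N t, (N p : ℝ)⁻¹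

/-- The sum of `v(k) / N(p) ^ (k + 1)` over the prime powers of norm at most `t`. -/
def ppSum (v : ℕ → ℝ) (t : ℝ) : ℝ := ∑ q ∈ ppBall N t, v q.2 * (ppSize N q)⁻¹

lemma logSum_mono {s t : ℝ} (h : s ≤ t) : logSum N s ≤ logSum N t :=
  Finset.sum_le_sum_of_subset_of_nonneg (ppBall_mono N h) fun q _ _ =>
    mul_nonneg (log_cast_pos N q.1).le (inv_nonneg.2 (ppSize_pos N q).le)

lemma logSum_nonneg (t : ℝ) : 0 ≤ logSum N t :=
  Finset.sum_nonneg fun q _ =>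
    mul_nonneg (log_cast_pos N q.1).le (inv_nonneg.2 (ppSize_pos N q).le)

lemma sum_primeBall_succ (f : P → ℝ) (n : ℕ) :
    ∑ p ∈ primeBall N ((n + 1 : ℕ) : ℝ), f p
      = ∑ p ∈ primeBall N n, f p
        + ∑ p ∈ (primeBall N ((n + 1 : ℕ) : ℝ)).filter (N · = n + 1), f p := by
  rw [← Finset.sum_filter_add_sum_filter_not (primeBall N ((n + 1 : ℕ) : ℝ)) (N · = n + 1),
    add_comm]
  congr 1
  refine Finset.sum_congr ?_ fun _ _ => rfl
  ext p
  simp only [Finset.mem_filter, mem_primeBall, Nat.cast_le]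
  omega

/-- Abel summation between `∑ log N(p) / N(p)` and `∑ 1 / N(p)`, one step at a time. -/
lemma primeSum_succ (n : ℕ) :
    primeSum N ((n + 1 : ℕ) : ℝ) - primeSum N n
      = (primeLogSum N ((n + 1 : ℕ) : ℝ) - primeLogSum N n) / Real.log ((n + 1 : ℕ) : ℝ) := by
  unfold primeSum primeLogSum
  rw [sum_primeBall_succ, sum_primeBall_succ, add_sub_cancel_left, add_sub_cancel_left,
    Finset.sum_div]
  refine Finset.sum_congr rfl fun p hp => ?_
  have h1 := (Finset.mem_filter.1 hp).2
  have h2 := log_cast_pos N p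
  rw [← h1]
  field_simp

/-- `log log` behaves like a sum of the increments of `log` divided by `log`. -/
lemma abs_loglog_sub_le {a b : ℝ} (ha : 0 < a) (hab : a ≤ b) (hba : b ≤ a + 1) :
    |(b - a) / b - (Real.log b - Real.log a)| ≤ 1 / a - 1 / b := by
  have hb : 0 < b := by linarith
  have h1 : Real.log b - Real.log a ≤ (b - a) / a := by
    rw [← Real.log_div hb.ne' ha.ne']
    refine (Real.log_le_sub_one_of_pos (by positivity)).trans (le_of_eq ?_)
    field_simp
  have h2 : (b - a) / b ≤ Real.log b - Real.log a := by
    have := Real.log_le_sub_one_of_pos (show 0 < a / b by positivity)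
    rw [Real.log_div ha.ne' hb.ne'] at this
    have h3 : (b - a) / b = 1 - a / b := by field_simp
    linarith
  have h4 : (b - a) / a - (b - a) / b ≤ 1 / a - 1 / b := by
    have h5 : (b - a) / a - (b - a) / b = (b - a) * (1 / a - 1 / b) := by ring
    have h6 : 0 ≤ 1 / a - 1 / b := sub_nonneg.2 (one_div_le_one_div_of_le ha hab)
    rw [h5]
    exact mul_le_of_le_one_left h6 (by linarith)
  rw [abs_le]
  constructor <;> linarith

lemma inv_rpow_quarter_le {t : ℝ} (ht : 2 ≤ t) : t ^ (-(1 / 4) : ℝ) ≤ 4 / Real.log t := by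
  have hl : 0 < Real.log t := Real.log_pos (by linarith)
  have h1 := Real.log_le_rpow_div (by linarith : 0 ≤ t) (by norm_num : (0 : ℝ) < 1 / 4)
  have h2 : 0 < t ^ (1 / 4 : ℝ) := by positivity
  rw [Real.rpow_neg (by linarith), le_div_iff₀ hl, inv_mul_le_iff₀ h2]
  linarith

variable {N} {Y : Set ℝ} {κ θ K : ℝ}

namespace Regular

variable (R : Regular N Y κ θ K)
include R

/-- Replacing the counting function by its main term in a sum over prime powers. -/
lemma abs_sum_mul_count_sub_le {u : P × ℕ → ℝ} (hu : ∀ q, 0 ≤ u q) {y : ℝ} (hy : y ∈ Y) :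
    |∑ q ∈ ppBall N y, u q * count N (y / ppSize N q)
        - κ * y * ∑ q ∈ ppBall N y, u q * (ppSize N q)⁻¹|
      ≤ K * ∑ q ∈ ppBall N y, u q * (y / ppSize N q) ^ θ := by
  have h1 : ∑ q ∈ ppBall N y, u q * count N (y / ppSize N q)
        - κ * y * ∑ q ∈ ppBall N y, u q * (ppSize N q)⁻¹
      = ∑ q ∈ ppBall N y, u q * (count N (y / ppSize N q) - κ * (y / ppSize N q)) := by
    rw [Finset.mul_sum, ← Finset.sum_sub_distrib]
    refine Finset.sum_congr rfl fun q _ => ?_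
    ring
  rw [h1, Finset.mul_sum]
  refine (Finset.abs_sum_le_sum_abs _ _).trans (Finset.sum_le_sum fun q _ => ?_)
  rw [abs_mul, abs_of_nonneg (hu q)]
  have := R.count_le _ (R.div_mem _ hy _ (R.ppSize_mem q))
  calc u q * |count N (y / ppSize N q) - κ * (y / ppSize N q)|
      ≤ u q * (K * (y / ppSize N q) ^ θ) := mul_le_mul_of_nonneg_left this (hu q)
    _ = _ := by ring

/-- If `u` has partial sums `O(t)` over the prime powers, its smoothed sums are `O(y)`. -/
lemma sum_ppBall_mul_rpow_le {u : P × ℕ → ℝ} (hu : ∀ q, 0 ≤ u q) {C y : ℝ} (hy : 0 < y)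
    (hC : ∀ t, 0 < t → t ≤ y → ∑ q ∈ ppBall N t, u q ≤ C * t) :
    ∑ q ∈ ppBall N y, u q * (y / ppSize N q) ^ θ ≤ 2 ^ θ * (1 - 2 ^ (θ - 1))⁻¹ * C * y := by
  refine sum_mul_div_rpow_le (ppBall N y) (ppSize N) u R.theta_pos.le R.theta_lt hy
    (fun q _ => hu q) (fun q hq => ⟨ppSize_pos N q, mem_ppBall.1 hq⟩) fun t ht hty => ?_
  refine le_trans (Finset.sum_le_sum_of_subset_of_nonneg ?_ fun q _ _ => hu q) (hC t ht hty)
  intro q hq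
  exact mem_ppBall.2 (Finset.mem_filter.1 hq).2

/-- Mertens' first theorem over prime powers: the sum of `log N(m)` over the elements of norm at
most `y` is evaluated directly and by expanding the logarithm over prime powers. -/
lemma exists_logSum_sub_log_le [Nonempty P] :
    ∃ C, ∀ t, 1 ≤ t → |logSum N t - Real.log t| ≤ C := by
  obtain ⟨C₁, hC₁, h₁⟩ := R.exists_psi_le
  obtain ⟨c, C₂, h₂⟩ := R.exists_sum_log
  have hκ := R.kappa_pos
  have hC₂ : 0 ≤ C₂ := by
    have := (abs_nonneg _).trans (h₂ 1 R.one_mem le_rfl)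
    simpa using this
  set C₃ := K * (2 ^ θ * (1 - 2 ^ (θ - 1))⁻¹ * C₁)
  set C₄ := (C₃ + C₂ + |c|) / κ with hC₄
  have hY : ∀ y ∈ Y, 1 ≤ y → |logSum N y - Real.log y| ≤ C₄ := by
    intro y hy hy1
    have hy0 : 0 < y := by linarith
    have e1 := (R.abs_sum_mul_count_sub_le (u := fun q => Real.log (N q.1))
      (fun q => (log_cast_pos N q.1).le) hy).trans (mul_le_mul_of_nonneg_left
        (R.sum_ppBall_mul_rpow_le (fun q => (log_cast_pos N q.1).le) hy0 fun t ht _ => h₁ t ht.le)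
        R.const_nonneg)
    have e2 := sum_additive_mul N (fun p => Real.log (N p)) (fun _ => 1) y
    simp only [mul_one, Finset.sum_const, nsmul_eq_mul, ← log_size_eq] at e2
    simp only [count] at e1
    rw [← e2] at e1
    have e3 := h₂ y hy hy1
    have e4 : y ^ ((1 + θ) / 2) ≤ y :=
      Real.rpow_le_self_of_one_le hy1 (by linarith [R.theta_lt])
    rw [hC₄, le_div_iff₀ hκ, ← mul_le_mul_iff_of_pos_right hy0]
    calc |logSum N y - Real.log y| * κ * y
        = |κ * y * logSum N y - κ * y * Real.log y| := by
          rw [← mul_sub, abs_mul, abs_of_pos (by positivity : 0 < κ * y)]; ring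
      _ = |(∑ m ∈ ball N y, Real.log (size N m) - κ * y * Real.log y - c * y) + c * y
            - (∑ m ∈ ball N y, Real.log (size N m) - κ * y * logSum N y)| := by
          congr 1; ring
      _ ≤ C₂ * y + |c| * y + C₃ * y := by
          refine (abs_sub _ _).trans (add_le_add ((abs_add_le _ _).trans
            (add_le_add (e3.trans (by gcongr)) ?_)) ?_)
          · rw [abs_mul, abs_of_pos hy0]
          · refine e1.trans (le_of_eq ?_); ring
      _ = _ := by ring
  obtain ⟨b, hb, hbY⟩ := R.exists_mem_ge
  have hlb : 0 ≤ Real.log b := Real.log_nonneg (by linarith)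
  have hC₄0 : 0 ≤ C₄ := (abs_nonneg _).trans (hY 1 R.one_mem le_rfl)
  refine ⟨C₄ + Real.log b, fun t ht => ?_⟩
  have ht0 : 0 < t := by linarith
  rw [abs_le]
  constructor
  · rcases lt_or_ge t b with htb | htb
    · have := Real.log_le_log ht0 htb.le
      have := logSum_nonneg N t
      linarith
    · obtain ⟨x, hx, hx1, hx2⟩ := hbY (t / b) ((one_le_div (by linarith)).2 htb)
      have hx3 : x ≤ t := hx2.trans (le_of_eq (by field_simp))
      have a1 := logSum_mono N hx3
      have hx4 : 1 ≤ x := ((one_le_div (by linarith)).2 htb).trans hx1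
      have a2 := (abs_le.1 (hY x hx hx4)).1
      have a3 := Real.log_le_log (by positivity) hx1
      rw [Real.log_div ht0.ne' (by linarith)] at a3
      linarith
  · obtain ⟨x, hx, hx1, hx2⟩ := hbY t ht
    have a1 := logSum_mono N hx1
    have a2 := (abs_le.1 (hY x hx (ht.trans hx1))).2
    have a3 := Real.log_le_log (by linarith) hx2
    rw [Real.log_mul (by linarith) ht0.ne'] at a3
    linarith

/-- Mertens' first theorem over primes. -/
lemma exists_primeLogSum_sub_log_le [Nonempty P] :
    ∃ C, 0 ≤ C ∧ ∀ t, 1 ≤ t → |primeLogSum N t - Real.log t| ≤ C := by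
  obtain ⟨C₁, h₁⟩ := R.exists_logSum_sub_log_le
  have hS := R.summable_higher
  set S := ∑' q : P × ℕ, ((q.2 : ℝ) + 2) * ppSize N (q.1, q.2 + 1) ^ (-(3 / 4) : ℝ)
  have hS0 : 0 ≤ S := tsum_nonneg fun q => by
    have := ppSize_pos N (q.1, q.2 + 1); positivity
  have hC₁ : 0 ≤ C₁ := (abs_nonneg _).trans (h₁ 1 le_rfl)
  refine ⟨C₁ + 4 * S, by positivity, fun t ht => ?_⟩
  have h2 := sum_ppBall N (fun q => Real.log (N q.1) * (ppSize N q)⁻¹) t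
  have h3 : ∑ p ∈ primeBall N t, Real.log (N p) * (ppSize N (p, 0))⁻¹ = primeLogSum N t :=
    Finset.sum_congr rfl fun p _ => by simp [ppSize]
  have h4 : |∑ q ∈ higherBall N t, Real.log (N q.1) * (ppSize N (q.1, q.2 + 1))⁻¹| ≤ 4 * S := by
    rw [abs_of_nonneg (Finset.sum_nonneg fun q _ => mul_nonneg (log_cast_pos N q.1).le
      (inv_nonneg.2 (ppSize_pos N _).le))]
    refine le_trans ?_ (mul_le_mul_of_nonneg_left (hS.sum_le_tsum (higherBall N t) fun q _ => by
      have := ppSize_pos N (q.1, q.2 + 1); positivity) (by norm_num))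
    rw [Finset.mul_sum]
    refine Finset.sum_le_sum fun q _ => ?_
    have hq := two_le_ppSize N (q.1, q.2 + 1)
    have hq0 := ppSize_pos N (q.1, q.2 + 1)
    have e1 : Real.log (N q.1) ≤ Real.log (ppSize N (q.1, q.2 + 1)) := by
      refine Real.log_le_log (by linarith [two_le_cast N q.1]) ?_
      exact le_self_pow₀ (by linarith [two_le_cast N q.1]) (by omega)
    have e2 := Real.log_le_rpow_div hq0.le (by norm_num : (0 : ℝ) < 1 / 4)
    have e3 : ppSize N (q.1, q.2 + 1) ^ (1 / 4 : ℝ) * (ppSize N (q.1, q.2 + 1))⁻¹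
        = ppSize N (q.1, q.2 + 1) ^ (-(3 / 4) : ℝ) := by
      rw [← Real.rpow_neg_one, ← Real.rpow_add hq0]; norm_num
    have e4 : 0 < ppSize N (q.1, q.2 + 1) ^ (-(3 / 4) : ℝ) := by positivity
    calc Real.log (N q.1) * (ppSize N (q.1, q.2 + 1))⁻¹
        ≤ ppSize N (q.1, q.2 + 1) ^ (1 / 4 : ℝ) / (1 / 4) * (ppSize N (q.1, q.2 + 1))⁻¹ := by
          gcongr; exact e1.trans e2
      _ = 4 * ppSize N (q.1, q.2 + 1) ^ (-(3 / 4) : ℝ) := by rw [← e3]; ring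
      _ ≤ _ := by
          have : (0 : ℝ) ≤ q.2 := Nat.cast_nonneg _
          nlinarith
  rw [h3] at h2
  have h5 := h₁ t ht
  rw [logSum, h2] at h5
  calc |primeLogSum N t - Real.log t|
      = |(primeLogSum N t + ∑ q ∈ higherBall N t, Real.log (N q.1) * (ppSize N (q.1, q.2 + 1))⁻¹
            - Real.log t)
          - ∑ q ∈ higherBall N t, Real.log (N q.1) * (ppSize N (q.1, q.2 + 1))⁻¹| := by
        congr 1; ring
    _ ≤ _ := (abs_sub _ _).trans (add_le_add h5 h4)

/-- Mertens' second theorem: the limit defining `𝔄` exists, with an explicit rate, and may be taken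
over all real arguments. -/
lemma exists_mertens [Nonempty P] :
    ∃ A C, ∀ t, 2 ≤ t →
      |primeSum N t - Real.log (Real.log t) - A| ≤ C / Real.log t := by
  obtain ⟨C, hC, h⟩ := R.exists_primeLogSum_sub_log_le
  -- Summation by parts over integers: `E` is the error in the first theorem, and the boundary term
  -- `E n / l n` is removed in `Φ`, whose increments then telescope against `1 / l n`.
  set l : ℕ → ℝ := fun n => Real.log n with hl
  set E : ℕ → ℝ := fun n => primeLogSum N n - l n with hE
  set Φ : ℕ → ℝ := fun n => primeSum N n - Real.log (l n) - E n / l n with hΦ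
  have hlpos : ∀ n, 2 ≤ n → 0 < l n := fun n hn => Real.log_pos (by exact_mod_cast hn)
  have hEle : ∀ n, 2 ≤ n → |E n| ≤ C := fun n hn => h n (by exact_mod_cast (by omega : 1 ≤ n))
  have hlmono : ∀ n, 2 ≤ n → l n ≤ l (n + 1) := fun n hn => by
    refine Real.log_le_log (by exact_mod_cast (by omega : 0 < n)) ?_
    push_cast; linarith
  have hlone : ∀ n, 2 ≤ n → l (n + 1) ≤ l n + 1 := by
    intro n hn
    have hn0 : (0 : ℝ) < n := by exact_mod_cast (by omega : 0 < n)
    have h1 : l (n + 1) - l n = Real.log (((n + 1 : ℕ) : ℝ) / n) := by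
      rw [Real.log_div (by positivity) hn0.ne']
    have h2 := Real.log_le_sub_one_of_pos (show 0 < ((n + 1 : ℕ) : ℝ) / n by positivity)
    have h3 : ((n + 1 : ℕ) : ℝ) / n - 1 = 1 / n := by push_cast; field_simp; ring
    have h4 : (1 : ℝ) / n ≤ 1 := by
      rw [div_le_one hn0]; exact_mod_cast (by omega : 1 ≤ n)
    linarith
  have hstep : ∀ n, 2 ≤ n → |Φ (n + 1) - Φ n| ≤ (C + 1) * (1 / l n - 1 / l (n + 1)) := by
    intro n hn
    have a0 := hlpos n hn
    have a1 := hlpos (n + 1) (by omega)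
    have a2 := primeSum_succ N n
    have a3 := abs_loglog_sub_le a0 (hlmono n hn) (hlone n hn)
    have a4 : 0 ≤ 1 / l n - 1 / l (n + 1) :=
      sub_nonneg.2 (one_div_le_one_div_of_le a0 (hlmono n hn))
    have a5 : Φ (n + 1) - Φ n = E n * (1 / l n - 1 / l (n + 1))
        + ((l (n + 1) - l n) / l (n + 1) - (Real.log (l (n + 1)) - Real.log (l n))) := by
      have b1 : primeLogSum N ((n + 1 : ℕ) : ℝ) = E (n + 1) + l (n + 1) := by simp [hE]
      have b2 : primeLogSum N (n : ℝ) = E n + l n := by simp [hE]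
      rw [b1, b2] at a2
      change _ = (E (n + 1) + l (n + 1) - (E n + l n)) / l (n + 1) at a2
      have b3 : Φ (n + 1) - Φ n = (primeSum N ((n + 1 : ℕ) : ℝ) - primeSum N n)
        - (Real.log (l (n + 1)) - Real.log (l n)) - E (n + 1) / l (n + 1) + E n / l n := by
        simp only [hΦ]; ring
      rw [b3, a2]
      ring
    rw [a5]
    refine (abs_add_le _ _).trans ?_
    rw [abs_mul, abs_of_nonneg a4, add_mul, one_mul]
    exact add_le_add (mul_le_mul_of_nonneg_right (hEle n hn) a4) a3
  have hdiff : ∀ m, 2 ≤ m → ∀ n, m ≤ n → |Φ n - Φ m| ≤ (C + 1) * (1 / l m - 1 / l n) := by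
    intro m hm n hmn
    induction n, hmn using Nat.le_induction with
    | base => simp
    | succ n hmn ih =>
      have := hstep n (hm.trans hmn)
      calc |Φ (n + 1) - Φ m| = |(Φ (n + 1) - Φ n) + (Φ n - Φ m)| := by congr 1; ring
        _ ≤ _ := (abs_add_le _ _).trans (add_le_add this ih)
        _ = _ := by ring
  have hdiff' : ∀ m, 2 ≤ m → ∀ n, m ≤ n → |Φ n - Φ m| ≤ (C + 1) / l m := by
    intro m hm n hmn
    refine (hdiff m hm n hmn).trans ?_
    have := hlpos n (hm.trans hmn)
    rw [mul_sub, mul_one_div]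
    have : 0 ≤ (C + 1) * (1 / l n) := by positivity
    linarith
  have hltop : Tendsto (fun n : ℕ => l (n + 2)) atTop atTop :=
    (Real.tendsto_log_atTop.comp tendsto_natCast_atTop_atTop).comp (tendsto_add_atTop_nat 2)
  have hcau : CauchySeq fun n => Φ (n + 2) := by
    refine cauchySeq_of_le_tendsto_0' (fun n => (C + 1) / l (n + 2)) (fun m n hmn => ?_)
      (hltop.const_div_atTop _)
    rw [dist_comm, Real.dist_eq]
    exact hdiff' _ (by omega) _ (by omega)
  obtain ⟨A, hA⟩ := cauchySeq_tendsto_of_complete hcau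
  have hlim : ∀ m, 2 ≤ m → |Φ m - A| ≤ (C + 1) / l m := by
    intro m hm
    have h1 : Tendsto (fun n => |Φ (n + 2) - Φ m|) atTop (𝓝 |A - Φ m|) :=
      (hA.sub_const _).abs
    rw [abs_sub_comm]
    refine le_of_tendsto h1 ?_
    filter_upwards [eventually_ge_atTop m] with n hn
    exact hdiff' m hm _ (by omega)
  refine ⟨A, 4 * C + 4, fun t ht => ?_⟩
  have ht0 : 0 < t := by linarith
  set n := ⌊t⌋₊ with hn
  have hn2 : 2 ≤ n := Nat.le_floor (by exact_mod_cast ht)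
  have hnt : (n : ℝ) ≤ t := Nat.floor_le ht0.le
  have htn : t ≤ n + 1 := (Nat.lt_floor_add_one t).le
  have hn2' : (2 : ℝ) ≤ n := by exact_mod_cast hn2
  have b1 : primeSum N t = primeSum N n := by
    unfold primeSum
    refine Finset.sum_congr ?_ fun _ _ => rfl
    ext p
    rw [mem_primeBall, mem_primeBall, ← Nat.le_floor_iff ht0.le, Nat.cast_le]
  have hlt : l n ≤ Real.log t := Real.log_le_log (by linarith) hnt
  have hln := hlpos n hn2
  have hlogt : 0 < Real.log t := by linarith
  have hl2 : Real.log t ≤ 2 * l n := by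
    have : t ≤ (n : ℝ) ^ 2 := by nlinarith
    have := Real.log_le_log ht0 this
    rw [Real.log_pow] at this
    exact_mod_cast this
  have hl1 : Real.log t ≤ l n + 1 := by
    have := hlone n hn2
    refine le_trans (Real.log_le_log ht0 ?_) this
    push_cast; exact htn
  have b2 : |Real.log (Real.log t) - Real.log (l n)| ≤ 1 / l n := by
    rw [abs_of_nonneg (sub_nonneg.2 (Real.log_le_log hln hlt)),
      ← Real.log_div hlogt.ne' hln.ne']
    refine (Real.log_le_sub_one_of_pos (by positivity)).trans ?_
    rw [div_sub_one hln.ne']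
    gcongr
    linarith
  have b3 : |E n / l n| ≤ C / l n := by
    rw [abs_div, abs_of_pos hln]
    gcongr
    exact hEle n hn2
  have b4 := hlim n hn2
  have b5 : 1 / l n ≤ 2 / Real.log t := by
    rw [div_le_div_iff₀ hln hlogt]; linarith
  calc |primeSum N t - Real.log (Real.log t) - A|
      = |(Φ n - A) + E n / l n - (Real.log (Real.log t) - Real.log (l n))| := by
        rw [b1]; simp only [hΦ]; congr 1; ring
    _ ≤ (C + 1) / l n + C / l n + 1 / l n :=
        (abs_sub _ _).trans (add_le_add ((abs_add_le _ _).trans (add_le_add b4 b3)) b2)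
    _ = (2 * C + 2) * (1 / l n) := by ring
    _ ≤ (2 * C + 2) * (2 / Real.log t) := by gcongr
    _ = _ := by ring

lemma summable_weight {v : ℕ → ℝ} (hv : ∀ k, |v k| ≤ k + 1) :
    Summable fun q : P × ℕ => v (q.2 + 1) * (ppSize N (q.1, q.2 + 1))⁻¹ := by
  refine (R.exists_sum_higher_sub_le (c := 1) zero_le_one fun q => ?_).1
  have hq0 := ppSize_pos N (q.1, q.2 + 1)
  rw [abs_mul, abs_of_pos (inv_pos.2 hq0), one_mul]
  gcongr
  refine (hv _).trans (le_of_eq ?_); push_cast; ring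

/-- Mertens' theorem for prime powers, with a weight depending on the exponent. -/
lemma exists_ppSum_sub_le {v : ℕ → ℝ} (hv0 : v 0 = 1) (hv : ∀ k, |v k| ≤ k + 1) {A C₁ : ℝ}
    (hA : ∀ t, 2 ≤ t → |primeSum N t - Real.log (Real.log t) - A| ≤ C₁ / Real.log t) :
    ∃ C, ∀ t, 2 ≤ t → |ppSum N v t - Real.log (Real.log t)
        - (A + ∑' q : P × ℕ, v (q.2 + 1) * (ppSize N (q.1, q.2 + 1))⁻¹)| ≤ C / Real.log t := by
  obtain ⟨-, C₂, h₂⟩ := R.exists_sum_higher_sub_le (c := 1)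
    (f := fun q : P × ℕ => v (q.2 + 1) * (ppSize N (q.1, q.2 + 1))⁻¹) zero_le_one fun q => by
      have hq0 := ppSize_pos N (q.1, q.2 + 1)
      rw [abs_mul, abs_of_pos (inv_pos.2 hq0), one_mul]
      gcongr
      refine (hv _).trans (le_of_eq ?_); push_cast; ring
  have hC₂ : 0 ≤ C₂ := by
    have := (abs_nonneg _).trans (h₂ 1 le_rfl)
    simpa using this
  refine ⟨C₁ + 4 * C₂, fun t ht => ?_⟩
  have h3 := sum_ppBall N (fun q => v q.2 * (ppSize N q)⁻¹) t
  have h4 : ∑ p ∈ primeBall N t, v 0 * (ppSize N (p, 0))⁻¹ = primeSum N t :=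
    Finset.sum_congr rfl fun p _ => by simp [ppSize, hv0]
  rw [h4] at h3
  have h5 := h₂ t (by linarith)
  have h6 : C₂ * t ^ (-(1 / 4) : ℝ) ≤ 4 * C₂ / Real.log t := by
    calc _ ≤ C₂ * (4 / Real.log t) := by gcongr; exact inv_rpow_quarter_le ht
      _ = _ := by ring
  rw [ppSum, h3]
  set T := ∑' q : P × ℕ, v (q.2 + 1) * (ppSize N (q.1, q.2 + 1))⁻¹
  calc _ = |(primeSum N t - Real.log (Real.log t) - A)
        + (∑ q ∈ higherBall N t, v (q.2 + 1) * (ppSize N (q.1, q.2 + 1))⁻¹ - T)| := by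
        congr 1; ring
    _ ≤ C₁ / Real.log t + 4 * C₂ / Real.log t :=
        (abs_add_le _ _).trans (add_le_add (hA t ht) (h5.trans h6))
    _ = _ := by ring

end Regular

end

section

/-! ### Self-convolution of sequences with logarithmic partial sums -/

/-- The harmonic numbers, as a partial sum in which the zeroth term is the junk value `1 / 0 = 0`. -/
def harm (n : ℕ) : ℝ := ∑ i ∈ Finset.range (n + 1), 1 / (i : ℝ)

lemma harm_succ (n : ℕ) : harm (n + 1) = harm n + 1 / ((n + 1 : ℕ) : ℝ) :=
  Finset.sum_range_succ _ _

lemma harm_zero : harm 0 = 0 := by simp [harm]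

lemma harm_eq (n : ℕ) : harm n = (harmonic n : ℝ) := by
  induction n with
  | zero => simp [harm]
  | succ n ih => rw [harm_succ, ih, harmonic_succ]; push_cast; ring

lemma abs_harm_sub_le {n : ℕ} (hn : 1 ≤ n) :
    |harm n - Real.log n - Real.eulerMascheroniConstant| ≤ 1 / n := by
  have hn0 : (0 : ℝ) < n := by exact_mod_cast hn
  have h1 := Real.eulerMascheroniSeq_lt_eulerMascheroniConstant n
  have h2 := Real.eulerMascheroniConstant_lt_eulerMascheroniSeq' n
  rw [Real.eulerMascheroniSeq, ← harm_eq] at h1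
  rw [Real.eulerMascheroniSeq', if_neg (by omega), ← harm_eq] at h2
  have h3 := Real.log_le_sub_one_of_pos (show 0 < ((n : ℝ) + 1) / n by positivity)
  rw [Real.log_div (by positivity) hn0.ne'] at h3
  have h4 : ((n : ℝ) + 1) / n - 1 = 1 / n := by field_simp; ring
  rw [abs_le]
  constructor <;> linarith

lemma harm_nonneg (n : ℕ) : 0 ≤ harm n := Finset.sum_nonneg fun _ _ => by positivity

lemma harm_le (n : ℕ) : harm n ≤ 1 + Real.log n := by
  rw [harm_eq]; exact harmonic_le_one_add_log n

lemma sum_one_div_mul (n : ℕ) :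
    ∑ i ∈ Finset.range (n + 1), 1 / (((i : ℝ) + 1) * ((n - i : ℕ) + 1))
      = 2 / ((n : ℝ) + 2) * harm (n + 1) := by
  have h1 : harm (n + 1) = ∑ i ∈ Finset.range (n + 1), 1 / ((i : ℝ) + 1) := by
    rw [harm, Finset.sum_range_succ']; simp
  have h2 : harm (n + 1) = ∑ i ∈ Finset.range (n + 1), 1 / (((n - i : ℕ) : ℝ) + 1) := by
    rw [h1, ← Finset.sum_range_reflect]
    refine Finset.sum_congr rfl fun i hi => ?_
    have : n + 1 - 1 - i = n - i := by omega
    rw [this]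
  have h3 : 2 / ((n : ℝ) + 2) * harm (n + 1)
      = 1 / ((n : ℝ) + 2) * (harm (n + 1) + harm (n + 1)) := by ring
  rw [h3]
  conv_rhs => rw [h1]
  conv_rhs => enter [2, 2]; rw [← h1, h2]
  rw [← Finset.sum_add_distrib, Finset.mul_sum]
  refine Finset.sum_congr rfl fun i hi => ?_
  have hi : i ≤ n := Nat.lt_succ_iff.1 (Finset.mem_range.1 hi)
  have : ((n - i : ℕ) : ℝ) = n - i := Nat.cast_sub hi
  have hle : (i : ℝ) ≤ n := by exact_mod_cast hi
  rw [this]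
  have h4 : (n : ℝ) - i + 1 ≠ 0 := by linarith
  have h5 : (i : ℝ) + 1 ≠ 0 := by positivity
  field_simp
  ring

lemma sum_one_div_mul_le {n : ℕ} (hn : 1 ≤ n) :
    ∑ i ∈ Finset.range (n + 1), 1 / (((i : ℝ) + 1) * ((n - i : ℕ) + 1))
      ≤ 4 * ((1 + Real.log n) / n) := by
  have hn0 : (1 : ℝ) ≤ n := by exact_mod_cast hn
  rw [sum_one_div_mul]
  have h1 := harm_le n
  have h2 : harm (n + 1) ≤ 2 + Real.log n := by
    rw [harm_succ]
    have : 1 / ((n + 1 : ℕ) : ℝ) ≤ 1 := by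
      rw [div_le_one (by positivity)]; push_cast; linarith
    linarith
  have h3 : 0 ≤ Real.log n := Real.log_nonneg hn0
  have h4 := harm_nonneg (n + 1)
  calc 2 / ((n : ℝ) + 2) * harm (n + 1) ≤ 2 / n * (2 * (1 + Real.log n)) := by
        gcongr
        · linarith
        · linarith
    _ = _ := by ring

/-- The self-convolution of `1 / i`. -/
lemma sum_one_div_mul_harm (n : ℕ) :
    ∑ i ∈ Finset.range (n + 1), 1 / (i : ℝ) * harm (n - i)
      = harm n ^ 2 - ∑ i ∈ Finset.range (n + 1), 1 / (i : ℝ) ^ 2 := by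
  induction n with
  | zero => simp [harm]
  | succ n ih =>
    have h1 : ∑ i ∈ Finset.range (n + 2), 1 / (i : ℝ) * harm (n + 1 - i)
        = ∑ i ∈ Finset.range (n + 1), 1 / (i : ℝ) * harm (n - i)
          + ∑ i ∈ Finset.range (n + 1), 1 / (i : ℝ) * (1 / ((n + 1 - i : ℕ) : ℝ)) := by
      rw [Finset.sum_range_succ, Nat.sub_self, harm_zero, mul_zero, add_zero,
        ← Finset.sum_add_distrib]
      refine Finset.sum_congr rfl fun i hi => ?_
      have hi : i ≤ n := Nat.lt_succ_iff.1 (Finset.mem_range.1 hi)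
      rw [Nat.succ_sub hi, harm_succ]; ring
    have h2 : ∑ i ∈ Finset.range (n + 1), 1 / (i : ℝ) * (1 / ((n + 1 - i : ℕ) : ℝ))
        = 2 / ((n : ℝ) + 1) * harm n := by
      rcases n with - | m
      · simp [harm]
      · rw [Finset.sum_range_succ']
        have := sum_one_div_mul m
        simp only [CharP.cast_eq_zero, div_zero, zero_mul, add_zero]
        push_cast at this ⊢
        have e : (m : ℝ) + 1 + 1 = m + 2 := by ring
        rw [e, ← this]
        refine Finset.sum_congr rfl fun i hi => ?_
        have hi : i ≤ m := Nat.lt_succ_iff.1 (Finset.mem_range.1 hi)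
        have : m + 1 - i = (m - i) + 1 := by omega
        rw [this]; push_cast
        rw [one_div_mul_one_div]
    rw [h1, ih, h2, harm_succ, Finset.sum_range_succ _ (n + 1)]
    have : (n : ℝ) + 1 ≠ 0 := by positivity
    push_cast
    field_simp
    ring

lemma abs_sum_one_div_sq_sub_le {n : ℕ} (hn : 1 ≤ n) :
    |∑ i ∈ Finset.range (n + 1), 1 / (i : ℝ) ^ 2 - Real.pi ^ 2 / 6| ≤ 1 / (n : ℝ) := by
  have hs := hasSum_zeta_two
  have hmono : ∀ m, n ≤ m → ∑ i ∈ Finset.range (m + 1), 1 / (i : ℝ) ^ 2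
      ≤ ∑ i ∈ Finset.range (n + 1), 1 / (i : ℝ) ^ 2 + 1 / (n : ℝ) - 1 / (m : ℝ) := by
    intro m hm
    induction m, hm using Nat.le_induction with
    | base => linarith
    | succ m hm ih =>
      rw [Finset.sum_range_succ]
      have hm0 : (0 : ℝ) < m := by exact_mod_cast (by omega : 0 < m)
      have : 1 / ((m + 1 : ℕ) : ℝ) ^ 2 ≤ 1 / (m : ℝ) - 1 / ((m + 1 : ℕ) : ℝ) := by
        push_cast
        rw [div_sub_div _ _ hm0.ne' (by positivity), div_le_div_iff₀ (by positivity)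
          (by positivity)]
        nlinarith
      linarith
  have h1 : Real.pi ^ 2 / 6 ≤ ∑ i ∈ Finset.range (n + 1), 1 / (i : ℝ) ^ 2 + 1 / n := by
    refine le_of_tendsto (hs.tendsto_sum_nat.comp (tendsto_add_atTop_nat 1)) ?_
    filter_upwards [eventually_ge_atTop n] with m hm
    have h2 : (0 : ℝ) ≤ 1 / m := by positivity
    have := hmono m hm
    simp only [Function.comp]
    linarith
  have h2 := sum_le_hasSum (Finset.range (n + 1)) (fun i _ => by positivity) hs
  rw [abs_le]
  have : 0 ≤ 1 / (n : ℝ) := by positivity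
  constructor <;> linarith

/-- The sum over the triangle `i + j ≤ n` of a product, summed in either order. -/
lemma sum_mul_sum_comm (a b : ℕ → ℝ) (n : ℕ) :
    ∑ i ∈ Finset.range (n + 1), a i * ∑ j ∈ Finset.range (n - i + 1), b j
      = ∑ j ∈ Finset.range (n + 1), b j * ∑ i ∈ Finset.range (n - j + 1), a i := by
  simp only [Finset.mul_sum]
  rw [Finset.sum_comm' (t' := Finset.range (n + 1)) (s' := fun j => Finset.range (n - j + 1))]
  · exact Finset.sum_congr rfl fun _ _ => Finset.sum_congr rfl fun _ _ => mul_comm _ _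
  · intro i j; simp only [Finset.mem_range]; omega

/-- If the partial sums of `a` are `log n + c + O(1 / n)`, the sum of `a i * a j` over `i + j ≤ n`
is the square of the partial sum, less `π² / 6`. The constant is found by comparing `a` with the
sequence `1 / i`, for which the sum can be evaluated. -/
lemma exists_convolution {a : ℕ → ℝ} (ha : ∀ i, 0 ≤ a i) {c C : ℝ}
    (hA : ∀ n, 1 ≤ n → |∑ i ∈ Finset.range (n + 1), a i - Real.log n - c| ≤ C / n) :
    ∃ C', 0 ≤ C' ∧ (∀ i, a i ≤ C' / (i + 1)) ∧ ∀ n : ℕ, 1 ≤ n →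
      |∑ i ∈ Finset.range (n + 1), a i * ∑ j ∈ Finset.range (n - i + 1), a j
        - ((Real.log n + c) ^ 2 - Real.pi ^ 2 / 6)| ≤ C' * ((1 + Real.log n) / n) := by
  set A : ℕ → ℝ := fun n => ∑ i ∈ Finset.range (n + 1), a i with hAdef
  set γ := Real.eulerMascheroniConstant
  set d := c - γ with hd
  set e : ℕ → ℝ := fun n => A n - harm n - d with he
  have hC : 0 ≤ C := by simpa using (abs_nonneg _).trans (hA 1 le_rfl)
  have he1 : ∀ n, 1 ≤ n → |e n| ≤ (C + 1) / n := by
    intro n hn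
    calc |e n| = |(A n - Real.log n - c) - (harm n - Real.log n - γ)| := by
          simp only [he, hd]; congr 1; ring
      _ ≤ C / n + 1 / n := (abs_sub _ _).trans (add_le_add (hA n hn) (abs_harm_sub_le hn))
      _ = _ := by ring
  set C₁ := 2 * (C + 1) + |e 0| with hC₁
  have hC₁0 : 0 ≤ C₁ := by positivity
  have he2 : ∀ n : ℕ, |e n| ≤ C₁ / (n + 1) := by
    intro n
    rcases Nat.eq_zero_or_pos n with rfl | hn
    · simp [hC₁]; linarith
    · have hn0 : (1 : ℝ) ≤ n := by exact_mod_cast hn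
      refine (he1 n hn).trans ?_
      rw [div_le_div_iff₀ (by linarith) (by linarith)]
      have := abs_nonneg (e 0)
      rw [hC₁]
      nlinarith
  have hb : ∀ i : ℕ, 1 / (i : ℝ) ≤ 2 / (i + 1) := by
    intro i
    rcases Nat.eq_zero_or_pos i with rfl | hi
    · simp
    · have hi0 : (1 : ℝ) ≤ i := by exact_mod_cast hi
      rw [div_le_div_iff₀ (by linarith) (by linarith)]
      linarith
  set C₂ := 2 + 3 * C₁ + a 0 with hC₂
  have ha2 : ∀ i : ℕ, a i ≤ C₂ / (i + 1) := by
    intro i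
    rcases i with - | i
    · simp [hC₂]; linarith
    · have h1 : a (i + 1) = 1 / ((i + 1 : ℕ) : ℝ) + e (i + 1) - e i := by
        simp only [he, hAdef, harm_succ, Finset.sum_range_succ _ (i + 1)]; ring
      have h2 := (abs_le.1 (he2 (i + 1))).2
      have h3 := (abs_le.1 (he2 i)).1
      have h4 := hb (i + 1)
      have h5 : C₁ / ((i : ℝ) + 1) ≤ 2 * C₁ / (((i + 1 : ℕ) : ℝ) + 1) := by
        rw [div_le_div_iff₀ (by positivity) (by positivity)]
        push_cast
        have : (0 : ℝ) ≤ i := Nat.cast_nonneg i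
        nlinarith
      have h6 : 0 ≤ a 0 / (((i + 1 : ℕ) : ℝ) + 1) := by have := ha 0; positivity
      have h7 : C₂ / (((i + 1 : ℕ) : ℝ) + 1) = 2 / (((i + 1 : ℕ) : ℝ) + 1)
        + C₁ / (((i + 1 : ℕ) : ℝ) + 1) + 2 * C₁ / (((i + 1 : ℕ) : ℝ) + 1)
        + a 0 / (((i + 1 : ℕ) : ℝ) + 1) := by rw [hC₂]; ring
      rw [h1, h7]
      linarith
  have hC₂0 : 0 ≤ C₂ := by have := ha 0; positivity
  -- Both `f` and `e` decay like `1 / i`, so their convolution is `O(log n / n)`.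
  have herr : ∀ (f : ℕ → ℝ) (D : ℝ), 0 ≤ D → (∀ i : ℕ, |f i| ≤ D / (i + 1)) → ∀ n : ℕ, 1 ≤ n →
      |∑ i ∈ Finset.range (n + 1), f i * e (n - i)| ≤ 4 * D * C₁ * ((1 + Real.log n) / n) := by
    intro f D hD hf n hn
    refine (Finset.abs_sum_le_sum_abs _ _).trans ?_
    calc ∑ i ∈ Finset.range (n + 1), |f i * e (n - i)|
        ≤ ∑ i ∈ Finset.range (n + 1), D * C₁ * (1 / (((i : ℝ) + 1) * ((n - i : ℕ) + 1))) := by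
          refine Finset.sum_le_sum fun i _ => ?_
          rw [abs_mul]
          calc |f i| * |e (n - i)| ≤ D / (i + 1) * (C₁ / ((n - i : ℕ) + 1)) := by
                gcongr
                · exact hf i
                · exact he2 _
            _ = _ := by rw [div_mul_div_comm]; ring
      _ = D * C₁ * ∑ i ∈ Finset.range (n + 1), 1 / (((i : ℝ) + 1) * ((n - i : ℕ) + 1)) := by
          rw [Finset.mul_sum]
      _ ≤ D * C₁ * (4 * ((1 + Real.log n) / n)) := by
          gcongr; exact sum_one_div_mul_le hn
      _ = _ := by ring
  set D := (1 + 2 * |c| + 2) * (1 : ℝ) + 1 + |d| * C₁ + 4 * C₂ * C₁ + 4 * 2 * C₁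
  refine ⟨C₂ + D, by positivity, fun i => (ha2 i).trans ?_, fun n hn => ?_⟩
  · gcongr
    have : 0 ≤ D := by positivity
    linarith
  have hn0 : (1 : ℝ) ≤ n := by exact_mod_cast hn
  have hlog : 0 ≤ Real.log n := Real.log_nonneg hn0
  set η := (1 + Real.log n) / n with hη
  have hη0 : 0 ≤ η := by positivity
  have h1η : 1 / (n : ℝ) ≤ η := by rw [hη]; gcongr; linarith
  -- `A = harm + d + e` is substituted once for each factor.
  have s1 : ∑ i ∈ Finset.range (n + 1), a i * A (n - i)
      = ∑ i ∈ Finset.range (n + 1), a i * harm (n - i) + d * A n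
        + ∑ i ∈ Finset.range (n + 1), a i * e (n - i) := by
    rw [hAdef, Finset.mul_sum, ← Finset.sum_add_distrib, ← Finset.sum_add_distrib]
    refine Finset.sum_congr rfl fun i _ => ?_
    simp only [he, hAdef]; ring
  have s2 : ∑ i ∈ Finset.range (n + 1), a i * harm (n - i)
      = ∑ i ∈ Finset.range (n + 1), 1 / (i : ℝ) * A (n - i) :=
    sum_mul_sum_comm a (fun i => 1 / (i : ℝ)) n
  have s3 : ∑ i ∈ Finset.range (n + 1), 1 / (i : ℝ) * A (n - i)
      = ∑ i ∈ Finset.range (n + 1), 1 / (i : ℝ) * harm (n - i) + d * harm n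
        + ∑ i ∈ Finset.range (n + 1), 1 / (i : ℝ) * e (n - i) := by
    rw [harm.eq_1 n, Finset.mul_sum, ← Finset.sum_add_distrib, ← Finset.sum_add_distrib]
    refine Finset.sum_congr rfl fun i _ => ?_
    simp only [he]; ring
  have t1 := herr a C₂ hC₂0 (fun i => by rw [abs_of_nonneg (ha i)]; exact ha2 i) n hn
  have t2 := herr (fun i => 1 / (i : ℝ)) 2 zero_le_two
    (fun i => by rw [abs_of_nonneg (by positivity)]; exact hb i) n hn
  have t3 := abs_sum_one_div_sq_sub_le hn
  have t4 := abs_harm_sub_le hn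
  have t5 : |d * e n| ≤ |d| * C₁ * η := by
    rw [abs_mul, mul_assoc]
    gcongr
    refine (he2 n).trans ?_
    have : C₁ * (1 / (n : ℝ)) ≤ C₁ * η := by gcongr
    refine le_trans ?_ this
    rw [mul_one_div]
    gcongr
    linarith
  have t6 : |(harm n + d) ^ 2 - (Real.log n + c) ^ 2| ≤ (1 + 2 * |c| + 2) * 1 * η := by
    have u1 : (harm n + d) ^ 2 - (Real.log n + c) ^ 2
        = (harm n - Real.log n - γ) * ((harm n - Real.log n - γ) + 2 * (Real.log n + c)) := by
      rw [hd]; ring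
    have u2 : |(harm n - Real.log n - γ) + 2 * (Real.log n + c)|
        ≤ (1 + 2 * |c| + 2) * (1 + Real.log n) := by
      refine (abs_add_le _ _).trans ?_
      have v1 : 1 / (n : ℝ) ≤ 1 := by rw [div_le_one (by linarith)]; exact hn0
      have v2 : |2 * (Real.log n + c)| ≤ 2 * (Real.log n + |c|) := by
        rw [abs_mul, abs_two]
        gcongr
        refine (abs_add_le _ _).trans ?_
        rw [abs_of_nonneg hlog]
      have := abs_nonneg c
      nlinarith
    rw [u1, abs_mul]
    calc _ ≤ 1 / (n : ℝ) * ((1 + 2 * |c| + 2) * (1 + Real.log n)) := by gcongr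
      _ = _ := by rw [hη]; ring
  have key : ∑ i ∈ Finset.range (n + 1), a i * A (n - i)
        - ((Real.log n + c) ^ 2 - Real.pi ^ 2 / 6)
      = ((harm n + d) ^ 2 - (Real.log n + c) ^ 2)
        - (∑ i ∈ Finset.range (n + 1), 1 / (i : ℝ) ^ 2 - Real.pi ^ 2 / 6) + d * e n
        + ∑ i ∈ Finset.range (n + 1), a i * e (n - i)
        + ∑ i ∈ Finset.range (n + 1), 1 / (i : ℝ) * e (n - i) := by
    rw [s1, s2, s3, sum_one_div_mul_harm]
    have : A n = harm n + d + e n := by simp only [he]; ring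
    rw [this]; ring
  change |∑ i ∈ Finset.range (n + 1), a i * A (n - i) - _| ≤ _
  rw [key]
  calc _ ≤ (1 + 2 * |c| + 2) * 1 * η + 1 * η + |d| * C₁ * η + 4 * C₂ * C₁ * η
        + 4 * 2 * C₁ * η := by
        refine (abs_add_le _ _).trans (add_le_add ((abs_add_le _ _).trans (add_le_add
          ((abs_add_le _ _).trans (add_le_add ((abs_sub _ _).trans (add_le_add t6 ?_)) t5))
          t1)) t2)
        linarith
    _ = D * η := by ring
    _ ≤ _ := by gcongr; linarith

end

section

/-! ### Expansions of `Ω` over prime powers, and dyadic blocks -/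

variable {P : Type*}

/-- The total number of prime factors, as a real number. -/
def omega (m : P →₀ ℕ) : ℝ := additive (fun _ => 1) m

lemma omega_eq (m : P →₀ ℕ) : omega m = (bigOmega m : ℝ) := by
  simp [omega, additive, bigOmega, Finsupp.sum]

lemma omega_nonneg (m : P →₀ ℕ) : 0 ≤ omega m := by rw [omega_eq]; positivity

lemma omega_add (m n : P →₀ ℕ) : omega (m + n) = omega m + omega n := additive_add _ m n

lemma omega_zero : omega (0 : P →₀ ℕ) = 0 := additive_zero _

lemma omega_nsmul (h : ℕ) (m : P →₀ ℕ) : omega (h • m) = h * omega m := additive_nsmul _ h m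

lemma omega_primePow (q : P × ℕ) : omega (primePow q) = q.2 + 1 := by
  simp [omega, additive_primePow]

variable (N : P → ℕ) [NormFinite N]

lemma sum_omega_mul (F : (P →₀ ℕ) → ℝ) (y : ℝ) :
    ∑ m ∈ ball N y, omega m * F m
      = ∑ q ∈ ppBall N y, ∑ m ∈ ball N (y / ppSize N q), F (m + primePow q) := by
  have := sum_additive_mul N (fun _ => 1) F y
  simpa [omega] using this

lemma sum_omega (y : ℝ) :
    ∑ m ∈ ball N y, omega m = ∑ q ∈ ppBall N y, count N (y / ppSize N q) := by
  have := sum_omega_mul N (fun _ => 1) y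
  simpa [count] using this

lemma sum_omega_sq (y : ℝ) :
    ∑ m ∈ ball N y, omega m ^ 2
      = ∑ q ∈ ppBall N y, ∑ m ∈ ball N (y / ppSize N q), omega m
        + ∑ q ∈ ppBall N y, ((q.2 : ℝ) + 1) * count N (y / ppSize N q) := by
  simp only [sq, sum_omega_mul, ← Finset.sum_add_distrib]
  refine Finset.sum_congr rfl fun q _ => ?_
  simp only [omega_add, omega_primePow, Finset.sum_add_distrib, Finset.sum_const, nsmul_eq_mul,
    count]
  ring

/-- The dyadic scale of a prime power. -/
def scale (q : P × ℕ) : ℕ := Nat.log 2 (N q.1 ^ (q.2 + 1))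

lemma scale_spec (q : P × ℕ) :
    (2 : ℝ) ^ scale N q ≤ ppSize N q ∧ ppSize N q < 2 ^ (scale N q + 1) := by
  have h0 : N q.1 ^ (q.2 + 1) ≠ 0 := pow_ne_zero _ (by
    have := NormFinite.two_le (N := N) q.1; omega)
  have h1 := Nat.pow_log_le_self 2 h0
  have h2 := Nat.lt_pow_succ_log_self one_lt_two (N q.1 ^ (q.2 + 1))
  unfold ppSize scale
  exact ⟨by exact_mod_cast h1, by exact_mod_cast h2⟩

lemma scale_le_iff {q : P × ℕ} {n : ℕ} : scale N q ≤ n ↔ ppSize N q < 2 ^ (n + 1) := by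
  obtain ⟨h1, h2⟩ := scale_spec N q
  constructor
  · intro h
    exact h2.trans_le (pow_le_pow_right₀ one_le_two (by omega))
  · intro h
    by_contra! h3
    exact absurd (h1.trans_lt h) (not_lt.2 (pow_le_pow_right₀ one_le_two (by omega)))

/-- The sum of `1 / N(p) ^ (k + 1)` over the prime powers of dyadic scale `i`. -/
def blockSum (i : ℕ) : ℝ :=
  ∑ q ∈ (ppBall N (2 ^ (i + 1))).filter (scale N · = i), (ppSize N q)⁻¹

lemma blockSum_nonneg (i : ℕ) : 0 ≤ blockSum N i :=
  Finset.sum_nonneg fun q _ => (inv_pos.2 (ppSize_pos N q)).le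

/-- Sums over prime powers, by scale. -/
lemma sum_scale (f : ℕ → ℝ) (n : ℕ) :
    ∑ i ∈ Finset.range (n + 1), blockSum N i * f i
      = ∑ q ∈ (ppBall N (2 ^ (n + 1))).filter (scale N · ≤ n), (ppSize N q)⁻¹ * f (scale N q) := by
  rw [← Finset.sum_fiberwise_of_maps_to (t := Finset.range (n + 1)) (g := scale N)
    fun q hq => Finset.mem_range.2 (Nat.lt_succ_of_le (Finset.mem_filter.1 hq).2)]
  refine Finset.sum_congr rfl fun i hi => ?_
  have hi : i ≤ n := Nat.lt_succ_iff.1 (Finset.mem_range.1 hi)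
  rw [blockSum, Finset.sum_mul]
  refine Finset.sum_congr ?_ fun q hq => ?_
  · ext q
    simp only [Finset.mem_filter, mem_ppBall]
    constructor
    · rintro ⟨h1, rfl⟩
      exact ⟨⟨h1.trans (pow_le_pow_right₀ one_le_two (by omega)), hi⟩, rfl⟩
    · rintro ⟨_, rfl⟩
      exact ⟨(scale_spec N q).2.le, rfl⟩
  · rw [(Finset.mem_filter.1 hq).2]

lemma sum_blockSum_le {n : ℕ} {t : ℝ} (ht : (2 : ℝ) ^ (n + 1) ≤ t) :
    ∑ i ∈ Finset.range (n + 1), blockSum N i ≤ ppSum N (fun _ => 1) t := by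
  have := sum_scale N (fun _ => 1) n
  simp only [mul_one] at this
  rw [this, ppSum]
  simp only [one_mul]
  refine Finset.sum_le_sum_of_subset_of_nonneg (fun q hq => ?_)
    fun q _ _ => (inv_pos.2 (ppSize_pos N q)).le
  exact ppBall_mono N ht (Finset.mem_filter.1 hq).1

lemma le_sum_blockSum {n : ℕ} {t : ℝ} (ht : t < 2 ^ (n + 1)) :
    ppSum N (fun _ => 1) t ≤ ∑ i ∈ Finset.range (n + 1), blockSum N i := by
  have := sum_scale N (fun _ => 1) n
  simp only [mul_one] at this
  rw [this, ppSum]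
  simp only [one_mul]
  refine Finset.sum_le_sum_of_subset_of_nonneg (fun q hq => ?_)
    fun q _ _ => (inv_pos.2 (ppSize_pos N q)).le
  have h := mem_ppBall.1 hq
  exact Finset.mem_filter.2 ⟨mem_ppBall.2 (h.trans ht.le), (scale_le_iff N).2 (h.trans_lt ht)⟩

/-- The sum of `1 / (N(q) N(q'))` over pairs of prime powers with `N(q) N(q') ≤ y`. -/
def pairSum (y : ℝ) : ℝ :=
  ∑ q ∈ ppBall N y, (ppSize N q)⁻¹ * ppSum N (fun _ => 1) (y / ppSize N q)

lemma ppSum_one_nonneg (t : ℝ) : 0 ≤ ppSum N (fun _ => 1) t :=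
  Finset.sum_nonneg fun q _ => by
    have := ppSize_pos N q
    positivity

/-- If `N(q) N(q') < 2 ^ (n + 1)`, the scales of `q` and `q'` add up to at most `n`. -/
lemma pairSum_le {n : ℕ} {y : ℝ} (hy : y < 2 ^ (n + 1)) :
    pairSum N y ≤ ∑ i ∈ Finset.range (n + 1),
      blockSum N i * ∑ j ∈ Finset.range (n - i + 1), blockSum N j := by
  rw [sum_scale N (fun i => ∑ j ∈ Finset.range (n - i + 1), blockSum N j) n, pairSum]
  refine (Finset.sum_le_sum fun q hq => ?_).trans
    (Finset.sum_le_sum_of_subset_of_nonneg (fun q hq => ?_) fun q _ _ => ?_)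
  · refine mul_le_mul_of_nonneg_left (le_sum_blockSum N (n := n - scale N q) ?_)
      (inv_pos.2 (ppSize_pos N q)).le
    have h1 : scale N q ≤ n := (scale_le_iff N).2 ((mem_ppBall.1 hq).trans_lt hy)
    rw [div_lt_iff₀ (ppSize_pos N q)]
    calc y < 2 ^ (n + 1) := hy
      _ = 2 ^ (n - scale N q + 1) * 2 ^ scale N q := by rw [← pow_add]; congr 1; omega
      _ ≤ _ := by gcongr; exact (scale_spec N q).1
  · have h := mem_ppBall.1 hq
    exact Finset.mem_filter.2 ⟨mem_ppBall.2 (h.trans hy.le), (scale_le_iff N).2 (h.trans_lt hy)⟩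
  · exact mul_nonneg (inv_pos.2 (ppSize_pos N q)).le
      (Finset.sum_nonneg fun i _ => blockSum_nonneg N i)

/-- If the scales of `q` and `q'` add up to at most `n`, then `N(q) N(q') < 2 ^ (n + 2)`. -/
lemma le_pairSum {n : ℕ} {y : ℝ} (hy : (2 : ℝ) ^ (n + 2) ≤ y) :
    ∑ i ∈ Finset.range (n + 1), blockSum N i * ∑ j ∈ Finset.range (n - i + 1), blockSum N j
      ≤ pairSum N y := by
  rw [sum_scale N (fun i => ∑ j ∈ Finset.range (n - i + 1), blockSum N j) n, pairSum]
  refine (Finset.sum_le_sum fun q hq => ?_).trans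
    (Finset.sum_le_sum_of_subset_of_nonneg (fun q hq => ?_) fun q _ _ => ?_)
  · refine mul_le_mul_of_nonneg_left (sum_blockSum_le N (n := n - scale N q) ?_)
      (inv_pos.2 (ppSize_pos N q)).le
    have h1 : scale N q ≤ n := (Finset.mem_filter.1 hq).2
    rw [le_div_iff₀ (ppSize_pos N q)]
    calc (2 : ℝ) ^ (n - scale N q + 1) * ppSize N q
        ≤ 2 ^ (n - scale N q + 1) * 2 ^ (scale N q + 1) := by
          gcongr; exact (scale_spec N q).2.le
      _ = 2 ^ (n + 2) := by rw [← pow_add]; congr 1; omega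
      _ ≤ y := hy
  · have h := mem_ppBall.1 (Finset.mem_filter.1 hq).1
    exact mem_ppBall.2 (h.trans ((pow_le_pow_right₀ one_le_two (by omega)).trans hy))
  · exact mul_nonneg (inv_pos.2 (ppSize_pos N q)).le (ppSum_one_nonneg N _)

lemma abs_log_sub_log_le {a b : ℝ} (ha : 0 < a) (hab : a ≤ b) :
    |Real.log b - Real.log a| ≤ (b - a) / a := by
  have hb : 0 < b := by linarith
  rw [abs_of_nonneg (sub_nonneg.2 (Real.log_le_log ha hab)), ← Real.log_div hb.ne' ha.ne']
  refine (Real.log_le_sub_one_of_pos (by positivity)).trans (le_of_eq ?_)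
  field_simp

variable {N} {Y : Set ℝ} {κ θ K : ℝ}

namespace Regular

variable (R : Regular N Y κ θ K)
include R

/-- The error terms of the counting formula, summed over prime powers, save a logarithm, because
prime powers are sparser than integers by this factor. -/
lemma exists_sum_ppBall_rpow_le [Nonempty P] :
    ∃ C, 0 ≤ C ∧ ∀ y, 1 ≤ y →
      ∑ q ∈ ppBall N y, ((q.2 : ℝ) + 1) * (y / ppSize N q) ^ θ ≤ C * (y / (1 + Real.log y)) := by
  obtain ⟨C, hC0, hC⟩ := R.exists_ppCount_le
  have hθ := R.theta_pos
  have hθ1 := R.theta_lt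
  have hK := R.const_nonneg
  set G := (2 : ℝ) ^ θ * (1 - 2 ^ (θ - 1))⁻¹ with hG
  have hG0 : 0 ≤ G := by
    have : (2 : ℝ) ^ (θ - 1) < 1 := Real.rpow_lt_one_of_one_lt_of_neg one_lt_two (by linarith)
    have : 0 ≤ (1 - (2 : ℝ) ^ (θ - 1))⁻¹ := inv_nonneg.2 (by linarith)
    positivity
  have hC' : ∀ t, 1 ≤ t → ∑ q ∈ ppBall N t, ((q.2 : ℝ) + 1) ≤ C / (1 + Real.log t) * t := by
    intro t ht
    have : 0 < 1 + Real.log t := by linarith [Real.log_nonneg ht]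
    rw [div_mul_eq_mul_div, le_div_iff₀ this]
    exact hC t ht
  set δ := (1 - θ) / 2 with hδ
  have hδ0 : 0 < δ := by rw [hδ]; linarith
  refine ⟨G * C * (1 + δ⁻¹) + 2 * G * C, by positivity, fun y hy => ?_⟩
  have hy0 : 0 < y := by linarith
  have hlog := Real.log_nonneg hy
  have hl1 : 0 < 1 + Real.log y := by linarith
  have hsq1 : 1 ≤ √y := Real.one_le_sqrt.2 hy
  have hsq0 : 0 < √y := by linarith
  have hsqle : √y ≤ y := by
    rw [Real.sqrt_le_left hy0.le]; nlinarith
  have hlsq : Real.log √y = Real.log y / 2 := Real.log_sqrt hy0.le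
  -- Prime powers up to `√y` contribute a smaller power of `y`; above `√y` their density is
  -- `O(1 / log y)`.
  have e1 : ∑ q ∈ ppBall N y, (if ppSize N q ≤ √y then (q.2 : ℝ) + 1 else 0) * (y / ppSize N q) ^ θ
      ≤ G * C * (1 + δ⁻¹) * (y / (1 + Real.log y)) := by
    have f1 : ∑ q ∈ ppBall N y,
          (if ppSize N q ≤ √y then (q.2 : ℝ) + 1 else 0) * (y / ppSize N q) ^ θ
        = √y ^ θ * ∑ q ∈ ppBall N √y, ((q.2 : ℝ) + 1) * (√y / ppSize N q) ^ θ := by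
      rw [Finset.mul_sum]
      simp only [ite_mul, zero_mul]
      rw [← Finset.sum_filter]
      refine Finset.sum_congr ?_ fun q _ => ?_
      · ext q
        simp only [Finset.mem_filter, mem_ppBall]
        exact ⟨fun h => h.2, fun h => ⟨h.trans hsqle, h⟩⟩
      · have hq := ppSize_pos N q
        have : y / ppSize N q = √y * (√y / ppSize N q) := by
          rw [← mul_div_assoc, Real.mul_self_sqrt hy0.le]
        rw [this, Real.mul_rpow hsq0.le (by positivity)]
        ring
    have f2 := R.sum_ppBall_mul_rpow_le (u := fun q => (q.2 : ℝ) + 1) (C := C) (y := √y)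
      (fun q => by positivity) hsq0 fun t ht _ => by
        rcases lt_or_ge t 1 with h | h
        · rw [ppBall_eq_empty N (by linarith)]; simp; positivity
        · refine (hC' t h).trans ?_
          gcongr
          exact div_le_self hC0 (by linarith [Real.log_nonneg h])
    have f3 : √y ^ θ * √y * (1 + Real.log y) ≤ (1 + δ⁻¹) * y := by
      have g1 : 1 + Real.log y ≤ (1 + δ⁻¹) * y ^ δ := by
        have := Real.log_le_rpow_div hy0.le hδ0
        have h1 : 1 ≤ y ^ δ := Real.one_le_rpow hy hδ0.le
        rw [div_eq_inv_mul] at this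
        linarith
      have g2 : √y ^ θ * √y = y ^ ((1 + θ) / 2) := by
        rw [Real.sqrt_eq_rpow, ← Real.rpow_mul hy0.le, ← Real.rpow_add hy0]
        congr 1; ring
      rw [g2]
      calc y ^ ((1 + θ) / 2) * (1 + Real.log y) ≤ y ^ ((1 + θ) / 2) * ((1 + δ⁻¹) * y ^ δ) := by
            gcongr
        _ = (1 + δ⁻¹) * (y ^ ((1 + θ) / 2) * y ^ δ) := by ring
        _ = (1 + δ⁻¹) * y := by
            rw [← Real.rpow_add hy0]
            have : (1 + θ) / 2 + δ = 1 := by rw [hδ]; ring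
            rw [this, Real.rpow_one]
    rw [f1, ← mul_div_assoc, le_div_iff₀ hl1]
    calc √y ^ θ * (∑ q ∈ ppBall N √y, ((q.2 : ℝ) + 1) * (√y / ppSize N q) ^ θ)
          * (1 + Real.log y) ≤ √y ^ θ * (G * C * √y) * (1 + Real.log y) := by gcongr
      _ = G * C * (√y ^ θ * √y * (1 + Real.log y)) := by ring
      _ ≤ G * C * ((1 + δ⁻¹) * y) := by gcongr
      _ = _ := by ring
  have e2 : ∑ q ∈ ppBall N y, (if ppSize N q ≤ √y then 0 else (q.2 : ℝ) + 1) * (y / ppSize N q) ^ θ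
      ≤ 2 * G * C * (y / (1 + Real.log y)) := by
    have f2 := R.sum_ppBall_mul_rpow_le
      (u := fun q => if ppSize N q ≤ √y then 0 else (q.2 : ℝ) + 1)
      (C := 2 * C / (1 + Real.log y)) (y := y)
      (fun q => by split_ifs <;> positivity) hy0 fun t ht _ => by
        rcases le_or_gt t √y with h | h
        · rw [Finset.sum_eq_zero fun q hq => if_pos ((mem_ppBall.1 hq).trans h)]
          positivity
        · have ht1 : 1 ≤ t := by linarith
          have g1 : ∑ q ∈ ppBall N t, (if ppSize N q ≤ √y then 0 else (q.2 : ℝ) + 1)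
              ≤ ∑ q ∈ ppBall N t, ((q.2 : ℝ) + 1) :=
            Finset.sum_le_sum fun q _ => by
              split_ifs
              · positivity
              · exact le_rfl
          refine g1.trans ((hC' t ht1).trans ?_)
          have g2 := Real.log_le_log hsq0 h.le
          rw [hlsq] at g2
          gcongr ?_ * _
          rw [div_le_div_iff₀ (by linarith) hl1]
          nlinarith
    refine f2.trans (le_of_eq ?_)
    ring
  calc _ = ∑ q ∈ ppBall N y, (if ppSize N q ≤ √y then (q.2 : ℝ) + 1 else 0) * (y / ppSize N q) ^ θ
        + ∑ q ∈ ppBall N y, (if ppSize N q ≤ √y then 0 else (q.2 : ℝ) + 1)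
          * (y / ppSize N q) ^ θ := by
        rw [← Finset.sum_add_distrib]
        refine Finset.sum_congr rfl fun q _ => ?_
        split_ifs <;> ring
    _ ≤ _ := (add_le_add e1 e2).trans (le_of_eq (by ring))

/-- A weighted sum of counting functions over prime powers, in terms of Mertens sums. -/
lemma exists_sum_count_sub_le [Nonempty P] :
    ∃ C, 0 ≤ C ∧ ∀ v : ℕ → ℝ, (∀ k, 0 ≤ v k) → (∀ k, v k ≤ k + 1) → ∀ y ∈ Y, 1 ≤ y →
      |∑ q ∈ ppBall N y, v q.2 * count N (y / ppSize N q) - κ * y * ppSum N v y|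
        ≤ C * (y / (1 + Real.log y)) := by
  obtain ⟨C, hC0, hC⟩ := R.exists_sum_ppBall_rpow_le
  have hK := R.const_nonneg
  refine ⟨K * C, by positivity, fun v hv0 hv y hy hy1 => ?_⟩
  refine (R.abs_sum_mul_count_sub_le (u := fun q => v q.2) (fun q => hv0 _) hy).trans ?_
  rw [mul_assoc]
  refine mul_le_mul_of_nonneg_left (le_trans ?_ (hC y hy1)) hK
  refine Finset.sum_le_sum fun q hq => ?_
  have := ppSize_pos N q
  have hy0 := R.pos y hy
  gcongr
  exact hv _

end Regular

end

section

/-! ### The moments over the whole monoid -/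

lemma one_le_loglog {y : ℝ} (hy : 16 ≤ y) : 1 ≤ Real.log (Real.log y) := by
  have h1 : Real.log 16 ≤ Real.log y := Real.log_le_log (by norm_num) hy
  have h2 : Real.log 16 = 4 * Real.log 2 := by
    rw [show (16 : ℝ) = 2 ^ 4 by norm_num, Real.log_pow]; norm_num
  have h3 := Real.log_two_gt_d9
  have h4 := Real.exp_one_lt_d9
  rw [Real.le_log_iff_exp_le (by linarith)]
  linarith

lemma neg_log_log_two_le : -Real.log (Real.log 2) ≤ 1 := by
  have h1 := Real.log_two_gt_d9
  rw [← Real.log_inv]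
  have h2 := Real.log_le_sub_one_of_pos (show 0 < (Real.log 2)⁻¹ by positivity)
  have h3 : (Real.log 2)⁻¹ ≤ 2 := by
    rw [inv_le_comm₀ (by linarith) two_pos]; linarith
  linarith

/-- Comparison of a natural number `k` with the binary logarithm of `y`. -/
lemma log_near {y : ℝ} (hy : 16 ≤ y) {k : ℕ} (hk : 2 ≤ k) (h1 : (k : ℝ) * Real.log 2 ≤ Real.log y)
    (h2 : Real.log y ≤ (k + 3) * Real.log 2) :
    |Real.log (Real.log y) - (Real.log k + Real.log (Real.log 2))| ≤ 3 / k ∧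
      (1 + Real.log k) / k ≤ 8 * (Real.log (Real.log y) / Real.log y) := by
  have hk2 : (2 : ℝ) ≤ k := by exact_mod_cast hk
  have hk0 : (0 : ℝ) < k := by linarith
  have hl := Real.log_two_gt_d9
  have hl' := Real.log_two_lt_d9
  have hl0 : 0 < Real.log 2 := by linarith
  have hLL := one_le_loglog hy
  have hly : 0 < Real.log y := Real.log_pos (by linarith)
  rw [← Real.log_mul hk0.ne' hl0.ne']
  have e1 := abs_log_sub_log_le (by positivity) h1
  have e2 : (Real.log y - k * Real.log 2) / (k * Real.log 2) ≤ 3 / k := by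
    rw [div_le_div_iff₀ (by positivity) hk0]
    nlinarith
  refine ⟨e1.trans e2, ?_⟩
  have e3 := Real.log_le_log (by positivity) h1
  rw [Real.log_mul hk0.ne' hl0.ne'] at e3
  have e4 := neg_log_log_two_le
  have e5 : Real.log y ≤ 5 / 2 * k := by nlinarith
  rw [← mul_div_assoc, div_le_div_iff₀ hk0 hly]
  have e6 : 1 + Real.log k ≤ 3 * Real.log (Real.log y) := by linarith
  calc (1 + Real.log k) * Real.log y ≤ 3 * Real.log (Real.log y) * (5 / 2 * k) := by gcongr
    _ ≤ _ := by nlinarith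

lemma exists_scale {y : ℝ} (hy : 16 ≤ y) :
    ∃ n : ℕ, 4 ≤ n ∧ (2 : ℝ) ^ n ≤ y ∧ y < 2 ^ (n + 1) ∧ n * Real.log 2 ≤ Real.log y ∧
      Real.log y ≤ (n + 1) * Real.log 2 := by
  obtain ⟨n, h1, h2⟩ := exists_nat_pow_near (x := y) (y := 2) (by linarith) one_lt_two
  refine ⟨n, ?_, h1, h2, ?_, ?_⟩
  · by_contra! h
    have : (2 : ℝ) ^ (n + 1) ≤ 2 ^ 4 := pow_le_pow_right₀ one_le_two (by omega)
    norm_num at this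
    linarith
  · have := Real.log_le_log (by positivity) h1
    rwa [Real.log_pow] at this
  · have := Real.log_le_log (by linarith) h2.le
    rw [Real.log_pow] at this
    exact_mod_cast this

variable {P : Type*} {N : P → ℕ} [NormFinite N]

lemma abs_sum_blockSum_sub_le {c D : ℝ}
    (h : ∀ t, 2 ≤ t → |ppSum N (fun _ => 1) t - Real.log (Real.log t) - c| ≤ D / Real.log t)
    {n : ℕ} (hn : 1 ≤ n) :
    |∑ i ∈ Finset.range (n + 1), blockSum N i - Real.log n - (c + Real.log (Real.log 2))|
      ≤ (2 * D + 1) / n := by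
  have hn1 : (1 : ℝ) ≤ n := by exact_mod_cast hn
  have hl := Real.log_two_gt_d9
  have hl0 : 0 < Real.log 2 := by linarith
  have hD : 0 ≤ D := by
    have := (abs_nonneg _).trans (h 2 le_rfl)
    rw [le_div_iff₀ hl0] at this
    linarith
  have hp : ∀ m : ℕ, 1 ≤ m →
      |ppSum N (fun _ => 1) (2 ^ m) - (Real.log m + Real.log (Real.log 2)) - c| ≤ 2 * D / m := by
    intro m hm
    have hm0 : (0 : ℝ) < m := by exact_mod_cast hm
    have := h (2 ^ m) (le_self_pow₀ one_le_two (by omega))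
    rw [Real.log_pow, Real.log_mul hm0.ne' hl0.ne'] at this
    refine this.trans ?_
    rw [div_le_div_iff₀ (by positivity) hm0]
    have := mul_nonneg hD hm0.le
    nlinarith
  have a1 := (abs_le.1 (hp n hn)).1
  have a2 := (abs_le.1 (hp (n + 1) (by omega))).2
  have a3 := sum_blockSum_le N (n := n) (t := 2 ^ (n + 1)) le_rfl
  have a4 := le_sum_blockSum N (n := n) (t := 2 ^ n) (pow_lt_pow_right₀ one_lt_two (by omega))
  have a5 := (abs_le.1 (abs_log_sub_log_le (by linarith : (0 : ℝ) < n)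
    (by push_cast; linarith : (n : ℝ) ≤ ((n + 1 : ℕ) : ℝ)))).2
  have a6 : (((n + 1 : ℕ) : ℝ) - n) / n = 1 / n := by push_cast; ring
  have a7 : 2 * D / ((n + 1 : ℕ) : ℝ) ≤ 2 * D / n := by
    gcongr; linarith
  have a8 : (2 * D + 1) / (n : ℝ) = 2 * D / n + 1 / n := by ring
  have a9 : 0 ≤ 1 / (n : ℝ) := by positivity
  rw [abs_le, a8]
  constructor <;> linarith

/-- The sum over pairs of prime powers, and the sum that bounds the error when the inner sums are
evaluated. -/
lemma exists_pairSum_sub_le {c D : ℝ}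
    (h : ∀ t, 2 ≤ t → |ppSum N (fun _ => 1) t - Real.log (Real.log t) - c| ≤ D / Real.log t) :
    ∃ C, 0 ≤ C ∧ ∀ y, 16 ≤ y →
      |pairSum N y - ((Real.log (Real.log y) + c) ^ 2 - Real.pi ^ 2 / 6)|
          ≤ C * (Real.log (Real.log y) / Real.log y) ∧
      ∑ q ∈ ppBall N y, (ppSize N q)⁻¹ * (1 / (1 + Real.log (y / ppSize N q)))
          ≤ C * (Real.log (Real.log y) / Real.log y) := by
  obtain ⟨C', hC'0, ha, hconv⟩ := exists_convolution (blockSum_nonneg N)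
    fun n hn => abs_sum_blockSum_sub_le h hn
  set c' := c + Real.log (Real.log 2) with hc'
  set B := C' + 3 * (3 + 2 * |c'| + 2) with hB
  have hB0 : 0 ≤ B := by positivity
  refine ⟨8 * B + 64 * C', by positivity, fun y hy => ?_⟩
  have hLL := one_le_loglog hy
  have hly : 0 < Real.log y := Real.log_pos (by linarith)
  have hl := Real.log_two_gt_d9
  set r := Real.log (Real.log y) / Real.log y with hr
  have hr0 : 0 ≤ r := by positivity
  obtain ⟨n, hn4, hn1, hn2, hn3, hn5⟩ := exists_scale hy
  -- The sum over the triangle `i + j ≤ k` has the same asymptotics for all `k` close to the binary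
  -- logarithm of `y`; `k = n` and `k = n - 2` bound `pairSum N y` from above and below.
  have hk : ∀ k : ℕ, 2 ≤ k → (k : ℝ) * Real.log 2 ≤ Real.log y →
      Real.log y ≤ (k + 3) * Real.log 2 →
      |∑ i ∈ Finset.range (k + 1), blockSum N i * ∑ j ∈ Finset.range (k - i + 1), blockSum N j
        - ((Real.log (Real.log y) + c) ^ 2 - Real.pi ^ 2 / 6)| ≤ 8 * B * r := by
    intro k hk2 hk3 hk4
    obtain ⟨g1, g2⟩ := log_near hy hk2 hk3 hk4
    have hk1 : (1 : ℝ) ≤ k := by exact_mod_cast (by omega : 1 ≤ k)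
    have hlk : 0 ≤ Real.log k := Real.log_nonneg hk1
    have g3 := hconv k (by omega)
    set V := Real.log k + c' with hV
    set U := Real.log (Real.log y) + c with hU
    have g4 : |U - V| ≤ 3 / k := by
      refine le_trans (le_of_eq ?_) g1
      rw [hU, hV, hc']; congr 1; ring
    have g5 : |U - V + 2 * V| ≤ (3 + 2 * |c'| + 2) * (1 + Real.log k) := by
      refine (abs_add_le _ _).trans ?_
      have v1 : 3 / (k : ℝ) ≤ 3 := div_le_self (by norm_num) hk1
      have v2 : |2 * V| ≤ 2 * (Real.log k + |c'|) := by
        rw [abs_mul, abs_two]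
        gcongr
        refine (abs_add_le _ _).trans ?_
        rw [abs_of_nonneg hlk]
      have := abs_nonneg c'
      nlinarith
    have g6 : |V ^ 2 - U ^ 2| ≤ 3 * (3 + 2 * |c'| + 2) * ((1 + Real.log k) / k) := by
      have : U ^ 2 - V ^ 2 = (U - V) * (U - V + 2 * V) := by ring
      rw [abs_sub_comm, this, abs_mul]
      calc _ ≤ 3 / (k : ℝ) * ((3 + 2 * |c'| + 2) * (1 + Real.log k)) := by gcongr
        _ = _ := by ring
    set S := ∑ i ∈ Finset.range (k + 1), blockSum N i *
      ∑ j ∈ Finset.range (k - i + 1), blockSum N j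
    calc |S - (U ^ 2 - Real.pi ^ 2 / 6)|
        = |(S - (V ^ 2 - Real.pi ^ 2 / 6)) + (V ^ 2 - U ^ 2)| := by congr 1; ring
      _ ≤ C' * ((1 + Real.log k) / k) + 3 * (3 + 2 * |c'| + 2) * ((1 + Real.log k) / k) :=
          (abs_add_le _ _).trans (add_le_add g3 g6)
      _ = B * ((1 + Real.log k) / k) := by rw [hB]; ring
      _ ≤ B * (8 * r) := by gcongr
      _ = _ := by ring
  constructor
  · have u1 := hk n (by omega) hn3 (by linarith)
    have hcast : ((n - 2 : ℕ) : ℝ) = n - 2 := by rw [Nat.cast_sub (by omega)]; norm_num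
    have u2 := hk (n - 2) (by omega) (by rw [hcast]; linarith)
      (hn5.trans (le_of_eq (by rw [hcast]; ring)))
    have u3 := pairSum_le N hn2
    have u4 := le_pairSum N (n := n - 2) (y := y) (by
      have : n - 2 + 2 = n := by omega
      rwa [this])
    have u5 : 0 ≤ 64 * C' * r := by positivity
    rw [abs_le] at u1 u2 ⊢
    rw [add_mul]
    constructor <;> linarith
  · obtain ⟨-, g2⟩ := log_near hy (k := n) (by omega) hn3 (by linarith)
    have hstep : ∀ q ∈ ppBall N y, (ppSize N q)⁻¹ * (1 / (1 + Real.log (y / ppSize N q)))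
        ≤ (ppSize N q)⁻¹ * (2 / ((n - scale N q : ℕ) + 1)) := by
      intro q hq
      have hq0 := ppSize_pos N q
      have hqy := mem_ppBall.1 hq
      have hsc : scale N q ≤ n := (scale_le_iff N).2 (hqy.trans_lt hn2)
      have hlog0 : 0 ≤ Real.log (y / ppSize N q) := Real.log_nonneg ((one_le_div hq0).2 hqy)
      gcongr ?_ * ?_
      rw [div_le_div_iff₀ (by linarith) (by positivity)]
      rcases Nat.eq_zero_or_pos (n - scale N q) with h0 | h0
      · rw [h0]; simp; linarith
      · have g3 : (2 : ℝ) ^ (n - scale N q - 1) ≤ y / ppSize N q := by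
          rw [le_div_iff₀ hq0]
          calc (2 : ℝ) ^ (n - scale N q - 1) * ppSize N q
              ≤ 2 ^ (n - scale N q - 1) * 2 ^ (scale N q + 1) := by
                gcongr; exact (scale_spec N q).2.le
            _ = 2 ^ n := by rw [← pow_add]; congr 1; omega
            _ ≤ y := hn1
        have g4 := Real.log_le_log (by positivity) g3
        rw [Real.log_pow, Nat.cast_sub (by omega : 1 ≤ n - scale N q)] at g4
        have g5 : (1 : ℝ) ≤ (n - scale N q : ℕ) := by exact_mod_cast h0
        push_cast at g4
        nlinarith
    calc _ ≤ ∑ q ∈ ppBall N y, (ppSize N q)⁻¹ * (2 / ((n - scale N q : ℕ) + 1)) :=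
          Finset.sum_le_sum hstep
      _ ≤ ∑ q ∈ (ppBall N (2 ^ (n + 1))).filter (scale N · ≤ n),
            (ppSize N q)⁻¹ * (2 / ((n - scale N q : ℕ) + 1)) := by
          refine Finset.sum_le_sum_of_subset_of_nonneg (fun q hq => ?_) fun q _ _ => ?_
          · have h := mem_ppBall.1 hq
            exact Finset.mem_filter.2
              ⟨mem_ppBall.2 (h.trans hn2.le), (scale_le_iff N).2 (h.trans_lt hn2)⟩
          · have := ppSize_pos N q
            positivity
      _ = ∑ i ∈ Finset.range (n + 1), blockSum N i * (2 / ((n - i : ℕ) + 1)) :=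
          (sum_scale N (fun i => 2 / (((n - i : ℕ) : ℝ) + 1)) n).symm
      _ ≤ ∑ i ∈ Finset.range (n + 1), 2 * C' * (1 / (((i : ℝ) + 1) * ((n - i : ℕ) + 1))) := by
          refine Finset.sum_le_sum fun i _ => ?_
          calc _ ≤ C' / ((i : ℝ) + 1) * (2 / ((n - i : ℕ) + 1)) := by
                gcongr; exact ha i
            _ = _ := by rw [div_mul_div_comm]; ring
      _ = 2 * C' * ∑ i ∈ Finset.range (n + 1), 1 / (((i : ℝ) + 1) * ((n - i : ℕ) + 1)) := by
          rw [Finset.mul_sum]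
      _ ≤ 2 * C' * (4 * (8 * r)) := by
          gcongr
          exact (sum_one_div_mul_le (by omega)).trans (by gcongr)
      _ ≤ _ := by
          have : 0 ≤ B * r := by positivity
          linarith

variable {Y : Set ℝ} {κ θ K : ℝ}

namespace Regular

variable (R : Regular N Y κ θ K)
include R

/-- The first moment over all elements. -/
lemma exists_sum_omega_sub_le [Nonempty P] {c D : ℝ}
    (h : ∀ t, 2 ≤ t → |ppSum N (fun _ => 1) t - Real.log (Real.log t) - c| ≤ D / Real.log t) :
    ∃ C, ∀ y ∈ Y, 16 ≤ y →
      |∑ m ∈ ball N y, omega m - κ * y * (Real.log (Real.log y) + c)| ≤ C * (y / Real.log y) := by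
  obtain ⟨C, hC0, hC⟩ := R.exists_sum_count_sub_le
  have hκ := R.kappa_pos
  refine ⟨C + κ * D, fun y hy hy16 => ?_⟩
  have hy0 : 0 < y := by linarith
  have hly : 0 < Real.log y := Real.log_pos (by linarith)
  have h1 := hC (fun _ => 1) (fun _ => zero_le_one) (fun k => by simp) y hy (by linarith)
  simp only [one_mul] at h1
  rw [← sum_omega] at h1
  have h2 := h y (by linarith)
  set M := ppSum N (fun _ => 1) y
  calc _ = |(∑ m ∈ ball N y, omega m - κ * y * M)
        + κ * y * (M - Real.log (Real.log y) - c)| := by congr 1; ring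
    _ ≤ C * (y / Real.log y) + κ * y * (D / Real.log y) := by
        refine (abs_add_le _ _).trans (add_le_add (h1.trans ?_) ?_)
        · gcongr; linarith
        · rw [abs_mul, abs_of_pos (by positivity)]
          gcongr
    _ = _ := by ring

/-- The second moment over all elements. -/
lemma exists_sum_omega_sq_sub_le [Nonempty P] {c c' D D' : ℝ}
    (h : ∀ t, 2 ≤ t → |ppSum N (fun _ => 1) t - Real.log (Real.log t) - c| ≤ D / Real.log t)
    (h' : ∀ t, 2 ≤ t →
      |ppSum N (fun k => k + 1) t - Real.log (Real.log t) - c'| ≤ D' / Real.log t) :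
    ∃ C, ∀ y ∈ Y, 16 ≤ y →
      |∑ m ∈ ball N y, omega m ^ 2 - κ * y * ((Real.log (Real.log y) + c) ^ 2 - Real.pi ^ 2 / 6
          + (Real.log (Real.log y) + c'))|
        ≤ C * (y * (Real.log (Real.log y) / Real.log y)) := by
  obtain ⟨C, hC0, hC⟩ := R.exists_sum_count_sub_le
  obtain ⟨B, hB0, hB⟩ := exists_pairSum_sub_le h
  have hκ := R.kappa_pos
  have hD' : 0 ≤ D' := by
    have := (abs_nonneg _).trans (h' 2 le_rfl)
    rw [le_div_iff₀ (Real.log_pos one_lt_two)] at this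
    linarith
  refine ⟨C * B + κ * B + C + κ * D', fun y hy hy16 => ?_⟩
  have hy0 : 0 < y := by linarith
  have hly : 0 < Real.log y := Real.log_pos (by linarith)
  have hLL := one_le_loglog hy16
  obtain ⟨b1, b2⟩ := hB y hy16
  set r := Real.log (Real.log y) / Real.log y with hr
  have hlr : 1 / Real.log y ≤ r := by rw [hr]; gcongr
  have h1 : |∑ q ∈ ppBall N y, ∑ m ∈ ball N (y / ppSize N q), omega m - κ * y * pairSum N y|
      ≤ C * B * (y * r) := by
    have e1 : ∑ q ∈ ppBall N y, ∑ m ∈ ball N (y / ppSize N q), omega m - κ * y * pairSum N y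
        = ∑ q ∈ ppBall N y, (∑ m ∈ ball N (y / ppSize N q), omega m
          - κ * (y / ppSize N q) * ppSum N (fun _ => 1) (y / ppSize N q)) := by
      rw [pairSum, Finset.mul_sum, ← Finset.sum_sub_distrib]
      refine Finset.sum_congr rfl fun q _ => ?_
      ring
    rw [e1]
    refine (Finset.abs_sum_le_sum_abs _ _).trans ?_
    calc _ ≤ ∑ q ∈ ppBall N y,
          C * y * ((ppSize N q)⁻¹ * (1 / (1 + Real.log (y / ppSize N q)))) := by
          refine Finset.sum_le_sum fun q hq => ?_
          have e2 := hC (fun _ => 1) (fun _ => zero_le_one) (fun k => by simp) _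
            (R.div_mem _ hy _ (R.ppSize_mem q))
            ((one_le_div (ppSize_pos N q)).2 (mem_ppBall.1 hq))
          simp only [one_mul] at e2
          rw [← sum_omega] at e2
          refine e2.trans (le_of_eq ?_)
          ring
      _ = C * y * ∑ q ∈ ppBall N y, (ppSize N q)⁻¹ * (1 / (1 + Real.log (y / ppSize N q))) := by
          rw [Finset.mul_sum]
      _ ≤ C * y * (B * r) := by gcongr
      _ = _ := by ring
  have h2 := hC (fun k => k + 1) (fun k => by positivity) (fun k => le_rfl) y hy (by linarith)
  have h3 := h' y (by linarith)
  have h4 : C * (y / (1 + Real.log y)) ≤ C * (y * r) := by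
    gcongr
    rw [div_eq_mul_one_div]
    gcongr
    refine le_trans ?_ hlr
    gcongr
    linarith
  have h5 : D' / Real.log y ≤ D' * r := by
    rw [div_eq_mul_one_div]; gcongr
  rw [sum_omega_sq]
  set W := ∑ q ∈ ppBall N y, ∑ m ∈ ball N (y / ppSize N q), omega m
  set T := ∑ q ∈ ppBall N y, ((q.2 : ℝ) + 1) * count N (y / ppSize N q)
  set M := ppSum N (fun k => (k : ℝ) + 1) y
  set L := Real.log (Real.log y)
  calc _ = |(W - κ * y * pairSum N y) + κ * y * (pairSum N y - ((L + c) ^ 2 - Real.pi ^ 2 / 6))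
        + (T - κ * y * M) + κ * y * (M - L - c')| := by congr 1; ring
    _ ≤ C * B * (y * r) + κ * y * (B * r) + C * (y * r) + κ * y * (D' * r) := by
        refine (abs_add_le _ _).trans (add_le_add ((abs_add_le _ _).trans (add_le_add
          ((abs_add_le _ _).trans (add_le_add h1 ?_)) (h2.trans h4))) ?_)
        · rw [abs_mul, abs_of_pos (by positivity : 0 < κ * y)]
          gcongr
        · rw [abs_mul, abs_of_pos (by positivity : 0 < κ * y)]
          exact mul_le_mul_of_nonneg_left (h3.trans h5) (by positivity)
    _ = _ := by ring

end Regular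

end

section

/-! ### Sums of slowly varying functions of `x / N(d) ^ h` -/

lemma one_add_log_pow_le {x : ℝ} (hx : 1 ≤ x) : (1 + Real.log x) ^ 3 ≤ 25 ^ 3 * x ^ (1 / 8 : ℝ) := by
  have h1 := Real.log_le_rpow_div (by linarith : 0 ≤ x) (by norm_num : (0 : ℝ) < 1 / 24)
  have h2 : 1 ≤ x ^ (1 / 24 : ℝ) := Real.one_le_rpow hx (by norm_num)
  have h3 : 1 + Real.log x ≤ 25 * x ^ (1 / 24 : ℝ) := by linarith
  have h4 : (x ^ (1 / 24 : ℝ)) ^ 3 = x ^ (1 / 8 : ℝ) := by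
    rw [← Real.rpow_natCast, ← Real.rpow_mul (by linarith)]; norm_num
  have h5 : 0 ≤ 1 + Real.log x := by linarith [Real.log_nonneg hx]
  calc (1 + Real.log x) ^ 3 ≤ (25 * x ^ (1 / 24 : ℝ)) ^ 3 := by gcongr
    _ = _ := by rw [mul_pow, h4]

variable {P : Type*} {N : P → ℕ} [NormFinite N] {Y : Set ℝ} {κ θ K : ℝ}

variable (N) in
lemma omega_le_log (m : P →₀ ℕ) : omega m ≤ 2 * Real.log (size N m) := by
  rw [log_size_eq, omega]
  unfold additive Finsupp.sum
  rw [Finset.mul_sum]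
  refine Finset.sum_le_sum fun p _ => ?_
  have h1 := Real.log_le_log two_pos (two_le_cast N p)
  have h2 := Real.log_two_gt_d9
  have h3 : (0 : ℝ) ≤ m p := Nat.cast_nonneg _
  nlinarith

lemma sum_omega_pow_le (y : ℝ) (j : ℕ) :
    ∑ m ∈ ball N y, omega m ^ j ≤ count N y * (2 * Real.log y) ^ j := by
  rw [count, ← nsmul_eq_mul, ← Finset.sum_const]
  refine Finset.sum_le_sum fun m hm => ?_
  have := omega_nonneg m
  gcongr
  refine (omega_le_log N m).trans ?_
  gcongr
  · exact size_pos N m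
  · exact mem_ball.1 hm

namespace Regular

variable (R : Regular N Y κ θ K)
include R

/-- Weights growing like a power of `omega` do not affect convergence. -/
lemma summable_omega_mul {s : ℝ} (hs : 3 / 2 ≤ s) :
    Summable fun d => (1 + omega d) ^ 2 * size N d ^ (-s) := by
  refine Summable.of_nonneg_of_le (fun d => ?_) (fun d => ?_)
    ((R.summable_size_rpow (s := 5 / 4) (by norm_num)).mul_left 289)
  · have := size_pos N d; positivity
  · have h0 := one_le_size N d
    have h1 := Real.log_le_rpow_div (by linarith : 0 ≤ size N d) (by norm_num : (0 : ℝ) < 1 / 8)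
    have h2 : 1 ≤ size N d ^ (1 / 8 : ℝ) := Real.one_le_rpow h0 (by norm_num)
    have h3 := omega_le_log N d
    have h4 := omega_nonneg d
    have h5 : 1 + omega d ≤ 17 * size N d ^ (1 / 8 : ℝ) := by linarith
    have h6 : size N d ^ (-s) ≤ size N d ^ (-(3 / 2) : ℝ) :=
      Real.rpow_le_rpow_of_exponent_le h0 (by linarith)
    calc (1 + omega d) ^ 2 * size N d ^ (-s)
        ≤ (17 * size N d ^ (1 / 8 : ℝ)) ^ 2 * size N d ^ (-(3 / 2) : ℝ) := by gcongr
      _ = 289 * ((size N d ^ (1 / 8 : ℝ)) ^ 2 * size N d ^ (-(3 / 2) : ℝ)) := by ring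
      _ = _ := by
        rw [← Real.rpow_natCast, ← Real.rpow_mul (by linarith), ← Real.rpow_add (by linarith)]
        norm_num

/-- If `V y` is approximately `y * G y` with a slowly varying `G`, then so are the sums of
`V (x / N(d) ^ h)` with coefficients whose Dirichlet series converges absolutely a little to the
left of `h`. The saving `N(d) ^ (h / 4)` in the convergence absorbs both the variation of `G` and
the range in which `x / N(d) ^ h` is small. -/
lemma exists_sum_div_pow_sub_le {h : ℕ} (hh : 2 ≤ h) {V G η : ℝ → ℝ} {C : ℝ} (hC : 0 ≤ C)
    (hV : ∀ y ∈ Y, 16 ≤ y → |V y - y * G y| ≤ C * (y * η y))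
    (hV0 : ∀ y < 1, V y = 0)
    (hVb : ∀ y ∈ Y, 1 ≤ y → |V y| ≤ C * (y * (1 + Real.log y) ^ 2))
    (hG : ∀ x, 16 ≤ x → |G x| ≤ C * (1 + Real.log x) ^ 2)
    (hGd : ∀ x D, 256 ≤ x → 1 ≤ D → D ≤ √x → |G (x / D) - G x| ≤ C * (Real.log D * η x))
    (hη : ∀ x D, 256 ≤ x → 1 ≤ D → D ≤ √x → η (x / D) ≤ 2 * η x)
    (hη1 : ∀ x, 16 ≤ x → 1 ≤ η x * (1 + Real.log x))
    {f : (P →₀ ℕ) → ℝ} (hf : ∀ d, |f d| ≤ (1 + omega d) ^ 2) :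
    ∃ C', ∀ x ∈ Y, 256 ≤ x →
      |∑ d ∈ ball N x, f d * V (x / size N d ^ h) - x * G x * ∑' d, f d * (size N d ^ h)⁻¹|
        ≤ C' * (x * η x) := by
  have hg0 : ∀ d, 0 ≤ (1 + omega d) ^ 2 * (size N d ^ h) ^ (-(3 / 4) : ℝ) := fun d => by
    have := size_pos N d; positivity
  have hrp : ∀ d, (size N d ^ h) ^ (-(3 / 4) : ℝ) = size N d ^ (-(3 / 4 * h) : ℝ) := fun d => by
    rw [← Real.rpow_natCast, ← Real.rpow_mul (size_pos N d).le]; congr 1; ring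
  have hh' : (2 : ℝ) ≤ h := by exact_mod_cast hh
  have hS : Summable fun d => (1 + omega d) ^ 2 * (size N d ^ h) ^ (-(3 / 4) : ℝ) := by
    simp only [hrp]; exact R.summable_omega_mul (by linarith)
  have hfs : Summable fun d => f d * (size N d ^ h)⁻¹ := by
    refine Summable.of_norm_bounded hS fun d => ?_
    have h1 : 1 ≤ size N d ^ h := one_le_pow₀ (one_le_size N d)
    rw [Real.norm_eq_abs, abs_mul, abs_of_pos (by positivity : 0 < (size N d ^ h)⁻¹),
      ← Real.rpow_neg_one]
    exact mul_le_mul (hf d) (Real.rpow_le_rpow_of_exponent_le h1 (by norm_num)) (by positivity)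
      (by positivity)
  set S := ∑' d, (1 + omega d) ^ 2 * (size N d ^ h) ^ (-(3 / 4) : ℝ) with hSdef
  have hS0 : 0 ≤ S := tsum_nonneg hg0
  -- `η` is at least of order `1 / log`, so a power of `x` absorbs all logarithms.
  have hlogs : ∀ x, 16 ≤ x → (1 + Real.log x) ^ 2 ≤ 25 ^ 3 * x ^ (1 / 8 : ℝ) * η x := by
    intro x hx
    have h1 := one_add_log_pow_le (by linarith : 1 ≤ x)
    have h2 := hη1 x hx
    have h3 : 0 < 1 + Real.log x := by linarith [Real.log_nonneg (by linarith : 1 ≤ x)]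
    have h4 : 0 < η x := by
      by_contra! h
      nlinarith
    calc (1 + Real.log x) ^ 2 ≤ (1 + Real.log x) ^ 2 * (η x * (1 + Real.log x)) :=
          le_mul_of_one_le_right (by positivity) h2
      _ = (1 + Real.log x) ^ 3 * η x := by ring
      _ ≤ _ := by gcongr
  set C₁ := 6 * C + 2 * C * 25 ^ 3 with hC₁
  have hC₁0 : 0 ≤ C₁ := by positivity
  have hmain : ∀ x, x ∈ Y → 256 ≤ x → ∀ d, size N d ^ h ≤ x →
      |V (x / size N d ^ h) - x / size N d ^ h * G x|
        ≤ C₁ * (x * η x) * (size N d ^ h) ^ (-(3 / 4) : ℝ) := by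
    intro x hx hx1 d hd
    set D := size N d ^ h with hD
    have hx0 : 0 < x := by linarith
    have hD1 : 1 ≤ D := one_le_pow₀ (one_le_size N d)
    have hD0 : 0 < D := by linarith
    have hz : x / D ∈ Y := R.div_mem _ hx _ (by rw [hD, ← size_nsmul]; exact R.size_mem _)
    have hlx : 0 ≤ Real.log x := Real.log_nonneg (by linarith)
    have hη0 : 0 < η x := by
      have := hη1 x (by linarith)
      by_contra! h
      nlinarith
    have hDq : x / D * D ^ (1 / 4 : ℝ) = x * D ^ (-(3 / 4) : ℝ) := by
      rw [div_mul_eq_mul_div, mul_div_assoc, div_eq_mul_inv (D ^ (1 / 4 : ℝ)), ← Real.rpow_neg_one,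
        ← Real.rpow_add hD0]
      norm_num
    have hgoal : C₁ * (x * η x) * D ^ (-(3 / 4) : ℝ) = C₁ * η x * (x / D * D ^ (1 / 4 : ℝ)) := by
      rw [hDq]; ring
    rw [hgoal]
    have hlogD : 0 ≤ Real.log D := Real.log_nonneg hD1
    rcases le_or_gt D √x with hDx | hDx
    · have hs16 : 16 ≤ √x := by
        rw [Real.le_sqrt (by norm_num) hx0.le]; linarith
      have hz16 : 16 ≤ x / D := by
        rw [le_div_iff₀ hD0]
        calc 16 * D ≤ √x * √x := by gcongr
          _ = x := Real.mul_self_sqrt hx0.le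
      have e1 := hV _ hz hz16
      have e2 := hGd x D hx1 hD1 hDx
      have e3 := hη x D hx1 hD1 hDx
      have e4 := Real.log_le_rpow_div hD0.le (by norm_num : (0 : ℝ) < 1 / 4)
      have e5 : 1 ≤ D ^ (1 / 4 : ℝ) := Real.one_le_rpow hD1 (by norm_num)
      have hz0 : 0 < x / D := by positivity
      calc |V (x / D) - x / D * G x|
          = |(V (x / D) - x / D * G (x / D)) + x / D * (G (x / D) - G x)| := by congr 1; ring
        _ ≤ C * (x / D * (2 * η x)) + x / D * (C * (Real.log D * η x)) := by
            refine (abs_add_le _ _).trans (add_le_add (e1.trans (by gcongr)) ?_)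
            rw [abs_mul, abs_of_pos hz0]
            gcongr
        _ = C * η x * (x / D) * (2 + Real.log D) := by ring
        _ ≤ C * η x * (x / D) * (6 * D ^ (1 / 4 : ℝ)) := by
            gcongr; linarith
        _ = 6 * C * η x * (x / D * D ^ (1 / 4 : ℝ)) := by ring
        _ ≤ _ := by
            gcongr
            rw [hC₁]
            have : 0 ≤ 2 * C * 25 ^ 3 := by positivity
            linarith
    · have hz1 : 1 ≤ x / D := (one_le_div hD0).2 hd
      have hz0 : 0 < x / D := by positivity
      have e1 := hVb _ hz hz1
      have e2 := hG x (by linarith)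
      have e3 : Real.log (x / D) ≤ Real.log x :=
        Real.log_le_log hz0 (div_le_self hx0.le hD1)
      have e4 : x ^ (1 / 8 : ℝ) ≤ D ^ (1 / 4 : ℝ) := by
        have : x ^ (1 / 8 : ℝ) = √x ^ (1 / 4 : ℝ) := by
          rw [Real.sqrt_eq_rpow, ← Real.rpow_mul hx0.le]; norm_num
        rw [this]
        gcongr
      have e5 := hlogs x (by linarith)
      have e6 : 0 ≤ Real.log (x / D) := Real.log_nonneg hz1
      calc |V (x / D) - x / D * G x|
          ≤ C * (x / D * (1 + Real.log x) ^ 2) + x / D * (C * (1 + Real.log x) ^ 2) := by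
            refine (abs_sub _ _).trans (add_le_add (e1.trans (by gcongr)) ?_)
            rw [abs_mul, abs_of_pos hz0]
            gcongr
        _ = 2 * C * (x / D) * (1 + Real.log x) ^ 2 := by ring
        _ ≤ 2 * C * (x / D) * (25 ^ 3 * D ^ (1 / 4 : ℝ) * η x) := by
            gcongr
            exact e5.trans (by gcongr)
        _ = 2 * C * 25 ^ 3 * η x * (x / D * D ^ (1 / 4 : ℝ)) := by ring
        _ ≤ _ := by
            gcongr
            rw [hC₁]
            linarith
  refine ⟨C₁ * S + C * 25 ^ 3 * S, fun x hx hx1 => ?_⟩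
  have hx0 : 0 < x := by linarith
  have hlx : 0 ≤ Real.log x := Real.log_nonneg (by linarith)
  have hη0 : 0 < η x := by
    have := hη1 x (by linarith)
    by_contra! h
    nlinarith
  set s := (ball N x).filter (fun d => size N d ^ h ≤ x) with hs
  have hsmem : ∀ d, d ∉ s → x < size N d ^ h := by
    intro d hd
    by_contra! hle
    refine hd (Finset.mem_filter.2 ⟨mem_ball.2 (le_trans ?_ hle), hle⟩)
    exact le_self_pow₀ (one_le_size N d) (by omega)
  have e1 : ∑ d ∈ ball N x, f d * V (x / size N d ^ h)
      = ∑ d ∈ s, f d * V (x / size N d ^ h) := by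
    symm
    refine Finset.sum_subset (Finset.filter_subset _ _) fun d _ hd => ?_
    rw [hV0 _ ((div_lt_one (pow_pos (size_pos N d) h)).2 (hsmem d hd)), mul_zero]
  have e2 : |∑ d ∈ s, f d * (V (x / size N d ^ h) - x / size N d ^ h * G x)|
      ≤ C₁ * (x * η x) * S := by
    refine (Finset.abs_sum_le_sum_abs _ _).trans ?_
    have h2 := hS.sum_le_tsum s fun d _ => hg0 d
    refine le_trans ?_ (mul_le_mul_of_nonneg_left h2 (by positivity))
    rw [Finset.mul_sum]
    refine Finset.sum_le_sum fun d hd => ?_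
    rw [abs_mul]
    calc _ ≤ (1 + omega d) ^ 2 * (C₁ * (x * η x) * (size N d ^ h) ^ (-(3 / 4) : ℝ)) :=
          mul_le_mul (hf d) (hmain x hx hx1 d (Finset.mem_filter.1 hd).2) (abs_nonneg _)
            (by positivity)
      _ = _ := by ring
  have e3 : |∑ d ∈ s, f d * (size N d ^ h)⁻¹ - ∑' d, f d * (size N d ^ h)⁻¹|
      ≤ x ^ (-(1 / 4) : ℝ) * S := by
    refine abs_sum_sub_tsum_le s hfs hS hg0 (by positivity) fun d hd => ?_
    have hD0 : 0 < size N d ^ h := pow_pos (size_pos N d) h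
    have h3 : (size N d ^ h)⁻¹
        = (size N d ^ h) ^ (-(1 / 4) : ℝ) * (size N d ^ h) ^ (-(3 / 4) : ℝ) := by
      rw [← Real.rpow_add hD0, ← Real.rpow_neg_one]; norm_num
    have h4 : (size N d ^ h) ^ (-(1 / 4) : ℝ) ≤ x ^ (-(1 / 4) : ℝ) :=
      Real.rpow_le_rpow_of_nonpos hx0 (hsmem d hd).le (by norm_num)
    rw [abs_mul, abs_of_pos (inv_pos.2 hD0), h3]
    calc _ ≤ (1 + omega d) ^ 2 * (x ^ (-(1 / 4) : ℝ) * (size N d ^ h) ^ (-(3 / 4) : ℝ)) := by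
          gcongr
          exact hf d
      _ = _ := by ring
  have e4 : |x * G x| * x ^ (-(1 / 4) : ℝ) ≤ C * 25 ^ 3 * (x * η x) := by
    have h1 := hG x (by linarith)
    have h2 := hlogs x (by linarith)
    have h3 : x ^ (1 / 8 : ℝ) * x ^ (-(1 / 4) : ℝ) ≤ 1 := by
      rw [← Real.rpow_add hx0]
      exact Real.rpow_le_one_of_one_le_of_nonpos (by linarith) (by norm_num)
    rw [abs_mul, abs_of_pos hx0]
    calc x * |G x| * x ^ (-(1 / 4) : ℝ)
        ≤ x * (C * (25 ^ 3 * x ^ (1 / 8 : ℝ) * η x)) * x ^ (-(1 / 4) : ℝ) := by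
          gcongr
          exact h1.trans (by gcongr)
      _ = C * 25 ^ 3 * (x * η x) * (x ^ (1 / 8 : ℝ) * x ^ (-(1 / 4) : ℝ)) := by ring
      _ ≤ _ := mul_le_of_le_one_right (by positivity) h3
  calc |∑ d ∈ ball N x, f d * V (x / size N d ^ h) - x * G x * ∑' d, f d * (size N d ^ h)⁻¹|
      = |∑ d ∈ s, f d * (V (x / size N d ^ h) - x / size N d ^ h * G x)
        + x * G x * (∑ d ∈ s, f d * (size N d ^ h)⁻¹ - ∑' d, f d * (size N d ^ h)⁻¹)| := by
        rw [e1]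
        congr 1
        have : ∑ d ∈ s, f d * (V (x / size N d ^ h) - x / size N d ^ h * G x)
            = ∑ d ∈ s, f d * V (x / size N d ^ h) - x * G x * ∑ d ∈ s, f d * (size N d ^ h)⁻¹ := by
          rw [Finset.mul_sum, ← Finset.sum_sub_distrib]
          refine Finset.sum_congr rfl fun d _ => ?_
          ring
        rw [this]; ring
    _ ≤ C₁ * (x * η x) * S + |x * G x| * (x ^ (-(1 / 4) : ℝ) * S) := by
        refine (abs_add_le _ _).trans (add_le_add e2 ?_)
        rw [abs_mul]
        gcongr
    _ = C₁ * (x * η x) * S + |x * G x| * x ^ (-(1 / 4) : ℝ) * S := by ring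
    _ ≤ C₁ * (x * η x) * S + C * 25 ^ 3 * (x * η x) * S := by gcongr
    _ = _ := by ring

end Regular

end

section

/-! ### The moments over `h`-free elements -/

lemma loglog_le {x : ℝ} (hx : 16 ≤ x) : Real.log (Real.log x) ≤ Real.log x := by
  have : 0 < Real.log x := Real.log_pos (by linarith)
  linarith [Real.log_le_sub_one_of_pos this]

/-- Slow variation of `log` and `log log`. -/
lemma log_div_bounds {x D : ℝ} (hx : 256 ≤ x) (hD : 1 ≤ D) (hDx : D ≤ √x) :
    16 ≤ x / D ∧ Real.log x ≤ 2 * Real.log (x / D) ∧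
      Real.log (Real.log (x / D)) ≤ Real.log (Real.log x) ∧
      |Real.log (Real.log (x / D)) - Real.log (Real.log x)| ≤ 2 * (Real.log D / Real.log x) := by
  have hx0 : 0 < x := by linarith
  have hD0 : 0 < D := by linarith
  have hs16 : 16 ≤ √x := by
    rw [Real.le_sqrt (by norm_num) hx0.le]; linarith
  have hz16 : 16 ≤ x / D := by
    rw [le_div_iff₀ hD0]
    calc 16 * D ≤ √x * √x := by gcongr
      _ = x := Real.mul_self_sqrt hx0.le
  have h1 : Real.log D ≤ Real.log x / 2 := by
    rw [← Real.log_sqrt hx0.le]; exact Real.log_le_log hD0 hDx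
  have h2 : Real.log (x / D) = Real.log x - Real.log D := Real.log_div hx0.ne' hD0.ne'
  have hlD : 0 ≤ Real.log D := Real.log_nonneg hD
  have hlx : 0 < Real.log x := Real.log_pos (by linarith)
  have hlz : 0 < Real.log (x / D) := Real.log_pos (by linarith)
  have h3 := abs_log_sub_log_le hlz (by linarith : Real.log (x / D) ≤ Real.log x)
  refine ⟨hz16, by linarith, Real.log_le_log hlz (by linarith), ?_⟩
  rw [abs_sub_comm]
  refine h3.trans ?_
  rw [← mul_div_assoc, div_le_div_iff₀ hlz hlx]
  nlinarith

variable {P : Type*} {N : P → ℕ} [NormFinite N] {Y : Set ℝ} {κ θ K : ℝ}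

variable (N) in
/-- The series `∑ μ(d) Ω(d) ^ j / N(d) ^ h`. -/
def mobSum (h j : ℕ) : ℝ := ∑' d, mob d * omega d ^ j * (size N d ^ h)⁻¹

lemma abs_mob_mul_omega_le (d : P →₀ ℕ) {j : ℕ} (hj : j ≤ 2) :
    |mob d * omega d ^ j| ≤ (1 + omega d) ^ 2 := by
  have h0 := omega_nonneg d
  rw [abs_mul, abs_of_nonneg (pow_nonneg h0 j)]
  refine (mul_le_of_le_one_left (pow_nonneg h0 j) (abs_mob_le d)).trans ?_
  calc omega d ^ j ≤ (1 + omega d) ^ j := by gcongr; linarith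
    _ ≤ (1 + omega d) ^ 2 := pow_le_pow_right₀ (by linarith) hj

namespace Regular

variable (R : Regular N Y κ θ K)
include R

lemma exists_sum_mul_count_div_pow {h : ℕ} (hh : 2 ≤ h) {f : (P →₀ ℕ) → ℝ}
    (hf : ∀ d, |f d| ≤ (1 + omega d) ^ 2) :
    ∃ C, ∀ x ∈ Y, 256 ≤ x →
      |∑ d ∈ ball N x, f d * count N (x / size N d ^ h) - x * κ * ∑' d, f d * (size N d ^ h)⁻¹|
        ≤ C * (x * (1 / Real.log x)) := by
  obtain ⟨C₁, hC₁, h₁⟩ := R.exists_count_le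
  have hκ := R.kappa_pos
  have hθ1 := R.theta_lt
  have hK := R.const_nonneg
  have hθ' : 0 < 1 - θ := by linarith
  refine R.exists_sum_div_pow_sub_le hh (V := count N) (G := fun _ => κ)
    (η := fun x => 1 / Real.log x) (C := C₁ + κ + K / (1 - θ)) (by positivity) ?_ ?_ ?_ ?_ ?_ ?_ ?_
    hf
  · intro y hy hy16
    have hy0 : 0 < y := by linarith
    have hly : 0 < Real.log y := Real.log_pos (by linarith)
    have e1 := R.count_le y hy
    have e2 := Real.log_le_rpow_div hy0.le hθ'
    have e3 : y ^ θ * y ^ (1 - θ) = y := by rw [← Real.rpow_add hy0]; simp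
    have e4 : K * y ^ θ ≤ K / (1 - θ) * (y * (1 / Real.log y)) := by
      rw [mul_one_div, ← mul_div_assoc, le_div_iff₀ hly]
      calc K * y ^ θ * Real.log y ≤ K * y ^ θ * (y ^ (1 - θ) / (1 - θ)) := by gcongr
        _ = K / (1 - θ) * (y ^ θ * y ^ (1 - θ)) := by ring
        _ = _ := by rw [e3]
    rw [mul_comm y κ]
    refine (e1.trans e4).trans ?_
    gcongr
    linarith
  · intro y hy
    rw [count, ball_eq_empty N hy]; simp
  · intro y _ hy1
    rw [abs_of_nonneg (count_nonneg N y)]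
    have hl := Real.log_nonneg hy1
    calc count N y ≤ C₁ * y := h₁ y (by linarith)
      _ ≤ C₁ * (y * (1 + Real.log y) ^ 2) := by
        gcongr
        exact le_mul_of_one_le_right (by linarith) (one_le_pow₀ (by linarith))
      _ ≤ _ := by
        gcongr
        have : 0 ≤ K / (1 - θ) := by positivity
        linarith
  · intro x hx
    have hl := Real.log_nonneg (by linarith : 1 ≤ x)
    rw [abs_of_pos hκ]
    calc κ ≤ κ * (1 + Real.log x) ^ 2 :=
          le_mul_of_one_le_right hκ.le (one_le_pow₀ (by linarith))
      _ ≤ _ := by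
        gcongr
        have : 0 ≤ K / (1 - θ) := by positivity
        linarith
  · intro x D hx hD _
    have := Real.log_nonneg hD
    have := Real.log_nonneg (by linarith : 1 ≤ x)
    rw [sub_self, abs_zero]
    positivity
  · intro x D hx hD hDx
    obtain ⟨a1, a2, -, -⟩ := log_div_bounds hx hD hDx
    have hlx : 0 < Real.log x := Real.log_pos (by linarith)
    have hlz : 0 < Real.log (x / D) := Real.log_pos (by linarith)
    rw [mul_one_div, div_le_div_iff₀ hlz hlx]
    linarith
  · intro x hx
    have hlx : 0 < Real.log x := Real.log_pos (by linarith)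
    rw [one_div_mul_eq_div, one_le_div hlx]
    linarith

lemma exists_sum_mul_omega_div_pow {h : ℕ} (hh : 2 ≤ h) {f : (P →₀ ℕ) → ℝ}
    (hf : ∀ d, |f d| ≤ (1 + omega d) ^ 2) {c C₀ : ℝ}
    (hW : ∀ y ∈ Y, 16 ≤ y →
      |∑ m ∈ ball N y, omega m - κ * y * (Real.log (Real.log y) + c)| ≤ C₀ * (y / Real.log y)) :
    ∃ C, ∀ x ∈ Y, 256 ≤ x →
      |∑ d ∈ ball N x, f d * ∑ m ∈ ball N (x / size N d ^ h), omega m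
          - x * (κ * (Real.log (Real.log x) + c)) * ∑' d, f d * (size N d ^ h)⁻¹|
        ≤ C * (x * (1 / Real.log x)) := by
  obtain ⟨C₁, hC₁, h₁⟩ := R.exists_count_le
  have hκ := R.kappa_pos
  have hb0 : 0 ≤ |C₀| + 2 * C₁ + κ * (2 + |c|) := by positivity
  refine R.exists_sum_div_pow_sub_le hh (V := fun y => ∑ m ∈ ball N y, omega m)
    (G := fun x => κ * (Real.log (Real.log x) + c))
    (η := fun x => 1 / Real.log x) (C := |C₀| + 2 * C₁ + κ * (2 + |c|)) hb0 ?_ ?_ ?_ ?_ ?_ ?_ ?_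
    hf
  · intro y hy hy16
    have hy0 : 0 < y := by linarith
    have hly : 0 < Real.log y := Real.log_pos (by linarith)
    rw [mul_one_div]
    have e1 := hW y hy hy16
    have e2 : y * (κ * (Real.log (Real.log y) + c)) = κ * y * (Real.log (Real.log y) + c) := by
      ring
    rw [e2]
    refine e1.trans ?_
    gcongr
    have h1 := le_abs_self C₀
    have h2 : 0 ≤ κ * (2 + |c|) := by positivity
    linarith
  · intro y hy
    rw [ball_eq_empty N hy]; simp
  · intro y _ hy1
    rw [abs_of_nonneg (Finset.sum_nonneg fun m _ => omega_nonneg m)]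
    have hl := Real.log_nonneg hy1
    have e1 := sum_omega_pow_le (N := N) y 1
    simp only [pow_one] at e1
    calc _ ≤ C₁ * y * (2 * Real.log y) := e1.trans (by gcongr; exact h₁ y (by linarith))
      _ = 2 * C₁ * (y * Real.log y) := by ring
      _ ≤ 2 * C₁ * (y * (1 + Real.log y) ^ 2) := by gcongr; nlinarith
      _ ≤ _ := by
        gcongr
        have h1 := abs_nonneg C₀
        have h2 : 0 ≤ κ * (2 + |c|) := by positivity
        linarith
  · intro x hx
    have hl := Real.log_nonneg (by linarith : 1 ≤ x)
    have hLL := one_le_loglog hx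
    have hLl := loglog_le hx
    have e1 : |Real.log (Real.log x) + c| ≤ (2 + |c|) * (1 + Real.log x) ^ 2 := by
      refine (abs_add_le _ _).trans ?_
      rw [abs_of_pos (by linarith)]
      have : 1 ≤ (1 + Real.log x) ^ 2 := one_le_pow₀ (by linarith)
      nlinarith [abs_nonneg c]
    rw [abs_mul, abs_of_pos hκ]
    calc _ ≤ κ * ((2 + |c|) * (1 + Real.log x) ^ 2) := by gcongr
      _ = κ * (2 + |c|) * (1 + Real.log x) ^ 2 := by ring
      _ ≤ _ := by
        gcongr
        have := abs_nonneg C₀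
        linarith
  · intro x D hx hD hDx
    obtain ⟨-, -, -, a4⟩ := log_div_bounds hx hD hDx
    have hlx : 0 < Real.log x := Real.log_pos (by linarith)
    have hlD := Real.log_nonneg hD
    rw [← mul_sub, add_sub_add_right_eq_sub, abs_mul, abs_of_pos hκ, mul_one_div]
    calc _ ≤ κ * (2 * (Real.log D / Real.log x)) := by gcongr
      _ = κ * 2 * (Real.log D / Real.log x) := by ring
      _ ≤ _ := by
        gcongr
        have h1 := abs_nonneg C₀
        have h2 : 0 ≤ κ * |c| := by positivity
        linarith
  · intro x D hx hD hDx
    obtain ⟨a1, a2, -, -⟩ := log_div_bounds hx hD hDx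
    have hlx : 0 < Real.log x := Real.log_pos (by linarith)
    have hlz : 0 < Real.log (x / D) := Real.log_pos (by linarith)
    rw [mul_one_div, div_le_div_iff₀ hlz hlx]
    linarith
  · intro x hx
    have hlx : 0 < Real.log x := Real.log_pos (by linarith)
    rw [one_div_mul_eq_div, one_le_div hlx]
    linarith

lemma exists_sum_mul_omega_sq_div_pow {h : ℕ} (hh : 2 ≤ h) {f : (P →₀ ℕ) → ℝ}
    (hf : ∀ d, |f d| ≤ (1 + omega d) ^ 2) {c c' C₀ : ℝ}
    (hW : ∀ y ∈ Y, 16 ≤ y →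
      |∑ m ∈ ball N y, omega m ^ 2 - κ * y * ((Real.log (Real.log y) + c) ^ 2 - Real.pi ^ 2 / 6
          + (Real.log (Real.log y) + c'))|
        ≤ C₀ * (y * (Real.log (Real.log y) / Real.log y))) :
    ∃ C, ∀ x ∈ Y, 256 ≤ x →
      |∑ d ∈ ball N x, f d * ∑ m ∈ ball N (x / size N d ^ h), omega m ^ 2
          - x * (κ * ((Real.log (Real.log x) + c) ^ 2 - Real.pi ^ 2 / 6
            + (Real.log (Real.log x) + c'))) * ∑' d, f d * (size N d ^ h)⁻¹|
        ≤ C * (x * (Real.log (Real.log x) / Real.log x)) := by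
  obtain ⟨C₁, hC₁, h₁⟩ := R.exists_count_le
  have hκ := R.kappa_pos
  set B := (1 + |c|) ^ 2 + Real.pi ^ 2 / 6 + (1 + |c'|) + (6 + 4 * |c|) with hB
  have hB0 : 0 ≤ B := by positivity
  have hb0 : 0 ≤ |C₀| + 4 * C₁ + κ * B := by positivity
  refine R.exists_sum_div_pow_sub_le hh (V := fun y => ∑ m ∈ ball N y, omega m ^ 2)
    (G := fun x => κ * ((Real.log (Real.log x) + c) ^ 2 - Real.pi ^ 2 / 6
            + (Real.log (Real.log x) + c')))
    (η := fun x => Real.log (Real.log x) / Real.log x) (C := |C₀| + 4 * C₁ + κ * B) hb0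
    ?_ ?_ ?_ ?_ ?_ ?_ ?_ hf
  · intro y hy hy16
    have hy0 : 0 < y := by linarith
    have hly : 0 < Real.log y := Real.log_pos (by linarith)
    have hLL := one_le_loglog hy16
    have e1 := hW y hy hy16
    rw [← mul_assoc y κ, mul_comm y κ]
    refine e1.trans ?_
    gcongr
    have h1 := le_abs_self C₀
    have h2 : 0 ≤ κ * B := by positivity
    linarith
  · intro y hy
    rw [ball_eq_empty N hy]; simp
  · intro y _ hy1
    rw [abs_of_nonneg (Finset.sum_nonneg fun m _ => pow_nonneg (omega_nonneg m) 2)]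
    have hl := Real.log_nonneg hy1
    have e1 := sum_omega_pow_le (N := N) y 2
    calc _ ≤ C₁ * y * (2 * Real.log y) ^ 2 := e1.trans (by gcongr; exact h₁ y (by linarith))
      _ = 4 * C₁ * (y * Real.log y ^ 2) := by ring
      _ ≤ 4 * C₁ * (y * (1 + Real.log y) ^ 2) := by gcongr; linarith
      _ ≤ _ := by
        gcongr
        have h1 := abs_nonneg C₀
        have h2 : 0 ≤ κ * B := by positivity
        linarith
  · intro x hx
    have hl := Real.log_nonneg (by linarith : 1 ≤ x)
    have hLL := one_le_loglog hx
    have hLl := loglog_le hx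
    set L := Real.log (Real.log x)
    set T := 1 + Real.log x with hT
    have hT1 : 1 ≤ T := by linarith
    have hLT : L ≤ T := by linarith
    have hTT : T ≤ T ^ 2 := by nlinarith
    have e0 : |L| = L := abs_of_pos (by linarith)
    have e1 : |(L + c) ^ 2| ≤ (1 + |c|) ^ 2 * T ^ 2 := by
      rw [abs_pow, ← mul_pow]
      have : |L + c| ≤ (1 + |c|) * T := by
        refine (abs_add_le _ _).trans ?_
        rw [e0]
        nlinarith [abs_nonneg c]
      gcongr
    have e2 : |L + c'| ≤ (1 + |c'|) * T ^ 2 := by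
      refine (abs_add_le _ _).trans ?_
      rw [e0]
      nlinarith [abs_nonneg c']
    have hpi : 0 ≤ Real.pi ^ 2 / 6 := by positivity
    have e3 : |(L + c) ^ 2 - Real.pi ^ 2 / 6 + (L + c')| ≤ B * T ^ 2 := by
      refine (abs_add_le _ _).trans ((add_le_add ((abs_sub _ _).trans
        (add_le_add e1 le_rfl)) e2).trans ?_)
      rw [abs_of_nonneg hpi, hB]
      have : 0 ≤ (6 + 4 * |c|) * T ^ 2 := by positivity
      nlinarith
    rw [abs_mul, abs_of_pos hκ]
    calc _ ≤ κ * (B * T ^ 2) := by gcongr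
      _ = κ * B * T ^ 2 := by ring
      _ ≤ _ := by
        gcongr
        have := abs_nonneg C₀
        linarith
  · intro x D hx hD hDx
    obtain ⟨a1, -, a3, a4⟩ := log_div_bounds hx hD hDx
    have hlx : 0 < Real.log x := Real.log_pos (by linarith)
    have hlD := Real.log_nonneg hD
    have hLL := one_le_loglog (by linarith : 16 ≤ x)
    have hLL' := one_le_loglog a1
    set L := Real.log (Real.log x)
    set L' := Real.log (Real.log (x / D))
    have e1 : (κ * ((L' + c) ^ 2 - Real.pi ^ 2 / 6 + (L' + c')))
        - κ * ((L + c) ^ 2 - Real.pi ^ 2 / 6 + (L + c'))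
        = κ * ((L' - L) * (L + L' + 2 * c + 1)) := by ring
    have e2 : |L + L' + 2 * c + 1| ≤ (3 + 2 * |c|) * L := by
      have h1 : |L + L' + 2 * c + 1| ≤ L + L' + 2 * |c| + 1 := by
        rw [abs_le]
        constructor <;> nlinarith [neg_abs_le c, le_abs_self c]
      nlinarith [abs_nonneg c]
    rw [e1, abs_mul, abs_of_pos hκ, abs_mul]
    calc _ ≤ κ * (2 * (Real.log D / Real.log x) * ((3 + 2 * |c|) * L)) := by gcongr
      _ = κ * (6 + 4 * |c|) * (Real.log D * (L / Real.log x)) := by ring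
      _ ≤ _ := by
        gcongr
        have h1 := abs_nonneg C₀
        have h2 : κ * (6 + 4 * |c|) ≤ κ * B := by
          gcongr
          rw [hB]
          have : 0 ≤ (1 + |c|) ^ 2 + Real.pi ^ 2 / 6 + (1 + |c'|) := by positivity
          linarith
        linarith
  · intro x D hx hD hDx
    obtain ⟨a1, a2, a3, -⟩ := log_div_bounds hx hD hDx
    have hlx : 0 < Real.log x := Real.log_pos (by linarith)
    have hlz : 0 < Real.log (x / D) := Real.log_pos (by linarith)
    have hLL := one_le_loglog (by linarith : 16 ≤ x)
    rw [← mul_div_assoc, div_le_div_iff₀ hlz hlx]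
    calc _ ≤ Real.log (Real.log x) * (2 * Real.log (x / D)) := by gcongr
      _ = _ := by ring
  · intro x hx
    have hlx : 0 < Real.log x := Real.log_pos (by linarith)
    have hLL := one_le_loglog hx
    rw [div_mul_eq_mul_div, one_le_div hlx]
    nlinarith

/-- The first moment, with the constants expressed by Dirichlet series of the Möbius function. -/
lemma exists_hFree_omega [Nonempty P] {h : ℕ} (hh : 2 ≤ h) {c D : ℝ}
    (hM : ∀ t, 2 ≤ t → |ppSum N (fun _ => 1) t - Real.log (Real.log t) - c| ≤ D / Real.log t) :
    ∃ C, ∀ x ∈ Y, 256 ≤ x →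
      |∑ m ∈ (ball N x).filter (IsHFree h), omega m
        - x * κ * ((Real.log (Real.log x) + c) * mobSum N h 0 + h * mobSum N h 1)|
        ≤ C * (x * (1 / Real.log x)) := by
  obtain ⟨C₀, h₀⟩ := R.exists_sum_omega_sub_le hM
  obtain ⟨C₁, h₁⟩ := R.exists_sum_mul_omega_div_pow hh
    (fun d => abs_mob_mul_omega_le d (j := 0) (by omega)) h₀
  obtain ⟨C₂, h₂⟩ := R.exists_sum_mul_count_div_pow hh
    (fun d => abs_mob_mul_omega_le d (j := 1) (by omega))
  refine ⟨C₁ + h * C₂, fun x hx hx1 => ?_⟩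
  have e1 := h₁ x hx hx1
  have e2 := h₂ x hx hx1
  simp only [← mobSum.eq_1] at e1 e2
  have e3 : ∑ m ∈ (ball N x).filter (IsHFree h), omega m
      = ∑ d ∈ ball N x, mob d * omega d ^ 0 * ∑ m ∈ ball N (x / size N d ^ h), omega m
        + h * ∑ d ∈ ball N x, mob d * omega d ^ 1 * count N (x / size N d ^ h) := by
    rw [sum_hFree N (by omega), Finset.mul_sum, ← Finset.sum_add_distrib]
    refine Finset.sum_congr rfl fun d _ => ?_
    simp only [omega_add, omega_nsmul, Finset.sum_add_distrib, Finset.sum_const, nsmul_eq_mul,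
      count]
    ring
  set S₁ := ∑ d ∈ ball N x, mob d * omega d ^ 0 * ∑ m ∈ ball N (x / size N d ^ h), omega m
  set S₂ := ∑ d ∈ ball N x, mob d * omega d ^ 1 * count N (x / size N d ^ h)
  rw [e3]
  calc _ = |(S₁ - x * (κ * (Real.log (Real.log x) + c)) * mobSum N h 0)
        + h * (S₂ - x * κ * mobSum N h 1)| := by congr 1; ring
    _ ≤ C₁ * (x * (1 / Real.log x)) + h * (C₂ * (x * (1 / Real.log x))) := by
        refine (abs_add_le _ _).trans (add_le_add e1 ?_)
        rw [abs_mul, Nat.abs_cast]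
        gcongr
    _ = _ := by ring

/-- The second moment, with the constants expressed by Dirichlet series of the Möbius function. -/
lemma exists_hFree_omega_sq [Nonempty P] {h : ℕ} (hh : 2 ≤ h) {c c' D D' : ℝ}
    (hM : ∀ t, 2 ≤ t → |ppSum N (fun _ => 1) t - Real.log (Real.log t) - c| ≤ D / Real.log t)
    (hM' : ∀ t, 2 ≤ t →
      |ppSum N (fun k => k + 1) t - Real.log (Real.log t) - c'| ≤ D' / Real.log t) :
    ∃ C, ∀ x ∈ Y, 256 ≤ x →
      |∑ m ∈ (ball N x).filter (IsHFree h), omega m ^ 2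
        - x * κ * (((Real.log (Real.log x) + c) ^ 2 - Real.pi ^ 2 / 6
              + (Real.log (Real.log x) + c')) * mobSum N h 0
            + 2 * h * (Real.log (Real.log x) + c) * mobSum N h 1 + h ^ 2 * mobSum N h 2)|
        ≤ C * (x * (Real.log (Real.log x) / Real.log x)) := by
  obtain ⟨C₀, h₀⟩ := R.exists_sum_omega_sub_le hM
  obtain ⟨C₀', h₀'⟩ := R.exists_sum_omega_sq_sub_le hM hM'
  obtain ⟨C₁, h₁⟩ := R.exists_sum_mul_omega_sq_div_pow hh
    (fun d => abs_mob_mul_omega_le d (j := 0) (by omega)) h₀'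
  obtain ⟨C₂, h₂⟩ := R.exists_sum_mul_omega_div_pow hh
    (fun d => abs_mob_mul_omega_le d (j := 1) (by omega)) h₀
  obtain ⟨C₃, h₃⟩ := R.exists_sum_mul_count_div_pow hh
    (fun d => abs_mob_mul_omega_le d (j := 2) (by omega))
  refine ⟨C₁ + 2 * h * |C₂| + h ^ 2 * |C₃|, fun x hx hx1 => ?_⟩
  have e1 := h₁ x hx hx1
  have e2 := h₂ x hx hx1
  have e3 := h₃ x hx hx1
  simp only [← mobSum.eq_1] at e1 e2 e3
  have hx0 : 0 < x := by linarith
  have hlx : 0 < Real.log x := Real.log_pos (by linarith)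
  have hLL := one_le_loglog (by linarith : 16 ≤ x)
  have hr : x * (1 / Real.log x) ≤ x * (Real.log (Real.log x) / Real.log x) := by gcongr
  have hr0 : 0 ≤ x * (1 / Real.log x) := by positivity
  have e4 : ∑ m ∈ (ball N x).filter (IsHFree h), omega m ^ 2
      = ∑ d ∈ ball N x, mob d * omega d ^ 0 * ∑ m ∈ ball N (x / size N d ^ h), omega m ^ 2
        + 2 * h * ∑ d ∈ ball N x, mob d * omega d ^ 1 * ∑ m ∈ ball N (x / size N d ^ h), omega m
        + h ^ 2 * ∑ d ∈ ball N x, mob d * omega d ^ 2 * count N (x / size N d ^ h) := by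
    rw [sum_hFree N (by omega), Finset.mul_sum, Finset.mul_sum, ← Finset.sum_add_distrib,
      ← Finset.sum_add_distrib]
    refine Finset.sum_congr rfl fun d _ => ?_
    have : ∀ m, omega (m + h • d) ^ 2
        = omega m ^ 2 + 2 * h * omega d * omega m + h ^ 2 * omega d ^ 2 := fun m => by
      rw [omega_add, omega_nsmul]; ring
    simp only [this, Finset.sum_add_distrib, Finset.sum_const, nsmul_eq_mul, count,
      ← Finset.mul_sum]
    ring
  set S₁ := ∑ d ∈ ball N x, mob d * omega d ^ 0 * ∑ m ∈ ball N (x / size N d ^ h), omega m ^ 2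
  set S₂ := ∑ d ∈ ball N x, mob d * omega d ^ 1 * ∑ m ∈ ball N (x / size N d ^ h), omega m
  set S₃ := ∑ d ∈ ball N x, mob d * omega d ^ 2 * count N (x / size N d ^ h)
  set L := Real.log (Real.log x)
  set η := x * (L / Real.log x)
  rw [e4]
  calc _ = |(S₁ - x * (κ * ((L + c) ^ 2 - Real.pi ^ 2 / 6 + (L + c'))) * mobSum N h 0)
        + 2 * h * (S₂ - x * (κ * (L + c)) * mobSum N h 1)
        + h ^ 2 * (S₃ - x * κ * mobSum N h 2)| := by congr 1; ring
    _ ≤ C₁ * η + 2 * h * (|C₂| * η) + h ^ 2 * (|C₃| * η) := by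
        refine (abs_add_le _ _).trans (add_le_add ((abs_add_le _ _).trans (add_le_add e1 ?_)) ?_)
        · rw [abs_mul, abs_of_nonneg (by positivity : (0 : ℝ) ≤ 2 * h)]
          gcongr
          refine e2.trans ((mul_le_mul_of_nonneg_right (le_abs_self _) hr0).trans ?_)
          gcongr
        · rw [abs_mul, abs_of_nonneg (by positivity : (0 : ℝ) ≤ (h : ℝ) ^ 2)]
          gcongr
          refine e3.trans ((mul_le_mul_of_nonneg_right (le_abs_self _) hr0).trans ?_)
          gcongr
    _ = _ := by ring

end Regular

end

section

/-! ### Evaluation of the constants -/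

variable {P : Type*} {N : P → ℕ} [NormFinite N] {Y : Set ℝ} {κ θ K : ℝ}

/-- A truncation of a double series `∑ F (i, m)` to `s i * N(m) ≤ n` recovers its sum. -/
lemma tendsto_sum_truncation {ι : Type*} (s : ι → ℝ) (B : ℕ → Finset ι)
    (hB : ∀ n i, i ∈ B n ↔ s i ≤ n) (hs : ∀ i, 0 < s i)
    {F : ι × (P →₀ ℕ) → ℝ} {a : ℝ} (hF : HasSum F a) :
    Tendsto (fun n : ℕ => ∑ i ∈ B n, ∑ m ∈ ball N (n / s i), F (i, m)) atTop (𝓝 a) := by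
  set T : ℕ → Finset (ι × (P →₀ ℕ)) := fun n =>
    (B n).biUnion fun i => (ball N (n / s i)).map ⟨fun m => (i, m), Prod.mk_right_injective i⟩
    with hT
  have memT : ∀ n x, x ∈ T n ↔ s x.1 ≤ n ∧ s x.1 * size N x.2 ≤ n := by
    rintro n ⟨i, m⟩
    simp only [hT, Finset.mem_biUnion, Finset.mem_map, Function.Embedding.coeFn_mk, mem_ball,
      Prod.mk.injEq, hB]
    constructor
    · rintro ⟨i, hi, m, hm, rfl, rfl⟩
      exact ⟨hi, by rwa [le_div_iff₀' (hs i)] at hm⟩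
    · rintro ⟨h1, h2⟩
      exact ⟨i, h1, m, by rwa [le_div_iff₀' (hs i)], rfl, rfl⟩
  have hTt : Tendsto T atTop atTop := by
    refine tendsto_atTop_finset_of_monotone (fun n n' hn x hx => ?_) fun x => ?_
    · rw [memT] at hx ⊢
      have : (n : ℝ) ≤ n' := by exact_mod_cast hn
      exact ⟨hx.1.trans this, hx.2.trans this⟩
    · obtain ⟨n, hn⟩ := exists_nat_ge (max (s x.1) (s x.1 * size N x.2))
      exact ⟨n, (memT _ _).2 ⟨(le_max_left _ _).trans hn, (le_max_right _ _).trans hn⟩⟩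
  refine (hF.comp hTt).congr fun n => ?_
  simp only [Function.comp, hT]
  rw [Finset.sum_biUnion]
  · simp
  · intro i _ j _ hij
    rw [Function.onFun, Finset.disjoint_left]
    intro x hx hx'
    simp only [Finset.mem_map, Function.Embedding.coeFn_mk] at hx hx'
    obtain ⟨_, _, rfl⟩ := hx
    obtain ⟨_, _, h⟩ := hx'
    exact hij (Prod.ext_iff.1 h).1.symm

/-- Möbius inversion for absolutely convergent sums. -/
lemma eq_of_hasSum_mob {g : (P →₀ ℕ) → ℝ} {a : ℝ}
    (h : HasSum (fun x : (P →₀ ℕ) × (P →₀ ℕ) => mob x.1 * g (x.2 + x.1)) a) (N : P → ℕ)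
    [NormFinite N] : a = g 0 := by
  have h1 := tendsto_sum_truncation (N := N) (size N) (fun n => ball N n) (fun n i => mem_ball)
    (size_pos N) h
  refine tendsto_nhds_unique h1 (tendsto_const_nhds.congr' ?_)
  filter_upwards [eventually_ge_atTop 1] with n hn
  simp only [← Finset.mul_sum]
  exact (sum_mob_mul N g (by exact_mod_cast hn)).symm

/-- The expansion of `omega` over prime powers, for absolutely convergent sums. -/
lemma eq_of_hasSum_omega {g : (P →₀ ℕ) → ℝ} {a b : ℝ} (h : HasSum (fun m => omega m * g m) a)
    (h' : HasSum (fun x : (P × ℕ) × (P →₀ ℕ) => g (x.2 + primePow x.1)) b) (N : P → ℕ)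
    [NormFinite N] : a = b := by
  have h1 := tendsto_sum_truncation (N := N) (ppSize N) (fun n => ppBall N n)
    (fun n i => mem_ppBall) (ppSize_pos N) h'
  have hT : Tendsto (fun n : ℕ => ball N n) atTop atTop := by
    refine tendsto_atTop_finset_of_monotone (fun n n' hn => ball_mono N (by exact_mod_cast hn))
      fun m => ?_
    obtain ⟨n, hn⟩ := exists_nat_ge (size N m)
    exact ⟨n, mem_ball.2 hn⟩
  refine tendsto_nhds_unique (h.comp hT) (h1.congr fun n => ?_)
  exact (sum_omega_mul N g n).symm

lemma hasSum_mul_of_summable {ι ι' : Type*} {f : ι → ℝ} {g : ι' → ℝ} (hf : Summable f)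
    (hg : Summable g) :
    HasSum (fun x : ι × ι' => f x.1 * g x.2) ((∑' i, f i) * ∑' j, g j) :=
  hf.hasSum.mul hg.hasSum (summable_mul_of_summable_norm hf.norm hg.norm)

variable (N) in
/-- The series `∑ Ω(m) ^ j / N(m) ^ h`. -/
def omegaZeta (h j : ℕ) : ℝ := ∑' m, omega m ^ j * (size N m ^ h)⁻¹

variable (N) in
/-- The series `∑ j ^ i / N(p) ^ (j h)` over the prime powers with exponent `j ≥ 1`. -/
def ppZeta (h i : ℕ) : ℝ := ∑' q : P × ℕ, ((q.2 : ℝ) + 1) ^ i * (ppSize N q ^ h)⁻¹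

lemma zeta_eq (h : ℕ) : zeta N h = omegaZeta N h 0 := by
  unfold zeta omegaZeta
  refine tsum_congr fun m => ?_
  change size N m ^ (-(h : ℝ)) = _
  rw [pow_zero, one_mul, Real.rpow_neg (size_pos N m).le, Real.rpow_natCast]

namespace Regular

variable (R : Regular N Y κ θ K)
include R

lemma summable_of_abs_le_omega {h : ℕ} (hh : 2 ≤ h) {f : (P →₀ ℕ) → ℝ}
    (hf : ∀ d, |f d| ≤ (1 + omega d) ^ 2) : Summable fun d => f d * (size N d ^ h)⁻¹ := by
  have hh' : (2 : ℝ) ≤ h := by exact_mod_cast hh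
  refine Summable.of_norm_bounded (R.summable_omega_mul (s := h) (by linarith)) fun d => ?_
  have h0 := size_pos N d
  rw [Real.norm_eq_abs, abs_mul, abs_of_pos (by positivity : 0 < (size N d ^ h)⁻¹),
    Real.rpow_neg h0.le, Real.rpow_natCast]
  gcongr
  exact hf d

lemma summable_mob_omega {h j : ℕ} (hh : 2 ≤ h) (hj : j ≤ 2) :
    Summable fun d => mob d * omega d ^ j * (size N d ^ h)⁻¹ :=
  R.summable_of_abs_le_omega hh fun d => abs_mob_mul_omega_le d hj

lemma summable_omega {h j : ℕ} (hh : 2 ≤ h) (hj : j ≤ 2) :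
    Summable fun d => omega d ^ j * (size N d ^ h)⁻¹ := by
  refine R.summable_of_abs_le_omega hh fun d => ?_
  have h0 := omega_nonneg d
  rw [abs_of_nonneg (pow_nonneg h0 j)]
  calc omega d ^ j ≤ (1 + omega d) ^ j := by gcongr; linarith
    _ ≤ (1 + omega d) ^ 2 := pow_le_pow_right₀ (by linarith) hj

lemma summable_ppZeta {h i : ℕ} (hh : 2 ≤ h) (hi : i ≤ 1) :
    Summable fun q : P × ℕ => ((q.2 : ℝ) + 1) ^ i * (ppSize N q ^ h)⁻¹ := by
  have hr : ‖(1 / 4 : ℝ)‖ < 1 := by norm_num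
  have h1 : Summable fun k : ℕ => ((k : ℝ) + 1) * (1 / 4 : ℝ) ^ k := by
    have a1 := summable_pow_mul_geometric_of_norm_lt_one 1 hr
    have a2 := summable_geometric_of_norm_lt_one hr
    refine (a1.add a2).congr fun k => ?_
    rw [pow_one]; ring
  have h2 := (R.summable_prime_rpow (s := 2) (by norm_num)).mul_of_nonneg h1
    (fun p => by positivity) (fun k => by positivity)
  refine Summable.of_nonneg_of_le (fun q => ?_) (fun q => ?_) h2
  · have := ppSize_pos N q; positivity
  · have hp := two_le_cast N q.1
    have hp0 : (0 : ℝ) < N q.1 := by linarith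
    have hq := two_le_ppSize N q
    have e1 : (ppSize N q ^ h)⁻¹ ≤ (ppSize N q ^ 2)⁻¹ := by
      gcongr
      linarith
    have e2 : (ppSize N q ^ 2)⁻¹ = (N q.1 : ℝ) ^ (-2 : ℝ) * (((N q.1 : ℝ) ^ 2)⁻¹) ^ q.2 := by
      rw [ppSize, Real.rpow_neg hp0.le, Real.rpow_two, ← inv_pow, ← inv_pow, ← inv_pow]
      ring
    have e3 : ((N q.1 : ℝ) ^ 2)⁻¹ ≤ 1 / 4 := by
      rw [inv_le_comm₀ (by positivity) (by norm_num)]; norm_num; nlinarith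
    calc _ ≤ ((q.2 : ℝ) + 1) ^ 1 * (ppSize N q ^ 2)⁻¹ := by
          gcongr
          linarith
      _ ≤ ((q.2 : ℝ) + 1) * ((N q.1 : ℝ) ^ (-2 : ℝ) * (1 / 4) ^ q.2) := by
          rw [e2, pow_one]; gcongr
      _ = _ := by ring

lemma omegaZeta_zero_pos {h : ℕ} (hh : 2 ≤ h) : 0 < omegaZeta N h 0 := by
  refine (R.summable_omega hh (by omega)).tsum_pos (fun m => ?_) 0 ?_
  · have := size_pos N m; positivity
  · simp [size_zero]

/-- The first two derivatives at `z = 1` of the series `∑ z ^ Ω(m) / N(m) ^ h`, in terms of sums over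
prime powers. The first relation expresses the logarithmic derivative of the Euler product. -/
lemma omegaZeta_eq {h : ℕ} (hh : 2 ≤ h) :
    omegaZeta N h 1 = ppZeta N h 0 * omegaZeta N h 0 ∧
      omegaZeta N h 2 = ppZeta N h 0 * omegaZeta N h 1 + ppZeta N h 1 * omegaZeta N h 0 := by
  have z0 := R.summable_omega hh (j := 0) (by omega)
  have z1 := R.summable_omega hh (j := 1) (by omega)
  have z2 := R.summable_omega hh (j := 2) (by omega)
  have p0 := R.summable_ppZeta hh (i := 0) (by omega)
  have p1 := R.summable_ppZeta hh (i := 1) (by omega)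
  constructor
  · refine eq_of_hasSum_omega (g := fun m => (size N m ^ h)⁻¹) ?_ ?_ N
    · exact z1.hasSum.congr_fun fun m => by rw [pow_one]
    · refine (hasSum_mul_of_summable p0 z0).congr_fun fun x => ?_
      rw [size_add, size_primePow, mul_pow, mul_inv]; ring
  · refine eq_of_hasSum_omega (g := fun m => omega m * (size N m ^ h)⁻¹) ?_ ?_ N
    · refine z2.hasSum.congr_fun fun m => by ring
    · refine ((hasSum_mul_of_summable p0 z1).add (hasSum_mul_of_summable p1 z0)).congr_fun
        fun x => ?_
      rw [size_add, size_primePow, omega_add, omega_primePow, mul_pow, mul_inv]; ring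

/-- The Möbius series, from the relations between the derivatives of a series and of its inverse. -/
lemma mobSum_eq {h : ℕ} (hh : 2 ≤ h) :
    mobSum N h 0 = 1 / omegaZeta N h 0 ∧
      mobSum N h 1 = -ppZeta N h 0 / omegaZeta N h 0 ∧
      mobSum N h 2 = (ppZeta N h 0 ^ 2 - ppZeta N h 1) / omegaZeta N h 0 := by
  have z0 := R.summable_omega hh (j := 0) (by omega)
  have z1 := R.summable_omega hh (j := 1) (by omega)
  have z2 := R.summable_omega hh (j := 2) (by omega)
  have m0 := R.summable_mob_omega hh (j := 0) (by omega)
  have m1 := R.summable_mob_omega hh (j := 1) (by omega)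
  have m2 := R.summable_mob_omega hh (j := 2) (by omega)
  have hz := R.omegaZeta_zero_pos hh
  obtain ⟨hz1, hz2⟩ := R.omegaZeta_eq hh
  have e0 : mobSum N h 0 * omegaZeta N h 0 = (size N (0 : P →₀ ℕ) ^ h)⁻¹ := by
    refine eq_of_hasSum_mob (g := fun m => (size N m ^ h)⁻¹) ?_ N
    refine (hasSum_mul_of_summable m0 z0).congr_fun fun x => ?_
    rw [size_add, mul_pow, mul_inv]; ring
  have e1 : mobSum N h 1 * omegaZeta N h 0 + mobSum N h 0 * omegaZeta N h 1
      = omega (0 : P →₀ ℕ) * (size N (0 : P →₀ ℕ) ^ h)⁻¹ := by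
    refine eq_of_hasSum_mob (g := fun m => omega m * (size N m ^ h)⁻¹) ?_ N
    refine ((hasSum_mul_of_summable m1 z0).add (hasSum_mul_of_summable m0 z1)).congr_fun
      fun x => ?_
    rw [size_add, omega_add, mul_pow, mul_inv]; ring
  have e2 : mobSum N h 2 * omegaZeta N h 0 + 2 * (mobSum N h 1 * omegaZeta N h 1)
        + mobSum N h 0 * omegaZeta N h 2
      = omega (0 : P →₀ ℕ) ^ 2 * (size N (0 : P →₀ ℕ) ^ h)⁻¹ := by
    refine eq_of_hasSum_mob (g := fun m => omega m ^ 2 * (size N m ^ h)⁻¹) ?_ N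
    refine (((hasSum_mul_of_summable m2 z0).add ((hasSum_mul_of_summable m1 z1).mul_left 2)).add
      (hasSum_mul_of_summable m0 z2)).congr_fun fun x => ?_
    rw [size_add, omega_add, mul_pow, mul_inv]; ring
  simp only [size_zero, omega_zero, one_pow, inv_one, zero_mul, ne_eq, OfNat.ofNat_ne_zero,
    not_false_eq_true, zero_pow] at e0 e1 e2
  rw [hz1] at e1 e2
  rw [hz2, hz1] at e2
  set Z := omegaZeta N h 0
  have f0 : mobSum N h 0 = 1 / Z := by rw [eq_div_iff hz.ne']; exact e0
  have f1 : mobSum N h 1 = -ppZeta N h 0 / Z := by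
    rw [eq_div_iff hz.ne']
    rw [f0] at e1
    field_simp at e1
    linarith
  refine ⟨f0, f1, ?_⟩
  rw [eq_div_iff hz.ne']
  rw [f0, f1] at e2
  field_simp at e2
  linarith

end Regular

end

section

/-! ### The constants as sums over prime elements -/

lemma hasSum_geometric_succ {r : ℝ} (h0 : 0 ≤ r) (h1 : r < 1) :
    HasSum (fun k : ℕ => r ^ (k + 1)) (r / (1 - r)) := by
  have := (hasSum_geometric_of_lt_one h0 h1).mul_left r
  rw [div_eq_mul_inv]
  exact this.congr_fun fun k => pow_succ' r k

lemma hasSum_mul_geometric_succ {r : ℝ} (h0 : 0 ≤ r) (h1 : r < 1) :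
    HasSum (fun k : ℕ => ((k : ℝ) + 1) * r ^ (k + 1)) (r / (1 - r) ^ 2) := by
  have h := hasSum_coe_mul_geometric_of_norm_lt_one (r := r)
    (by rwa [Real.norm_eq_abs, abs_of_nonneg h0])
  have h' := (hasSum_nat_add_iff' 1).2 h
  simpa using h'

/-- Summation of a double series over the second index first. -/
lemma hasSum_of_fiber {P : Type*} {f : P × ℕ → ℝ} {g : P → ℝ} (hf : Summable f)
    (hg : ∀ p, HasSum (fun k => f (p, k)) (g p)) : HasSum g (∑' q, f q) :=
  hf.hasSum.prod_fiberwise hg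

section terms

variable {n : ℝ} {h : ℕ}

lemma one_lt_pow_of_two_le (hn : 2 ≤ n) (hh : 2 ≤ h) : 1 < n ^ h :=
  one_lt_pow₀ (by linarith) (by omega)

lemma termC3_eq (hn : 2 ≤ n) (hh : 2 ≤ h) :
    termC3 h n = 1 / (n * (n - 1)) - h * (1 / (n ^ h - 1)) := by
  have h1 := one_lt_pow_of_two_le hn hh
  have h2 : n ^ h - 1 ≠ 0 := by linarith
  have h3 : n - 1 ≠ 0 := by linarith
  have h4 : n ≠ 0 := by linarith
  unfold termC3
  generalize n ^ h = a at *
  field_simp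
  ring

lemma termC4_eq (hn : 2 ≤ n) (hh : 2 ≤ h) :
    termC4 h n = (1 / (n - 1) - h * (1 / (n ^ h - 1))) ^ 2 := by
  have h1 := one_lt_pow_of_two_le hn hh
  have h2 : n ^ h - 1 ≠ 0 := by linarith
  have h3 : n - 1 ≠ 0 := by linarith
  unfold termC4
  generalize n ^ h = a at *
  congr 1
  field_simp
  ring

lemma termC3'_eq (hn : 2 ≤ n) (hh : 2 ≤ h) :
    termC3' h n = termC4 h n + (n / (n - 1) ^ 2 - 1 / n)
      - h ^ 2 * (n ^ h / (n ^ h - 1) ^ 2) := by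
  have h1 := one_lt_pow_of_two_le hn hh
  have h2 : n ^ h - 1 ≠ 0 := by linarith
  have h3 : n - 1 ≠ 0 := by linarith
  have h4 : n ≠ 0 := by linarith
  rw [termC4_eq hn hh]
  unfold termC3'
  generalize n ^ h = a at *
  field_simp
  ring

lemma termC4_le (hn : 2 ≤ n) (hh : 2 ≤ h) :
    termC4 h n ≤ (2 + 2 * h) ^ 2 * n ^ (-2 : ℝ) := by
  have hn0 : 0 < n := by linarith
  have h1 : n ^ 2 ≤ n ^ h := pow_le_pow_right₀ (by linarith) hh
  have e1 : 1 / (n - 1) ≤ 2 * n⁻¹ := by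
    rw [← div_eq_mul_inv, div_le_div_iff₀ (by linarith) hn0]; linarith
  have e2 : 1 / (n ^ h - 1) ≤ 2 * n⁻¹ := by
    rw [← div_eq_mul_inv, div_le_div_iff₀ (by nlinarith) hn0]; nlinarith
  have e3 : 0 ≤ 1 / (n - 1) := by apply div_nonneg <;> linarith
  have e4 : 0 ≤ 1 / (n ^ h - 1) := by
    have := one_lt_pow_of_two_le hn hh
    apply div_nonneg <;> linarith
  have hh0 : (0 : ℝ) ≤ h := by positivity
  rw [termC4_eq hn hh, Real.rpow_neg hn0.le, Real.rpow_two, ← inv_pow, ← mul_pow, sq_le_sq,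
    abs_of_nonneg (by positivity : 0 ≤ (2 + 2 * (h : ℝ)) * n⁻¹), abs_le]
  have e5 := mul_le_mul_of_nonneg_left e2 hh0
  have e6 := mul_nonneg hh0 e4
  have e7 : 0 ≤ n⁻¹ := by positivity
  have e8 := mul_nonneg hh0 e7
  constructor <;> nlinarith

end terms

namespace Regular

variable {P : Type*} {N : P → ℕ} [NormFinite N] {Y : Set ℝ} {κ θ K : ℝ}
variable (R : Regular N Y κ θ K)
include R

lemma hasSum_ppZeta_zero {h : ℕ} (hh : 2 ≤ h) :
    HasSum (fun p => 1 / ((N p : ℝ) ^ h - 1)) (ppZeta N h 0) := by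
  refine hasSum_of_fiber (R.summable_ppZeta hh (by omega)) fun p => ?_
  have h1 := one_lt_pow_of_two_le (two_le_cast N p) hh
  have h2 := hasSum_geometric_succ (r := ((N p : ℝ) ^ h)⁻¹) (by positivity) (inv_lt_one_of_one_lt₀ h1)
  have h3 : (N p : ℝ) ^ h - 1 ≠ 0 := by linarith
  have h4 : (N p : ℝ) ^ h ≠ 0 := by linarith
  convert h2 using 1
  · ext k
    simp only [pow_zero, one_mul, ppSize]
    rw [inv_pow, ← pow_mul, ← pow_mul, mul_comm]
  · field_simp

lemma hasSum_ppZeta_one {h : ℕ} (hh : 2 ≤ h) :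
    HasSum (fun p => (N p : ℝ) ^ h / ((N p : ℝ) ^ h - 1) ^ 2) (ppZeta N h 1) := by
  refine hasSum_of_fiber (R.summable_ppZeta hh (by omega)) fun p => ?_
  have h1 := one_lt_pow_of_two_le (two_le_cast N p) hh
  have h2 := hasSum_mul_geometric_succ (r := ((N p : ℝ) ^ h)⁻¹) (by positivity)
    (inv_lt_one_of_one_lt₀ h1)
  have h3 : (N p : ℝ) ^ h - 1 ≠ 0 := by linarith
  have h4 : (N p : ℝ) ^ h ≠ 0 := by linarith
  convert h2 using 1
  · ext k
    simp only [pow_one, ppSize]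
    rw [inv_pow, ← pow_mul, ← pow_mul, mul_comm h]
  · field_simp

lemma hasSum_higher_one :
    HasSum (fun p => 1 / ((N p : ℝ) * (N p - 1)))
      (∑' q : P × ℕ, (1 : ℝ) * (ppSize N (q.1, q.2 + 1))⁻¹) := by
  refine hasSum_of_fiber
    (R.summable_weight (v := fun _ => 1) fun k => by rw [abs_one]; linarith [k.cast_nonneg (α := ℝ)])
    fun p => ?_
  have h1 := two_le_cast N p
  have h2 := (hasSum_geometric_succ (r := (N p : ℝ)⁻¹) (by positivity)
    (inv_lt_one_of_one_lt₀ (by linarith))).mul_left (N p : ℝ)⁻¹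
  have h3 : (N p : ℝ) - 1 ≠ 0 := by linarith
  have h4 : (N p : ℝ) ≠ 0 := by linarith
  have e : 1 / ((N p : ℝ) * (N p - 1)) = (N p : ℝ)⁻¹ * ((N p : ℝ)⁻¹ / (1 - (N p : ℝ)⁻¹)) := by
    field_simp
  rw [e]
  refine h2.congr_fun fun k => ?_
  rw [← pow_succ', inv_pow, one_mul]
  rfl

lemma hasSum_higher_succ :
    HasSum (fun p => (N p : ℝ) / (N p - 1) ^ 2 - 1 / N p)
      (∑' q : P × ℕ, (((q.2 + 1 : ℕ) : ℝ) + 1) * (ppSize N (q.1, q.2 + 1))⁻¹) := by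
  refine hasSum_of_fiber
    (R.summable_weight (v := fun k => k + 1) fun k => (abs_of_nonneg (by positivity)).le)
    fun p => ?_
  have h1 := two_le_cast N p
  have h2 := (hasSum_nat_add_iff' 1).2 (hasSum_mul_geometric_succ (r := (N p : ℝ)⁻¹)
    (by positivity) (inv_lt_one_of_one_lt₀ (by linarith)))
  have h3 : (N p : ℝ) - 1 ≠ 0 := by linarith
  have h4 : (N p : ℝ) ≠ 0 := by linarith
  have e : (N p : ℝ) / (N p - 1) ^ 2 - 1 / N p = (N p : ℝ)⁻¹ / (1 - (N p : ℝ)⁻¹) ^ 2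
      - ∑ k ∈ Finset.range 1, ((k : ℝ) + 1) * (N p : ℝ)⁻¹ ^ (k + 1) := by
    rw [Finset.sum_range_one, Nat.cast_zero, zero_add, one_mul, pow_one]
    field_simp
  rw [e]
  refine h2.congr_fun fun k => ?_
  rw [inv_pow]
  rfl

lemma hasSum_termC3 {h : ℕ} (hh : 2 ≤ h) :
    HasSum (fun p => termC3 h (N p))
      ((∑' q : P × ℕ, (1 : ℝ) * (ppSize N (q.1, q.2 + 1))⁻¹) - h * ppZeta N h 0) :=
  (R.hasSum_higher_one.sub ((R.hasSum_ppZeta_zero hh).mul_left (h : ℝ))).congr_fun fun p =>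
    termC3_eq (two_le_cast N p) hh

lemma summable_termC4 {h : ℕ} (hh : 2 ≤ h) : Summable fun p => termC4 h (N p) :=
  Summable.of_nonneg_of_le (fun p => sq_nonneg _) (fun p => termC4_le (two_le_cast N p) hh)
    ((R.summable_prime_rpow (s := 2) (by norm_num)).mul_left _)

lemma hasSum_termC3' {h : ℕ} (hh : 2 ≤ h) :
    HasSum (fun p => termC3' h (N p))
      ((∑' p, termC4 h (N p))
        + (∑' q : P × ℕ, (((q.2 + 1 : ℕ) : ℝ) + 1) * (ppSize N (q.1, q.2 + 1))⁻¹)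
        - h ^ 2 * ppZeta N h 1) :=
  (((R.summable_termC4 hh).hasSum.add R.hasSum_higher_succ).sub
    ((R.hasSum_ppZeta_one hh).mul_left _)).congr_fun fun p => termC3'_eq (two_le_cast N p) hh

end Regular

end

section

/-! ### Passage to real arguments -/

variable {P : Type*} {N : P → ℕ} {X : Set ℚ} {κ θ : ℝ}

lemma tendsto_cast_toInf (X : Set ℚ) : Tendsto (fun x : ℚ => (x : ℝ)) (toInf X) atTop :=
  (tendsto_ratCast_atTop_iff.2 tendsto_id).mono_left inf_le_left

/-- The counting hypothesis excludes that the counting function stays bounded by `1`, unless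
`X` is bounded. -/
lemma ConditionStar.toInf_eq_bot (hs : ConditionStar N X κ θ)
    (h : ∀ᶠ x in toInf X, (normLE N x).ncard ≤ 1) : toInf X = ⊥ := by
  obtain ⟨C, hC⟩ := hs.count.bound
  have hκ := hs.kappa_pos
  have h1 : Tendsto (fun x : ℚ => (x : ℝ) ^ (1 - θ)) (toInf X) atTop :=
    (tendsto_rpow_atTop (by linarith [hs.theta_lt_one])).comp (tendsto_cast_toInf X)
  rw [← eventually_false_iff_eq_bot]
  filter_upwards [h, hC, h1.eventually_gt_atTop ((1 + |C|) / κ),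
    (tendsto_cast_toInf X).eventually_ge_atTop 1] with x hx1 hx2 hx3 hx4
  have hx0 : (0 : ℝ) < x := by linarith
  have e1 : 1 ≤ (x : ℝ) ^ θ := Real.one_le_rpow hx4 hs.theta_nonneg
  rw [Real.norm_eq_abs, Real.norm_eq_abs, abs_of_nonneg (by linarith : 0 ≤ (x : ℝ) ^ θ)] at hx2
  rw [div_lt_iff₀ hκ] at hx3
  have e2 : (x : ℝ) = (x : ℝ) ^ (1 - θ) * (x : ℝ) ^ θ := by
    rw [← Real.rpow_add hx0]; simp
  have e3 : ((normLE N x).ncard : ℝ) ≤ 1 := by exact_mod_cast hx1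
  have e4 := (abs_le.1 hx2).1
  have e5 := mul_le_mul_of_nonneg_right (le_abs_self C) (by linarith : 0 ≤ (x : ℝ) ^ θ)
  have e6 := mul_lt_mul_of_pos_right hx3 (by linarith : 0 < (x : ℝ) ^ θ)
  nlinarith

lemma ConditionStar.toInf_neBot [Nonempty P] (hs : ConditionStar N X κ θ) (hN : ∀ p, 2 ≤ N p) :
    (toInf X).NeBot := by
  rw [toInf, inf_principal_neBot_iff]
  intro U hU
  obtain ⟨a, ha⟩ := mem_atTop_sets.1 hU
  obtain ⟨p⟩ := ‹Nonempty P›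
  have hp : (1 : ℚ) < N p := by exact_mod_cast hN p
  obtain ⟨k, hk⟩ := pow_unbounded_of_one_lt a hp
  have hm := hs.norm_mem (Finsupp.single p k)
  have e : (norm N (Finsupp.single p k) : ℚ) = (N p : ℚ) ^ k := by
    unfold norm
    rw [Finsupp.prod_single_index (h := fun p k => N p ^ k) (pow_zero _)]; push_cast; rfl
  exact ⟨_, ha _ hk.le, e ▸ hm⟩

lemma normLE_mono {x y : ℚ} (h : x ≤ y) : normLE N x ⊆ normLE N y := fun _ hm => le_trans hm h

lemma ConditionStar.finite_normLE [Nonempty P] (hs : ConditionStar N X κ θ)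
    (hN : ∀ p, 2 ≤ N p) (x : ℚ) : (normLE N x).Finite := by
  by_contra hinf
  have := hs.toInf_neBot hN
  refine this.ne (hs.toInf_eq_bot ?_)
  filter_upwards [(eventually_ge_atTop x).filter_mono inf_le_left] with y hy
  rw [Set.Infinite.ncard (Set.Infinite.mono (normLE_mono hy) hinf)]
  exact zero_le_one

lemma ConditionStar.normFinite [Nonempty P] (hs : ConditionStar N X κ θ) (hN : ∀ p, 2 ≤ N p) :
    NormFinite N where
  two_le := hN
  finite t := by
    refine (hs.finite_normLE hN ⌈t⌉).subset fun m hm => ?_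
    have h1 : (norm N m : ℝ) ≤ ⌈t⌉ := le_trans hm (Int.le_ceil t)
    change (norm N m : ℚ) ≤ (⌈t⌉ : ℤ)
    exact_mod_cast h1

variable [NormFinite N]

lemma coe_ball_cast (x : ℚ) : (ball N (x : ℝ) : Set (P →₀ ℕ)) = normLE N x := by
  ext m
  rw [Finset.mem_coe, mem_ball, normLE, Set.mem_ofPred_eq, size]
  exact_mod_cast Iff.rfl

lemma count_cast (x : ℚ) : count N (x : ℝ) = (normLE N x).ncard := by
  rw [← coe_ball_cast, Set.ncard_coe_finset]; rfl

lemma hFreeLE_eq (h : ℕ) (x : ℚ) :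
    hFreeLE N h x = ((ball N (x : ℝ)).filter (IsHFree h) : Finset (P →₀ ℕ)) := by
  ext m
  rw [Finset.coe_filter, hFreeLE, ← coe_ball_cast]
  exact and_comm

lemma mertensDiff_eq (x : ℚ) :
    mertensDiff N x = primeSum N (x : ℝ) - Real.log (Real.log x) := by
  unfold mertensDiff primeSum
  congr 1
  rw [← finsum_mem_coe_finset]
  have : {p : P | (N p : ℚ) ≤ x} = (primeBall N (x : ℝ) : Set P) := by
    ext p
    rw [Finset.mem_coe, mem_primeBall, Set.mem_ofPred_eq]
    exact_mod_cast Iff.rfl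
  rw [← this]
  simp only [one_div]
  rfl

/-- The positive elements of `X`, as real numbers. -/
def positivePart (X : Set ℚ) : Set ℝ := {y | 0 < y ∧ ∃ x ∈ X, (x : ℝ) = y}

/-- The counting hypothesis holds with a uniform constant for all positive arguments in `X`, once
`θ` is replaced by a positive exponent. -/
lemma exists_regular (hs : ConditionStar N X κ θ) :
    ∃ K, Regular N (positivePart X) κ (max θ (1 / 2)) K := by
  obtain ⟨C, hC⟩ := hs.count.bound
  rw [toInf, eventually_inf_principal, eventually_atTop] at hC
  obtain ⟨x₀, hx₀⟩ := hC
  set b : ℝ := max (x₀ : ℝ) 1 with hb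
  have hκ := hs.kappa_pos
  have hb0 := count_nonneg N b
  have hb1 : 1 ≤ b := le_max_right _ _
  refine ⟨|C| + (count N b + κ * b) + κ, ?_, ?_, ?_, hκ, ?_, ?_, ?_⟩
  · exact fun y hy => hy.1
  · exact fun m => ⟨size_pos N m, _, hs.norm_mem m, by simp [size]⟩
  · rintro x ⟨hx, x', hx', rfl⟩ y ⟨hy, y', hy', rfl⟩
    exact ⟨by positivity, _, hs.div_mem _ hx' _ hy', by push_cast; rfl⟩
  · exact lt_max_of_lt_right (by norm_num)
  · exact max_lt hs.theta_lt_one (by norm_num)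
  · rintro y ⟨hy, x, hx, rfl⟩
    have hpos : 0 < (x : ℝ) ^ max θ (1 / 2) := by positivity
    rcases lt_or_ge (x : ℝ) 1 with h1 | h1
    · have e0 : count N (x : ℝ) = 0 := by rw [count, ball_eq_empty N h1]; simp
      have e1 : (x : ℝ) ≤ (x : ℝ) ^ max θ (1 / 2) := by
        conv_lhs => rw [← Real.rpow_one (x : ℝ)]
        exact Real.rpow_le_rpow_of_exponent_ge hy h1.le (max_le hs.theta_lt_one.le (by norm_num))
      rw [e0, zero_sub, abs_neg, abs_of_pos (by positivity)]
      have e2 : 0 ≤ (|C| + (count N b + κ * b)) * (x : ℝ) ^ max θ (1 / 2) := by positivity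
      nlinarith [mul_le_mul_of_nonneg_left e1 hκ.le]
    · have e1 : 1 ≤ (x : ℝ) ^ max θ (1 / 2) :=
        Real.one_le_rpow h1 (le_max_of_le_right (by norm_num))
      rcases lt_or_ge (x : ℝ) b with h2 | h2
      · have e2 : count N (x : ℝ) ≤ count N b := count_mono N h2.le
        have e3 := count_nonneg N (x : ℝ)
        have e4 : |count N (x : ℝ) - κ * x| ≤ count N b + κ * b := by
          have := mul_le_mul_of_nonneg_left h2.le hκ.le
          have : 0 ≤ κ * x := by positivity
          rw [abs_le]; constructor <;> linarith
        have e5 : 0 ≤ (|C| + κ) * (x : ℝ) ^ max θ (1 / 2) := by positivity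
        have e6 : 0 ≤ count N b + κ * b := by positivity
        nlinarith [mul_le_mul_of_nonneg_left e1 e6]
      · have e2 := hx₀ x (by exact_mod_cast (le_max_left _ _).trans h2) hx
        rw [Real.norm_eq_abs, Real.norm_eq_abs, abs_of_nonneg (by positivity : 0 ≤ (x : ℝ) ^ θ),
          ← count_cast] at e2
        have e3 : (x : ℝ) ^ θ ≤ (x : ℝ) ^ max θ (1 / 2) :=
          Real.rpow_le_rpow_of_exponent_le h1 (le_max_left _ _)
        have e4 : C * (x : ℝ) ^ θ ≤ |C| * (x : ℝ) ^ max θ (1 / 2) :=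
          mul_le_mul (le_abs_self C) e3 (by positivity) (abs_nonneg C)
        have e5 : 0 ≤ (count N b + κ * b + κ) * (x : ℝ) ^ max θ (1 / 2) := by positivity
        linarith

end

section

/-! ### The asymptotic formulas along `X` -/

variable {P : Type*} {N : P → ℕ} [NormFinite N] {X : Set ℚ} {κ θ K : ℝ}

lemma tendsto_mertensDiff {A C : ℝ}
    (hA : ∀ t, 2 ≤ t → |primeSum N t - Real.log (Real.log t) - A| ≤ C / Real.log t) :
    Tendsto (mertensDiff N) (toInf X) (𝓝 A) := by
  have hcast := tendsto_cast_toInf X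
  rw [tendsto_iff_norm_sub_tendsto_zero]
  refine squeeze_zero' (Eventually.of_forall fun _ => norm_nonneg _) ?_
    ((tendsto_const_nhds (x := C)).div_atTop (Real.tendsto_log_atTop.comp hcast))
  filter_upwards [hcast.eventually_ge_atTop 2] with x hx
  rw [mertensDiff_eq]
  exact hA x hx

namespace Regular

variable [Nonempty P] (R : Regular N (positivePart X) κ θ K)
include R

/-- The moments in terms of the constant `A` in Mertens' theorem and sums over prime elements. -/
lemma isBigO_moments {h : ℕ} (hh : 2 ≤ h) {A : ℝ} (hA : constA N X = A) {C : ℝ}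
    (hM : ∀ t, 2 ≤ t → |primeSum N t - Real.log (Real.log t) - A| ≤ C / Real.log t) :
    (fun x : ℚ => (∑ᶠ m ∈ hFreeLE N h x, (bigOmega m : ℝ))
          - (κ / zeta N h * x * Real.log (Real.log x) + κ * constC3 N X h / zeta N h * x))
      =O[toInf X] (fun x : ℚ => (x : ℝ) / Real.log x) ∧
    (fun x : ℚ => (∑ᶠ m ∈ hFreeLE N h x, (bigOmega m : ℝ) ^ 2)
          - (κ / zeta N h * x * Real.log (Real.log x) ^ 2
            + κ * (2 * constC3 N X h + 1) / zeta N h * x * Real.log (Real.log x)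
            + κ * constC4 N X h / zeta N h * x))
      =O[toInf X] (fun x : ℚ => (x : ℝ) * Real.log (Real.log x) / Real.log x) := by
  obtain ⟨D, hD⟩ := R.exists_ppSum_sub_le (v := fun _ => 1) rfl
    (fun k => by rw [abs_one]; linarith [k.cast_nonneg (α := ℝ)]) hM
  obtain ⟨D', hD'⟩ := R.exists_ppSum_sub_le (v := fun k => k + 1) (by simp)
    (fun k => (abs_of_nonneg (by positivity)).le) hM
  have h3 : constC3 N X h = A + (∑' q : P × ℕ, (1 : ℝ) * (ppSize N (q.1, q.2 + 1))⁻¹)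
      - h * ppZeta N h 0 := by
    rw [constC3, hA, (R.hasSum_termC3 hh).tsum_eq]; ring
  have h4 : constC4 N X h = constC3 N X h ^ 2 - Real.pi ^ 2 / 6
      + (A + ∑' q : P × ℕ, (((q.2 + 1 : ℕ) : ℝ) + 1) * (ppSize N (q.1, q.2 + 1))⁻¹)
      - h ^ 2 * ppZeta N h 1 := by
    rw [constC4, constC3', constB, hA, (R.hasSum_termC3' hh).tsum_eq]; ring
  obtain ⟨C₁, h₁⟩ := R.exists_hFree_omega hh hD
  obtain ⟨C₂, h₂⟩ := R.exists_hFree_omega_sq hh hD hD'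
  obtain ⟨m0, m1, m2⟩ := R.mobSum_eq hh
  have hz := R.omegaZeta_zero_pos hh
  have hev : ∀ᶠ x : ℚ in toInf X, 256 ≤ (x : ℝ) ∧ (x : ℝ) ∈ positivePart X := by
    have hX : ∀ᶠ x : ℚ in toInf X, x ∈ X := (eventually_principal.2 fun _ h => h).filter_mono
      inf_le_right
    filter_upwards [hX, (tendsto_cast_toInf X).eventually_ge_atTop 256] with x hx hx1
    exact ⟨hx1, by linarith, x, hx, rfl⟩
  rw [m0, m1] at h₁
  rw [m0, m1, m2] at h₂
  generalize (∑' q : P × ℕ, (1 : ℝ) * (ppSize N (q.1, q.2 + 1))⁻¹) = T at *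
  generalize (∑' q : P × ℕ, (((q.2 + 1 : ℕ) : ℝ) + 1) * (ppSize N (q.1, q.2 + 1))⁻¹) = T' at *
  rw [zeta_eq]
  constructor
  · refine IsBigO.of_bound C₁ ?_
    filter_upwards [hev] with x hx
    have hx0 := hx.2.1
    have hl : 0 ≤ Real.log x := Real.log_nonneg (by linarith [hx.1])
    have := h₁ x hx.2 hx.1
    rw [hFreeLE_eq, finsum_mem_coe_finset, Real.norm_eq_abs, Real.norm_eq_abs,
      abs_of_nonneg (div_nonneg hx0.le hl), div_eq_mul_one_div (x : ℝ)]
    simp only [omega_eq] at this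
    convert this using 3
    rw [h3]
    field_simp
    ring
  · refine IsBigO.of_bound C₂ ?_
    filter_upwards [hev] with x hx
    have hx0 := hx.2.1
    have hl1 : 1 ≤ Real.log x := by
      rw [Real.le_log_iff_exp_le hx0]
      linarith [hx.1, Real.exp_one_lt_d9]
    have hll : 0 ≤ Real.log (Real.log x) := Real.log_nonneg hl1
    have := h₂ x hx.2 hx.1
    rw [hFreeLE_eq, finsum_mem_coe_finset, Real.norm_eq_abs, Real.norm_eq_abs,
      abs_of_nonneg (div_nonneg (mul_nonneg hx0.le hll) (by linarith)), mul_div_assoc (x : ℝ)]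
    simp only [omega_eq] at this
    convert this using 3
    rw [h4, h3]
    field_simp
    ring

end Regular

end

end PrimeMonoid

end

theorem theorem1p1 {P : Type*} [Countable P] (N : P → ℕ) (hN : ∀ p, 2 ≤ N p)
    (X : Set ℚ) (κ θ : ℝ) (hstar : PrimeMonoid.ConditionStar N X κ θ)
    (h : ℕ) (hh : 2 ≤ h) :
    -- the sums, series and limits below are genuine
    (∀ x : ℚ, (PrimeMonoid.normLE N x).Finite) ∧
    (Summable fun m : P →₀ ℕ => (PrimeMonoid.norm N m : ℝ) ^ (-(h : ℝ))) ∧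
    Tendsto (PrimeMonoid.mertensDiff N) (PrimeMonoid.toInf X) (𝓝 (PrimeMonoid.constA N X)) ∧
    (Summable fun p : P => PrimeMonoid.termC3 h (N p)) ∧
    (Summable fun p : P => PrimeMonoid.termC3' h (N p)) ∧
    (Summable fun p : P => PrimeMonoid.termC4 h (N p)) ∧
    -- first moment
    (fun x : ℚ =>
        (∑ᶠ m ∈ PrimeMonoid.hFreeLE N h x, (PrimeMonoid.bigOmega m : ℝ))
          - (κ / PrimeMonoid.zeta N h * x * Real.log (Real.log x)
            + κ * PrimeMonoid.constC3 N X h / PrimeMonoid.zeta N h * x))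
      =O[PrimeMonoid.toInf X] (fun x : ℚ => (x : ℝ) / Real.log x) ∧
    -- second moment
    (fun x : ℚ =>
        (∑ᶠ m ∈ PrimeMonoid.hFreeLE N h x, (PrimeMonoid.bigOmega m : ℝ) ^ 2)
          - (κ / PrimeMonoid.zeta N h * x * Real.log (Real.log x) ^ 2
            + κ * (2 * PrimeMonoid.constC3 N X h + 1) / PrimeMonoid.zeta N h
                * x * Real.log (Real.log x)
            + κ * PrimeMonoid.constC4 N X h / PrimeMonoid.zeta N h * x))
      =O[PrimeMonoid.toInf X]
        (fun x : ℚ => (x : ℝ) * Real.log (Real.log x) / Real.log x) := by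
  rcases isEmpty_or_nonempty P with hP | hP
  · -- Without prime elements the counting function is at most `1`, hence `X` is bounded
    -- above and the filter `x → ∞` in `X` is trivial.
    have hbot : PrimeMonoid.toInf X = ⊥ := hstar.toInf_eq_bot <| Eventually.of_forall fun x =>
      Set.ncard_le_one_of_subsingleton _
    rw [hbot]
    exact ⟨fun x => Set.toFinite _, Summable.of_finite, tendsto_bot, Summable.of_finite,
      Summable.of_finite, Summable.of_finite, isBigO_bot _ _, isBigO_bot _ _⟩
  · have := hstar.toInf_neBot hN
    have := hstar.normFinite hN
    obtain ⟨K, R⟩ := PrimeMonoid.exists_regular hstar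
    obtain ⟨A, C, hA⟩ := R.exists_mertens
    have hlim := PrimeMonoid.tendsto_mertensDiff (X := X) hA
    have hA' : PrimeMonoid.constA N X = A := hlim.limUnder_eq
    refine ⟨hstar.finite_normLE hN, R.summable_size_rpow ?_, hA' ▸ hlim,
      (R.hasSum_termC3 hh).summable, (R.hasSum_termC3' hh).summable, R.summable_termC4 hh,
      R.isBigO_moments hh hA' hA⟩
    exact_mod_cast (by omega : 1 < h)
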